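/- Let $(\Omega,\mathcal F_\infty,(\mathcal F_t)_{t\ge 0},P)$ be a filtered probability space satisfying the usual assumptions (right continuity and completeness), where $\mathcal F_0$ is the $\sigma$-algebra generated by the $P$-null sets. Stopping times take values in $[0,\infty]$ and $\mathcal F_\tau=\{A\in\mathcal F_\infty : A\cap\{\tau\le t\}\in\mathcal F_t\ \forall t\ge 0\}$. Write $L^\infty(\mathcal F_\tau)=L^\infty(\Omega,\mathcal F_\tau,P)$; all (in)equalities between its elements hold almost surely. **Pricing procedures.** A *dynamic pricing procedure* is a family of maps $\Pi_{\sigma,\tau}:L^\infty(\mathcal F_\tau)\to L^\infty(\mathcal F_\sigma)$, indexed by stopping times $\sigma\le\tau$, which are monotone, convex, normalized ($\Pi_{\sigma,\tau}(0)=0$) and translation invariant ($\Pi_{\sigma,\tau}(X+Z)=\Pi_{\sigma,\tau}(X)+Z$ for $Z\in L^\infty(\mathcal F_\sigma)$). It is *sublinear* if $\Pi_{\sigma,\tau}(\lambda X)=\lambda\Pi_{\sigma,\tau}(X)$ for $\lambda>0$. It is a *TCPP* if it is time consistent ($\Pi_{\nu,\sigma}(\Pi_{\sigma,\tau}(X))=\Pi_{\nu,\tau}(X)$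 for all $\nu\le\sigma\le\tau$ and $X\in L^\infty(\mathcal F_\tau)$) and continuous from below (if $X_n\uparrow X$ a.s. with $X_n,X\in L^\infty(\mathcal F_\tau)$, then $\Pi_{\sigma,\tau}(X_n)\to\Pi_{\sigma,\tau}(X)$ a.s.). **No Free Lunch.** Let $\mathcal C=\{\lambda X:\lambda\ge0,\ X\in L^\infty(\mathcal F_\infty),\ \Pi_{0,\infty}(X)\le0\}$, and let $\mathcal K=\{\lambda X:\lambda\ge 0,\ X\in\mathcal K_0\}$, where $\mathcal K_0$ is the set of all $X_0+\sum_{i=1}^n(Z_i-Y_i)$ with $n\geq 0$, $X_0,Y_i,Z_i\in L^\infty(\mathcal F_\infty)$, $\Pi_{0,\infty}(X_0)\le0$, and $\Pi_{\tau_i,\infty}(Z_i)\le-\Pi_{\tau_i,\infty}(-Y_i)$ for some stopping times $0\le\tau_1\le\dots\le\tau_n<\infty$. There is *No Static Free Lunch* (resp. *No Multiperiod Free Lunch*) if the closure $\overline{\mathcal C}$ (resp. $\overline{\mathcal K}$) for the topology $\sigma(L^\infty(P),L^1(P))$ satisfies $\overline{\mathcal C}\cap L^\infty_+=\{0\}$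 (resp. $\overline{\mathcal K}\cap L^\infty_+=\{0\}$). **Reference assets.** Let $S=(S^k)_{0\le k\le d}$ be adapted real processes indexed by $[0,\infty)$ with $S^0=1$ and $S^1,\dots,S^d$ locally bounded. On $\{\tau=\infty\}$, $S^k_\tau$ means $\lim_{t\to\infty}S^k_t$; the condition "$S^k_\tau\in L^\infty(\mathcal F_\tau)$" includes that this limit exists a.s. on $\{\tau=\infty\}$. A pricing procedure *extends the dynamics of $S$* if $\Pi_{\sigma,\tau}(nS^k_\tau)=nS^k_\sigma$ for all $0\le k\le d$, $n\in\mathbb Z$, and stopping times $\sigma\le\tau$ with $S^k_\tau\in L^\infty(\mathcal F_\tau)$. Let $\mathcal M^e$ be the set of equivalent local martingale measures, meaning here the probability measures $Q\sim P$ on $\mathcal F_\infty$ such that $E_Q(S^k_\tau\mid\mathcal F_\sigma)=S^k_\sigma$ a.s. for all $0\le k\le d$ and all stopping times $\sigma\le\tau$ with $S^k_\tau\in L^\infty(\mathcal F_\tau)$. **Stable sets.** A set $\mathcal Q$ of probability measures equivalent to $P$ is *stable* if for all $Q,R\in\mathcal Q$ and every stopping time $\tau$ there is $T\in\mathcal Q$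 with $E_T(X)=E_Q\big(E_R(X\mid\mathcal F_\tau)\big)$ for all bounded $\mathcal F_\infty$-measurable $X$. **Statement.** 1. Let $(\Pi_{\sigma,\tau})$ be a sublinear TCPP which extends the dynamics of $S$ and has No Free Lunch (static or multiperiod: either one suffices). Then there is a nonempty stable subset $\mathcal Q\subseteq\mathcal M^e$ such that for all stopping times $\sigma\le\tau$ and all $X\in L^\infty(\mathcal F_\tau)$, $$\Pi_{\sigma,\tau}(X)=\operatorname*{ess\,sup}_{Q\in\mathcal Q}E_Q(X\mid\mathcal F_\sigma).\qquad(*)$$ 2. Conversely, let $\mathcal Q\subseteq\mathcal M^e$ be nonempty and stable. Then $(*)$ defines a unique family of maps $\Pi_{\sigma,\tau}:L^\infty(\mathcal F_\tau)\to L^\infty(\mathcal F_\sigma)$, and this family is a sublinear TCPP which has No Static Free Lunch and No Multiperiod Free Lunch and which extends the dynamics of $S$. -/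

import Mathlib

open MeasureTheory ProbabilityTheory Filter Topology
open scoped NNReal ENNReal

namespace TCPP

noncomputable section

/-! ### Filtered probability space, stopping times and `L^∞(F_τ)` -/

/-- Stopping times with values in `[0, ∞]`. They are ordered pointwise. -/
abbrev StoppingTime {Ω : Type*} [mΩ : MeasurableSpace Ω] (F : Filtration ℝ≥0 mΩ) : Type _ :=
  {τ : Ω → WithTop ℝ≥0 // IsStoppingTime F τ}

/-- The stopping time `0`. -/
def StoppingTime.zero {Ω : Type*} [mΩ : MeasurableSpace Ω] (F : Filtration ℝ≥0 mΩ) :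
    StoppingTime F :=
  ⟨fun _ => ((0 : ℝ≥0) : WithTop ℝ≥0), isStoppingTime_const F 0⟩

/-- The stopping time `∞`. -/
def StoppingTime.infty {Ω : Type*} [mΩ : MeasurableSpace Ω] (F : Filtration ℝ≥0 mΩ) :
    StoppingTime F :=
  ⟨fun _ => ⊤, fun i => by simp⟩

theorem StoppingTime.zero_le {Ω : Type*} [mΩ : MeasurableSpace Ω] {F : Filtration ℝ≥0 mΩ}
    (τ : StoppingTime F) : StoppingTime.zero F ≤ τ := fun ω => by
  show ((0 : ℝ≥0) : WithTop ℝ≥0) ≤ τ.1 ω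
  exact bot_le

theorem StoppingTime.le_infty {Ω : Type*} [mΩ : MeasurableSpace Ω] {F : Filtration ℝ≥0 mΩ}
    (τ : StoppingTime F) : τ ≤ StoppingTime.infty F := fun _ => le_top

/-- `F_τ = {A ∈ F_∞ | ∀ t, A ∩ {τ ≤ t} ∈ F_t}`, where `F_∞` is the σ-algebra of the
probability space (so that `F_τ` is `F_∞` for `τ = ∞`). -/
@[reducible] def sigmaAt {Ω : Type*} [mΩ : MeasurableSpace Ω] {F : Filtration ℝ≥0 mΩ}
    (τ : StoppingTime F) : MeasurableSpace Ω where
  MeasurableSet' A :=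
    MeasurableSet[mΩ] A ∧ ∀ t : ℝ≥0, MeasurableSet[F t] (A ∩ {ω | τ.1 ω ≤ t})
  measurableSet_empty := by simp
  measurableSet_compl A hA := by
    refine ⟨hA.1.compl, fun t => ?_⟩
    have h : Aᶜ ∩ {ω | τ.1 ω ≤ t} = {ω | τ.1 ω ≤ t} \ (A ∩ {ω | τ.1 ω ≤ t}) := by
      ext ω; simp only [Set.mem_inter_iff, Set.mem_compl_iff, Set.mem_sdiff]; tauto
    rw [h]
    exact (τ.2 t).diff (hA.2 t)
  measurableSet_iUnion f hf := by
    refine ⟨MeasurableSet.iUnion fun i => (hf i).1, fun t => ?_⟩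
    rw [Set.iUnion_inter]
    exact MeasurableSet.iUnion fun i => (hf i).2 t

theorem sigmaAt_mono {Ω : Type*} [mΩ : MeasurableSpace Ω] {F : Filtration ℝ≥0 mΩ}
    {σ τ : StoppingTime F} (h : σ ≤ τ) : sigmaAt σ ≤ sigmaAt τ := by
  refine fun A hA => ⟨hA.1, fun t => ?_⟩
  have e : A ∩ {ω | τ.1 ω ≤ t} = (A ∩ {ω | σ.1 ω ≤ t}) ∩ {ω | τ.1 ω ≤ t} := by
    ext ω
    have hle : σ.1 ω ≤ τ.1 ω := h ω
    constructor
    · rintro ⟨h1, h2⟩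
      exact ⟨⟨h1, le_trans hle h2⟩, h2⟩
    · rintro ⟨⟨h1, _⟩, h2⟩
      exact ⟨h1, h2⟩
  rw [e]
  exact (hA.2 t).inter (τ.2 t)

/-- The usual assumptions: the filtration is right continuous, `P` is complete, and `F_0` is the
σ-algebra generated by the `P`-null sets (so `F_0` is `P`-trivial, and every `F_t` contains the
null sets). -/
structure UsualAssumptions {Ω : Type*} [mΩ : MeasurableSpace Ω] (F : Filtration ℝ≥0 mΩ)
    (P : Measure Ω) : Prop where
  rightContinuous : F.IsRightContinuous
  complete : P.IsComplete
  initial : F 0 = MeasurableSpace.generateFrom {N : Set Ω | P N = 0}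

/-- `L^∞(F_τ)`, as a subspace of `L^∞(Ω, F_∞, P)`: the classes which have an
`F_τ`-measurable representative. -/
abbrev LInf {Ω : Type*} [mΩ : MeasurableSpace Ω] (F : Filtration ℝ≥0 mΩ) (P : Measure Ω)
    (τ : StoppingTime F) : Submodule ℝ (Lp ℝ ∞ P) :=
  lpMeas ℝ ℝ (sigmaAt τ) ∞ P

theorem LInf_mono {Ω : Type*} [mΩ : MeasurableSpace Ω] {F : Filtration ℝ≥0 mΩ} {P : Measure Ω}
    {σ τ : StoppingTime F} (h : σ ≤ τ) : LInf F P σ ≤ LInf F P τ := fun X hX => by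
  rw [mem_lpMeas_iff_aestronglyMeasurable] at hX ⊢
  exact hX.mono (sigmaAt_mono h)

/-- The inclusion of `L^∞(F_σ)` in `L^∞(F_τ)` for `σ ≤ τ`. -/
def LInf.incl {Ω : Type*} [mΩ : MeasurableSpace Ω] {F : Filtration ℝ≥0 mΩ} {P : Measure Ω}
    {σ τ : StoppingTime F} (h : σ ≤ τ) : LInf F P σ →ₗ[ℝ] LInf F P τ :=
  Submodule.inclusion (LInf_mono h)

/-! ### Dynamic pricing procedures -/

/-- A family of maps `Π_{σ,τ} : L^∞(F_τ) → L^∞(F_σ)`, indexed by stopping times `σ ≤ τ`. -/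
abbrev PriceFamily {Ω : Type*} [mΩ : MeasurableSpace Ω] (F : Filtration ℝ≥0 mΩ)
    (P : Measure Ω) : Type _ :=
  ∀ σ τ : StoppingTime F, σ ≤ τ → LInf F P τ → LInf F P σ

section Properties

variable {Ω : Type*} [mΩ : MeasurableSpace Ω] {F : Filtration ℝ≥0 mΩ} {P : Measure Ω}

/-- The axioms of a dynamic pricing procedure. -/
structure IsDynamicPricing (Pr : PriceFamily F P) : Prop where
  monotone : ∀ (σ τ : StoppingTime F) (h : σ ≤ τ) (X Y : LInf F P τ),
    X ≤ Y → Pr σ τ h X ≤ Pr σ τ h Y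
  translation : ∀ (σ τ : StoppingTime F) (h : σ ≤ τ) (X : LInf F P τ) (Z : LInf F P σ),
    Pr σ τ h (X + LInf.incl h Z) = Pr σ τ h X + Z
  convex : ∀ (σ τ : StoppingTime F) (h : σ ≤ τ) (X Y : LInf F P τ) (l : ℝ),
    0 ≤ l → l ≤ 1 → Pr σ τ h (l • X + (1 - l) • Y) ≤ l • Pr σ τ h X + (1 - l) • Pr σ τ h Y
  normalized : ∀ (σ τ : StoppingTime F) (h : σ ≤ τ), Pr σ τ h 0 = 0

/-- Sublinearity, i.e. positive homogeneity. -/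
def IsSublinear (Pr : PriceFamily F P) : Prop :=
  ∀ (σ τ : StoppingTime F) (h : σ ≤ τ) (l : ℝ) (X : LInf F P τ),
    0 < l → Pr σ τ h (l • X) = l • Pr σ τ h X

def IsTimeConsistent (Pr : PriceFamily F P) : Prop :=
  ∀ (ν σ τ : StoppingTime F) (h₁ : ν ≤ σ) (h₂ : σ ≤ τ) (X : LInf F P τ),
    Pr ν σ h₁ (Pr σ τ h₂ X) = Pr ν τ (h₁.trans h₂) X

/-- Continuity from below: along increasing sequences `X_n` in `L^∞(F_τ)` which converge almost
surely to an element `X` of `L^∞(F_τ)`. -/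
def IsContinuousFromBelow (Pr : PriceFamily F P) : Prop :=
  ∀ (σ τ : StoppingTime F) (h : σ ≤ τ) (X : ℕ → LInf F P τ) (Y : LInf F P τ),
    Monotone X →
    (∀ᵐ ω ∂P, Tendsto (fun n => (X n : Lp ℝ ∞ P) ω) atTop (𝓝 ((Y : Lp ℝ ∞ P) ω))) →
    ∀ᵐ ω ∂P, Tendsto (fun n => (Pr σ τ h (X n) : Lp ℝ ∞ P) ω) atTop
      (𝓝 ((Pr σ τ h Y : Lp ℝ ∞ P) ω))

/-- A TCPP: a time-consistent dynamic pricing procedure which is continuous from below. -/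
structure IsTCPP (Pr : PriceFamily F P) : Prop extends IsDynamicPricing Pr where
  timeConsistent : IsTimeConsistent Pr
  continuousFromBelow : IsContinuousFromBelow Pr

end Properties

/-! ### No Free Lunch -/

/-- The weak* topology `σ(L^∞(P), L^1(P))`. -/
@[reducible] def weakStar {Ω : Type*} [mΩ : MeasurableSpace Ω] (P : Measure Ω) :
    TopologicalSpace (Lp ℝ ∞ P) :=
  TopologicalSpace.induced (fun (X : Lp ℝ ∞ P) (g : Lp ℝ 1 P) => ∫ ω, g ω * X ω ∂P)
    Pi.topologicalSpace

section NoFreeLunch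

variable {Ω : Type*} [mΩ : MeasurableSpace Ω] {F : Filtration ℝ≥0 mΩ} {P : Measure Ω}

/-- `{λ X | λ ≥ 0, X ∈ A}`. -/
def nonnegMultiples (A : Set (Lp ℝ ∞ P)) : Set (Lp ℝ ∞ P) :=
  {Y | ∃ l : ℝ, 0 ≤ l ∧ ∃ X ∈ A, Y = l • X}

/-- The financial products available at time zero at a nonpositive price. -/
def staticZeroCost (Pr : PriceFamily F P) : Set (Lp ℝ ∞ P) :=
  {Y | ∃ X : LInf F P (StoppingTime.infty F),
    Pr (StoppingTime.zero F) (StoppingTime.infty F) (StoppingTime.zero_le _) X ≤ 0 ∧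
      Y = (X : Lp ℝ ∞ P)}

/-- The financial products attainable at zero cost via simple strategies: one gets `X₀` at time
zero, and at the finite stopping times `ρ 0 ≤ ρ 1 ≤ …` one sells `Y i` and buys `Z i`. -/
def simpleZeroCost (Pr : PriceFamily F P) : Set (Lp ℝ ∞ P) :=
  {W | ∃ (n : ℕ) (ρ : Fin n → StoppingTime F) (X₀ : LInf F P (StoppingTime.infty F))
      (Y Z : Fin n → LInf F P (StoppingTime.infty F)),
    Monotone ρ ∧ (∀ i, ∀ᵐ ω ∂P, (ρ i).1 ω ≠ ⊤) ∧
    Pr (StoppingTime.zero F) (StoppingTime.infty F) (StoppingTime.zero_le _) X₀ ≤ 0 ∧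
    (∀ i, Pr (ρ i) (StoppingTime.infty F) (StoppingTime.le_infty _) (Z i) ≤
      -Pr (ρ i) (StoppingTime.infty F) (StoppingTime.le_infty _) (-Y i)) ∧
    W = ((X₀ + ∑ i, (Z i - Y i) : LInf F P (StoppingTime.infty F)) : Lp ℝ ∞ P)}

def NoStaticFreeLunch (Pr : PriceFamily F P) : Prop :=
  closure[weakStar P] (nonnegMultiples (staticZeroCost Pr)) ∩ {X | 0 ≤ X} = {0}

def NoMultiperiodFreeLunch (Pr : PriceFamily F P) : Prop :=
  closure[weakStar P] (nonnegMultiples (simpleZeroCost Pr)) ∩ {X | 0 ≤ X} = {0}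

end NoFreeLunch

/-! ### Reference assets -/

/-- A locally bounded process: it is uniformly bounded when stopped along some sequence of
stopping times which increases to `∞`. -/
def IsLocallyBounded {Ω : Type*} [mΩ : MeasurableSpace Ω] (F : Filtration ℝ≥0 mΩ)
    (P : Measure Ω) (V : ℝ≥0 → Ω → ℝ) : Prop :=
  ∃ ρ : ℕ → Ω → WithTop ℝ≥0, IsLocalizingSequence F ρ P ∧
    ∀ n, ∃ C : ℝ, ∀ᵐ ω ∂P, ∀ t : ℝ≥0,
      |stoppedValue V (fun ω => min (t : WithTop ℝ≥0) (ρ n ω)) ω| ≤ C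

/-- The reference assets: adapted processes, the numéraire `S 0 = 1` and locally bounded
processes `S 1, …, S d`. -/
structure IsReferenceMarket {Ω : Type*} [mΩ : MeasurableSpace Ω] (F : Filtration ℝ≥0 mΩ)
    (P : Measure Ω) {d : ℕ} (S : Fin (d + 1) → ℝ≥0 → Ω → ℝ) : Prop where
  numeraire : ∀ t ω, S 0 t ω = 1
  adapted : ∀ k, Adapted F (S k)
  locallyBounded : ∀ k, k ≠ 0 → IsLocallyBounded F P (S k)

/-- `V_τ`, with the usual convention `V_∞ = lim_{t → ∞} V_t`. It is only used where this limit
exists, see `HasValueAt`. -/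
def valueAt {Ω : Type*} (V : ℝ≥0 → Ω → ℝ) (τ : Ω → WithTop ℝ≥0) (ω : Ω) : ℝ :=
  if τ ω = ⊤ then limUnder atTop (fun t : ℝ≥0 => V t ω) else stoppedValue V τ ω

/-- `V_τ` is well defined: almost surely on `{τ = ∞}` the limit `V_∞` exists.
This holds for every `V` if `τ` is almost surely finite. -/
def HasValueAt {Ω : Type*} [mΩ : MeasurableSpace Ω] (P : Measure Ω) (V : ℝ≥0 → Ω → ℝ)
    (τ : Ω → WithTop ℝ≥0) : Prop :=
  ∀ᵐ ω ∂P, τ ω = ⊤ → ∃ l : ℝ, Tendsto (fun t : ℝ≥0 => V t ω) atTop (𝓝 l)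

/-- `Π_{σ,τ}(n S^k_τ) = n S^k_σ` for all integers `n` and all `σ ≤ τ` such that
`S^k_τ ∈ L^∞(F_τ)`; here `X` is the class of `S^k_τ`. -/
def ExtendsDynamics {Ω : Type*} [mΩ : MeasurableSpace Ω] {F : Filtration ℝ≥0 mΩ}
    {P : Measure Ω} {d : ℕ} (S : Fin (d + 1) → ℝ≥0 → Ω → ℝ) (Pr : PriceFamily F P) : Prop :=
  ∀ (k : Fin (d + 1)) (n : ℤ) (σ τ : StoppingTime F) (h : σ ≤ τ) (X : LInf F P τ),
    HasValueAt P (S k) τ.1 → (X : Lp ℝ ∞ P) =ᵐ[P] valueAt (S k) τ.1 →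
    (Pr σ τ h ((n : ℝ) • X) : Lp ℝ ∞ P) =ᵐ[P] fun ω => (n : ℝ) * valueAt (S k) σ.1 ω

/-- `Q ≪ P` is a local martingale measure for `S`: `E_Q(S^k_τ | F_σ) = S^k_σ` `Q`-a.s. for all
`σ ≤ τ` such that `S^k_τ ∈ L^∞(F_τ)`; here `X` is the class of `S^k_τ`. -/
def IsLocalMartingaleMeasure {Ω : Type*} [mΩ : MeasurableSpace Ω] (F : Filtration ℝ≥0 mΩ)
    (P : Measure Ω) {d : ℕ} (S : Fin (d + 1) → ℝ≥0 → Ω → ℝ) (Q : Measure Ω) : Prop :=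
  ∀ (k : Fin (d + 1)) (σ τ : StoppingTime F), σ ≤ τ → ∀ X : LInf F P τ,
    HasValueAt P (S k) τ.1 → (X : Lp ℝ ∞ P) =ᵐ[P] valueAt (S k) τ.1 →
    Q[(X : Lp ℝ ∞ P) | sigmaAt σ] =ᵐ[Q] valueAt (S k) σ.1

/-- The set of probability measures equivalent to `P` which are local martingale measures. -/
def EquivalentLMM {Ω : Type*} [mΩ : MeasurableSpace Ω] (F : Filtration ℝ≥0 mΩ)
    (P : Measure Ω) {d : ℕ} (S : Fin (d + 1) → ℝ≥0 → Ω → ℝ) : Set (Measure Ω) :=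
  {Q | IsProbabilityMeasure Q ∧ Q ≪ P ∧ P ≪ Q ∧ IsLocalMartingaleMeasure F P S Q}

/-! ### Stable sets and the dual representation -/

/-- Stability of a set of equivalent probability measures: for `Q`, `R` in the set and a stopping
time `τ`, the measure obtained by following `Q` until `τ` and `R` after `τ`, i.e. the
probability measure `T` with `E_T(X) = E_Q(E_R(X | F_τ))`, is in the set. -/
def IsStableSet {Ω : Type*} [mΩ : MeasurableSpace Ω] (F : Filtration ℝ≥0 mΩ)
    (𝒬 : Set (Measure Ω)) : Prop :=
  ∀ Q ∈ 𝒬, ∀ R ∈ 𝒬, ∀ τ : StoppingTime F, ∃ T ∈ 𝒬,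
    ∀ X : Ω → ℝ, Measurable X → (∃ C : ℝ, ∀ ω, |X ω| ≤ C) →
      ∫ ω, X ω ∂T = ∫ ω, (R[X | sigmaAt τ]) ω ∂Q

/-- `Y` is the `P`-essential supremum of the family `f`. -/
structure IsEssSup {Ω : Type*} [mΩ : MeasurableSpace Ω] (P : Measure Ω) {ι : Type*}
    (f : ι → Ω → ℝ) (Y : Ω → ℝ) : Prop where
  aemeasurable : AEMeasurable Y P
  upper : ∀ i, f i ≤ᵐ[P] Y
  least : ∀ Z : Ω → ℝ, AEMeasurable Z P → (∀ i, f i ≤ᵐ[P] Z) → Y ≤ᵐ[P] Z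

/-- `Π_{σ,τ}(X) = esssup_{Q ∈ 𝒬} E_Q(X | F_σ)` for all `σ ≤ τ` and `X ∈ L^∞(F_τ)`. -/
def IsRepresentedBy {Ω : Type*} [mΩ : MeasurableSpace Ω] {F : Filtration ℝ≥0 mΩ}
    {P : Measure Ω} (Pr : PriceFamily F P) (𝒬 : Set (Measure Ω)) : Prop :=
  ∀ (σ τ : StoppingTime F) (h : σ ≤ τ) (X : LInf F P τ),
    IsEssSup P (fun Q : 𝒬 => (Q : Measure Ω)[(X : Lp ℝ ∞ P) | sigmaAt σ])
      (Pr σ τ h X : Lp ℝ ∞ P)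

end

end TCPP

/-! Part 1 reduces the dynamic problem to one scalar functional. Put ρ(X) = E_P(Π_{0,∞}(X))
(`meanPrice`). It is monotone, sublinear, cash-additive and continuous from below, and time
consistency gives ρ(Π_{σ,∞}(X)) = ρ(X). The set 𝒬 consists of all Q ∼ P with E_Q ≤ ρ
(`pricingMeasures`).

The analytic core is the duality `IsCoherent.exists_measure_lt`: if a < ρ(X), some probability
measure Q ≪ P satisfies E_Q ≤ ρ and a < E_Q(X). Norm separation alone would give only a finitely
additive measure. Instead the convex set of all Y with ρ(X - Y) ≤ 0 is separated from a convex
neighbourhood U of zero, large enough to contain M·1_A for every M as soon as P(A) is small,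
depending on M. A functional bounded above on such a U is countably additive. That U can be kept
disjoint from the other set rests on the Fatou property of ρ and on a compactness argument in L².

No Free Lunch says ρ(1_A) > 0 whenever P(A) > 0, so by exhaustion some dominated measure is
equivalent to P. Both inequalities of (*) then come from testing on a set A ∈ F_σ: prices are local,
so ρ can be evaluated on 1_A(X - Z) with Z ∈ L^∞(F_σ) (`condExp_le_price`, `price_le_of_isEssSup`).
Stability of 𝒬 and the martingale property both follow from E_Q(X|F_σ) ≤ Π_{σ,∞}(X).

Part 2 rests on stability. Pasting along a stopping time that equals σ on an event and ∞ elsewhere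
makes {E_Q(X|F_σ)} directed upwards (`IsStableSet.exists_ge`), so the essential supremum is the
limit of a sequence; pasting again at σ gives time consistency. Any single Q ∈ 𝒬 excludes free
lunches, since {E_Q ≤ 0} is weak-star closed and Q ∼ P. -/

namespace TCPP

/-! ### Elements of `L^∞(P)` as bounded functions -/

section Basic

variable {Ω : Type*} [mΩ : MeasurableSpace Ω] {P : Measure Ω}

theorem ae_abs_le_norm (X : Lp ℝ ∞ P) : ∀ᵐ ω ∂P, |X ω| ≤ ‖X‖ := by
  filter_upwards [ae_le_eLpNormEssSup (f := (X : Ω → ℝ)) (μ := P)] with ω hω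
  rw [Lp.norm_def, eLpNorm_exponent_top, ← Real.norm_eq_abs, ← toReal_enorm]
  refine ENNReal.toReal_mono ?_ hω
  rw [← eLpNorm_exponent_top]
  exact Lp.eLpNorm_ne_top X

theorem aemeasurable_coeFn (X : Lp ℝ ∞ P) : AEMeasurable X P :=
  (Lp.aestronglyMeasurable X).aemeasurable

theorem integrable_of_absolutelyContinuous {Q : Measure Ω} [IsFiniteMeasure Q] (hQ : Q ≪ P)
    (X : Lp ℝ ∞ P) : Integrable X Q :=
  Integrable.of_bound ((Lp.aestronglyMeasurable X).mono_ac hQ) ‖X‖ (hQ.ae_le (ae_abs_le_norm X))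

theorem Lp_le_iff {X Y : Lp ℝ ∞ P} : X ≤ Y ↔ ∀ᵐ ω ∂P, X ω ≤ Y ω :=
  (Lp.coeFn_le X Y).symm

theorem exists_Lp_of_bound {f : Ω → ℝ} (hf : AEStronglyMeasurable f P) (C : ℝ)
    (h : ∀ᵐ ω ∂P, |f ω| ≤ C) : ∃ X : Lp ℝ ∞ P, X =ᵐ[P] f :=
  ⟨(memLp_top_of_bound hf C h).toLp f, MemLp.coeFn_toLp _⟩

theorem coeFn_smul' (c : ℝ) (X : Lp ℝ ∞ P) : ∀ᵐ ω ∂P, (c • X : Lp ℝ ∞ P) ω = c * X ω := by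
  filter_upwards [Lp.coeFn_smul c X] with ω h
  simp [h]

theorem coeFn_add' (X Y : Lp ℝ ∞ P) : ∀ᵐ ω ∂P, (X + Y : Lp ℝ ∞ P) ω = X ω + Y ω :=
  Lp.coeFn_add X Y

theorem coeFn_sub' (X Y : Lp ℝ ∞ P) : ∀ᵐ ω ∂P, (X - Y : Lp ℝ ∞ P) ω = X ω - Y ω :=
  Lp.coeFn_sub X Y

theorem coeFn_neg' (X : Lp ℝ ∞ P) : ∀ᵐ ω ∂P, (-X : Lp ℝ ∞ P) ω = -X ω :=
  Lp.coeFn_neg X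

theorem coeFn_zero' : ∀ᵐ ω ∂P, (0 : Lp ℝ ∞ P) ω = 0 :=
  Lp.coeFn_zero _ _ _

theorem coeFn_const' [IsFiniteMeasure P] (c : ℝ) : ∀ᵐ ω ∂P, (Lp.const ∞ P c) ω = c :=
  Lp.coeFn_const ∞ P c

theorem Lp_le_const_norm [IsFiniteMeasure P] (X : Lp ℝ ∞ P) : X ≤ Lp.const ∞ P ‖X‖ := by
  rw [Lp_le_iff]
  filter_upwards [ae_abs_le_norm X, coeFn_const' (P := P) ‖X‖] with ω h1 h2
  rw [h2]; exact (abs_le.1 h1).2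

theorem const_mono [IsFiniteMeasure P] {a b : ℝ} (h : a ≤ b) :
    Lp.const ∞ P a ≤ Lp.const ∞ P b := by
  rw [Lp_le_iff]
  filter_upwards [coeFn_const' (P := P) a, coeFn_const' (P := P) b] with ω h1 h2
  rwa [h1, h2]

theorem smul_const [IsFiniteMeasure P] (a b : ℝ) :
    a • Lp.const ∞ P b = Lp.const ∞ P (a * b) :=
  rfl

theorem smul_mono_Lp {c : ℝ} (hc : 0 ≤ c) {X Y : Lp ℝ ∞ P} (h : X ≤ Y) : c • X ≤ c • Y := by
  rw [Lp_le_iff] at h ⊢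
  filter_upwards [h, coeFn_smul' c X, coeFn_smul' c Y] with ω h1 h2 h3
  rw [h2, h3]; gcongr

end Basic

/-! ### Essential suprema of bounded families -/

section EssSup

variable {Ω : Type*} [mΩ : MeasurableSpace Ω] {P : Measure Ω} {ι : Type*}

theorem abs_iSup_le_of_forall {u : ℕ → ℝ} {C : ℝ} (h : ∀ n, |u n| ≤ C) : |⨆ n, u n| ≤ C := by
  have hb : BddAbove (Set.range u) := ⟨C, by rintro _ ⟨n, rfl⟩; exact (abs_le.1 (h n)).2⟩
  exact abs_le.2 ⟨(abs_le.1 (h 0)).1.trans (le_ciSup hb 0), ciSup_le fun n => (abs_le.1 (h n)).2⟩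

/-- Among suprema over countable subfamilies, one of maximal integral exists; adjoining a further
member cannot raise its integral, hence leaves it unchanged almost everywhere. -/
theorem exists_seq_ae_le_iSup [IsFiniteMeasure P] [Nonempty ι] (f : ι → Ω → ℝ)
    (hf : ∀ i, AEMeasurable (f i) P) (C : ℝ) (hC : ∀ i, ∀ᵐ ω ∂P, |f i ω| ≤ C) :
    ∃ s : ℕ → ι, ∀ i, f i ≤ᵐ[P] fun ω => ⨆ n, f (s n) ω := by
  set g : (ℕ → ι) → Ω → ℝ := fun s ω => ⨆ n, f (s n) ω with hg
  have hbd : ∀ s : ℕ → ι, ∀ᵐ ω ∂P, ∀ n, |f (s n) ω| ≤ C := fun s => ae_all_iff.2 fun n => hC _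
  have hbdd : ∀ (s : ℕ → ι) ω, (∀ n, |f (s n) ω| ≤ C) → BddAbove (Set.range fun n => f (s n) ω) :=
    fun s ω h => ⟨C, by rintro _ ⟨n, rfl⟩; exact (abs_le.1 (h n)).2⟩
  have hgb : ∀ s, ∀ᵐ ω ∂P, |g s ω| ≤ C := fun s => by
    filter_upwards [hbd s] with ω hω using abs_iSup_le_of_forall hω
  have hgm : ∀ s, AEMeasurable (g s) P := fun s => AEMeasurable.iSup fun n => hf _
  have hgi : ∀ s, Integrable (g s) P := fun s =>
    Integrable.of_bound (hgm s).aestronglyMeasurable C (hgb s)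
  have hmono : ∀ s t : ℕ → ι, (∀ n, ∃ m, s n = t m) → g s ≤ᵐ[P] g t := fun s t h => by
    filter_upwards [hbd t] with ω hω
    refine ciSup_le fun n => ?_
    obtain ⟨m, hm⟩ := h n
    rw [hm]
    exact le_ciSup (hbdd t ω hω) m
  set Φ : (ℕ → ι) → ℝ := fun s => ∫ ω, g s ω ∂P with hΦ
  have hΦb : BddAbove (Set.range Φ) := by
    refine ⟨∫ _, C ∂P, ?_⟩
    rintro _ ⟨s, rfl⟩
    refine integral_mono_ae (hgi s) (integrable_const C) ?_
    filter_upwards [hgb s] with ω hω using (abs_le.1 hω).2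
  have hα : ∀ k : ℕ, ∃ s, (⨆ s, Φ s) - 1 / ((k : ℝ) + 1) < Φ s := fun k =>
    exists_lt_of_lt_ciSup (by linarith [Nat.one_div_pos_of_nat (α := ℝ) (n := k)])
  choose S hS using hα
  -- The near-optimal sequences `S k` are merged into one through the pairing of ℕ × ℕ with ℕ.
  let s : ℕ → ι := fun n => S n.unpair.1 n.unpair.2
  have hs : (⨆ s, Φ s) ≤ Φ s := by
    refine le_of_forall_pos_lt_add fun ε hε => ?_
    obtain ⟨k, hk⟩ := exists_nat_one_div_lt hε
    have h1 : Φ (S k) ≤ Φ s := integral_mono_ae (hgi _) (hgi _)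
      (hmono _ _ fun n => ⟨Nat.pair k n, by simp [s]⟩)
    linarith [hS k]
  refine ⟨s, fun i => ?_⟩
  let t : ℕ → ι := fun n => Nat.casesOn n i s
  have hst : g s ≤ᵐ[P] g t := hmono _ _ fun n => ⟨n + 1, rfl⟩
  have hle : Φ t ≤ Φ s := (le_ciSup hΦb t).trans hs
  have heq : g s =ᵐ[P] g t := by
    have h0 : ∫ ω, (g t ω - g s ω) ∂P = 0 := by
      refine le_antisymm ?_ (integral_nonneg_of_ae ?_)
      · rw [integral_sub (hgi _) (hgi _)]; exact sub_nonpos.2 hle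
      · filter_upwards [hst] with ω hω using sub_nonneg.2 hω
    have h1 := (integral_eq_zero_iff_of_nonneg_ae (by
      filter_upwards [hst] with ω hω using sub_nonneg.2 hω) ((hgi t).sub (hgi s))).1 h0
    filter_upwards [h1] with ω hω
    exact (sub_eq_zero.1 (hω : g t ω - g s ω = 0)).symm
  filter_upwards [heq, hbd t] with ω h1 h2
  show f i ω ≤ g s ω
  rw [h1]
  exact le_ciSup (hbdd t ω h2) 0

theorem isEssSup_iSup_seq (f : ι → Ω → ℝ) (hf : ∀ i, AEMeasurable (f i) P) (s : ℕ → ι)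
    (hs : ∀ i, f i ≤ᵐ[P] fun ω => ⨆ n, f (s n) ω) :
    IsEssSup P f fun ω => ⨆ n, f (s n) ω where
  aemeasurable := AEMeasurable.iSup fun n => hf _
  upper := hs
  least Z _ h := by
    filter_upwards [ae_all_iff.2 fun n => h (s n)] with ω hω using ciSup_le hω

theorem IsEssSup.ae_eq {f : ι → Ω → ℝ} {Y Z : Ω → ℝ} (hY : IsEssSup P f Y)
    (hZ : IsEssSup P f Z) : Y =ᵐ[P] Z :=
  (hY.least Z hZ.aemeasurable hZ.upper).antisymm (hZ.least Y hY.aemeasurable hY.upper)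

theorem IsEssSup.congr {f : ι → Ω → ℝ} {Y Z : Ω → ℝ} (hY : IsEssSup P f Y)
    (h : Y =ᵐ[P] Z) : IsEssSup P f Z where
  aemeasurable := hY.aemeasurable.congr h
  upper i := (hY.upper i).trans h.le
  least W hW hi := h.symm.le.trans (hY.least W hW hi)

end EssSup

/-! ### Compactness of bounded convex sets -/

section Compactness

/-- This stands in for weak compactness. The points of least norm in the `D n` form a Cauchy
sequence: their norms increase and stay bounded, and the obtuse-angle inequality `hin` bounds
distances by differences of squared norms. -/
theorem exists_mem_iInter_of_convex_bounded {E : Type*} [NormedAddCommGroup E]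
    [InnerProductSpace ℝ E] [CompleteSpace E] (D : ℕ → Set E) (hne : ∀ n, (D n).Nonempty)
    (hcl : ∀ n, IsClosed (D n)) (hco : ∀ n, Convex ℝ (D n)) (hanti : Antitone D) (R : ℝ)
    (hR : ∀ x ∈ D 0, ‖x‖ ≤ R) : (⋂ n, D n).Nonempty := by
  have key := fun n => exists_norm_eq_iInf_of_complete_convex (hne n) (hcl n).isComplete (hco n) 0
  choose v hv hvn using key
  have hin : ∀ n, ∀ w ∈ D n, ‖v n‖ ^ 2 + ‖w - v n‖ ^ 2 ≤ ‖w‖ ^ 2 := fun n w hw => by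
    have h := (norm_eq_iInf_iff_real_inner_le_zero (hco n) (hv n)).1 (hvn n) w hw
    have h2 := norm_add_sq_real (v n) (w - v n)
    rw [add_sub_cancel] at h2
    rw [zero_sub, inner_neg_left] at h
    linarith
  have hmono : Monotone fun n => ‖v n‖ ^ 2 := monotone_nat_of_le_succ fun n => by
    have := hin n _ (hanti (Nat.le_succ n) (hv (n + 1)))
    nlinarith [sq_nonneg ‖v (n + 1) - v n‖]
  have hbd : BddAbove (Set.range fun n => ‖v n‖ ^ 2) := by
    refine ⟨R ^ 2, ?_⟩
    rintro _ ⟨n, rfl⟩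
    have := hR _ (hanti (Nat.zero_le n) (hv n))
    show ‖v n‖ ^ 2 ≤ R ^ 2
    gcongr
  have hlim := tendsto_atTop_ciSup hmono hbd
  have hcau : CauchySeq v := by
    rw [Metric.cauchySeq_iff']
    intro ε hε
    obtain ⟨N, hN⟩ := Metric.cauchySeq_iff'.1 hlim.cauchySeq (ε ^ 2) (by positivity)
    refine ⟨N, fun n hn => ?_⟩
    have h1 := hN n hn
    have h2 := hin N _ (hanti hn (hv n))
    rw [Real.dist_eq] at h1
    have h3 := (abs_lt.1 h1).2
    rw [dist_eq_norm]
    exact lt_of_pow_lt_pow_left₀ 2 hε.le (by linarith)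
  obtain ⟨x, hx⟩ := cauchySeq_tendsto_of_complete hcau
  refine ⟨x, Set.mem_iInter.2 fun n => (hcl n).mem_of_tendsto hx ?_⟩
  filter_upwards [eventually_ge_atTop n] with m hm using hanti hm (hv m)

variable {Ω : Type*} [mΩ : MeasurableSpace Ω] {P : Measure Ω}

/-- The inclusion of `L^∞` in `L^2`. -/
noncomputable def toLpTwo [IsFiniteMeasure P] : Lp ℝ ∞ P →ₗ[ℝ] Lp ℝ 2 P where
  toFun X := ⟨X.1, Lp.antitone le_top X.2⟩
  map_add' _ _ := rfl
  map_smul' _ _ := rfl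

theorem toLpTwo_coe [IsFiniteMeasure P] (X : Lp ℝ ∞ P) : (toLpTwo X : Ω → ℝ) = X := rfl

theorem norm_toLpTwo_le [IsProbabilityMeasure P] (X : Lp ℝ ∞ P) (M : ℝ) (hM : 0 ≤ M)
    (h : ∀ᵐ ω ∂P, |X ω| ≤ M) : ‖toLpTwo X‖ ≤ M := by
  have := Lp.norm_le_of_ae_bound (f := toLpTwo X) hM h
  simpa [measureUnivNNReal] using this

/-- The previous result is applied in L². An L²-limit is an almost sure limit along a subsequence,
and the uniform bound `M` brings it back into L^∞. -/
theorem exists_mem_iInter_of_ae_closed [IsProbabilityMeasure P] (D : ℕ → Set (Lp ℝ ∞ P))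
    (hne : ∀ n, (D n).Nonempty) (hco : ∀ n, Convex ℝ (D n)) (hanti : Antitone D) (M : ℝ)
    (hM : 0 ≤ M) (hbd : ∀ n, ∀ X ∈ D n, ∀ᵐ ω ∂P, |X ω| ≤ M)
    (hcl : ∀ n, ∀ (X : ℕ → Lp ℝ ∞ P) (Y : Lp ℝ ∞ P), (∀ k, X k ∈ D n) →
      (∀ᵐ ω ∂P, Tendsto (fun k => X k ω) atTop (𝓝 (Y ω))) → Y ∈ D n) :
    (⋂ n, D n).Nonempty := by
  have h := exists_mem_iInter_of_convex_bounded (fun n => toLpTwo '' D n)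
    (fun n => (hne n).image _) ?_ (fun n => (hco n).linear_image _)
    (fun m n hmn => Set.image_mono (hanti hmn)) M ?_
  · obtain ⟨x, hx⟩ := h
    rw [Set.mem_iInter] at hx
    obtain ⟨Y, hY, hYx⟩ := hx 0
    refine ⟨Y, Set.mem_iInter.2 fun n => ?_⟩
    obtain ⟨Z, hZ, hZx⟩ := hx n
    have : Y = Z := Subtype.ext (by
      have := congrArg Subtype.val (hYx.trans hZx.symm)
      exact this)
    rwa [this]
  · intro n
    refine isClosed_of_closure_subset fun x hx => ?_
    obtain ⟨u, hu, hux⟩ := mem_closure_iff_seq_limit.1 hx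
    choose X hX hXu using hu
    obtain ⟨ns, -, hns⟩ := (tendstoInMeasure_of_tendsto_Lp hux).exists_seq_tendsto_ae
    have hb : ∀ᵐ ω ∂P, |x ω| ≤ M := by
      filter_upwards [hns, ae_all_iff.2 fun k => hbd n _ (hX k)] with ω h1 h2
      refine le_of_tendsto h1.abs (Eventually.of_forall fun k => ?_)
      rw [← hXu, toLpTwo_coe]
      exact h2 _
    obtain ⟨Y, hY⟩ := exists_Lp_of_bound (Lp.aestronglyMeasurable x) M hb
    refine ⟨Y, hcl n (fun k => X (ns k)) Y (fun k => hX _) ?_, ?_⟩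
    · filter_upwards [hns, hY] with ω h1 h2
      rw [h2]
      refine h1.congr fun k => ?_
      rw [← hXu, toLpTwo_coe]
    · exact Lp.ext hY
  · rintro _ ⟨X, hX, rfl⟩
    exact norm_toLpTwo_le X M hM (hbd 0 X hX)

end Compactness

/-! ### Countably additive functionals on `L^∞(P)` -/

section Functional

variable {Ω : Type*} [mΩ : MeasurableSpace Ω] {P : Measure Ω} [IsProbabilityMeasure P]

/-- The class of the indicator function of a measurable set. -/
noncomputable def ind (P : Measure Ω) [IsProbabilityMeasure P] {A : Set Ω}
    (hA : MeasurableSet A) : Lp ℝ ∞ P :=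
  indicatorConstLp ∞ hA (measure_ne_top P A) 1

theorem ind_coe {A : Set Ω} (hA : MeasurableSet A) :
    ∀ᵐ ω ∂P, ind P hA ω = A.indicator (fun _ => (1 : ℝ)) ω :=
  indicatorConstLp_coeFn

theorem ind_nonneg {A : Set Ω} (hA : MeasurableSet A) : 0 ≤ ind P hA := by
  rw [Lp_le_iff]
  filter_upwards [ind_coe (P := P) hA, coeFn_zero' (P := P)] with ω h1 h2
  rw [h1, h2]
  exact Set.indicator_nonneg (fun _ _ => zero_le_one) _

/-- The measure is Q(A) = l(1_A). Uniform smallness on events of small probability turns finite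
additivity into countable additivity, because the tails of a disjoint union have vanishing
probability. Uniform approximation by simple functions then extends the formula to all of L^∞. -/
theorem exists_measure_of_continuousLinearMap (l : Lp ℝ ∞ P →L[ℝ] ℝ)
    (hpos : ∀ X, 0 ≤ X → 0 ≤ l X) (hone : l (Lp.const ∞ P 1) = 1)
    (hcont : ∀ ε > 0, ∃ δ > 0, ∀ (A : Set Ω) (hA : MeasurableSet A), P.real A ≤ δ →
      l (ind P hA) ≤ ε) :
    ∃ Q : Measure Ω, IsProbabilityMeasure Q ∧ Q ≪ P ∧ ∀ X : Lp ℝ ∞ P, ∫ ω, X ω ∂Q = l X := by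
  have hnn : ∀ {A : Set Ω} (hA : MeasurableSet A), 0 ≤ l (ind P hA) :=
    fun hA => hpos _ (ind_nonneg hA)
  have hempty : l (ind P (MeasurableSet.empty)) = 0 := by
    rw [ind, indicatorConstLp_empty, map_zero]
  have hunion : ∀ {A B : Set Ω} (hA : MeasurableSet A) (hB : MeasurableSet B), Disjoint A B →
      l (ind P (hA.union hB)) = l (ind P hA) + l (ind P hB) := fun {A B} hA hB hd => by
    rw [← map_add]
    congr 1
    exact indicatorConstLp_disjoint_union hA hB _ _ hd 1
  have hsum : ∀ (f : ℕ → Set Ω) (hf : ∀ i, MeasurableSet (f i)), Pairwise (Function.onFun Disjoint f) →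
      ∀ n, ∑ i ∈ Finset.range n, l (ind P (hf i)) =
        l (ind P (MeasurableSet.iUnion fun i => MeasurableSet.iUnion fun _ : i < n => hf i)) := by
    intro f hf hd n
    induction n with
    | zero =>
      rw [Finset.sum_range_zero, ← hempty]
      congr 2
      simp
    | succ n ih =>
      rw [Finset.sum_range_succ, ih, ← hunion]
      · congr 2
        simp only [Set.biUnion_lt_succ]
      · rw [Set.disjoint_iUnion₂_left]
        intro i hi
        exact hd hi.ne
  have hhas : ∀ (f : ℕ → Set Ω) (hf : ∀ i, MeasurableSet (f i)), Pairwise (Function.onFun Disjoint f) →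
      HasSum (fun i => l (ind P (hf i))) (l (ind P (MeasurableSet.iUnion hf))) := by
    intro f hf hd
    rw [hasSum_iff_tendsto_nat_of_nonneg fun i => hnn (hf i)]
    set T : ℕ → Set Ω := fun n => (⋃ i, f i) \ ⋃ i, ⋃ _ : i < n, f i with hT
    have hBm : ∀ n, MeasurableSet (⋃ i, ⋃ _ : i < n, f i) :=
      fun n => MeasurableSet.iUnion fun i => MeasurableSet.iUnion fun _ => hf i
    have hTm : ∀ n, MeasurableSet (T n) := fun n => (MeasurableSet.iUnion hf).diff (hBm n)
    have hTl : ∀ n, l (ind P (MeasurableSet.iUnion hf)) =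
        ∑ i ∈ Finset.range n, l (ind P (hf i)) + l (ind P (hTm n)) := fun n => by
      rw [hsum f hf hd n, ← hunion _ _ Set.disjoint_sdiff_right]
      congr 2
      refine (Set.union_sdiff_cancel ?_).symm
      exact Set.iUnion₂_subset fun i _ => Set.subset_iUnion f i
    have hTanti : Antitone T := fun m n hmn => Set.sdiff_subset_sdiff_right
      (Set.iUnion₂_subset fun i hi => Set.subset_iUnion₂ (s := fun i (_ : i < n) => f i) i
        (hi.trans_le hmn))
    have hTint : ⋂ n, T n = ∅ := by
      refine Set.eq_empty_of_forall_notMem fun ω hω => ?_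
      rw [Set.mem_iInter] at hω
      obtain ⟨i, hi⟩ := Set.mem_iUnion.1 (hω 0).1
      exact (hω (i + 1)).2 (Set.mem_iUnion₂.2 ⟨i, Nat.lt_succ_self i, hi⟩)
    have hTP : Tendsto (fun n => P.real (T n)) atTop (𝓝 0) := by
      have h := tendsto_measure_iInter_atTop (μ := P) (fun n => (hTm n).nullMeasurableSet) hTanti
        ⟨0, measure_ne_top _ _⟩
      rw [hTint, measure_empty] at h
      exact (ENNReal.tendsto_toReal ENNReal.zero_ne_top).comp h
    have hlT : Tendsto (fun n => l (ind P (hTm n))) atTop (𝓝 0) := by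
      rw [Metric.tendsto_atTop]
      intro ε hε
      obtain ⟨δ, hδ, h⟩ := hcont (ε / 2) (by positivity)
      obtain ⟨N, hN⟩ := (Metric.tendsto_atTop.1 hTP) δ hδ
      refine ⟨N, fun n hn => ?_⟩
      have h1 := hN n hn
      rw [Real.dist_eq, sub_zero, abs_of_nonneg measureReal_nonneg] at h1
      rw [Real.dist_eq, sub_zero, abs_of_nonneg (hnn _)]
      linarith [h _ (hTm n) h1.le]
    have h3 := hlT.const_sub (l (ind P (MeasurableSet.iUnion hf)))
    rw [sub_zero] at h3
    refine h3.congr fun n => ?_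
    rw [hTl n]; ring
  let Q : Measure Ω := Measure.ofMeasurable (fun A hA => ENNReal.ofReal (l (ind P hA)))
    (by rw [hempty, ENNReal.ofReal_zero])
    (fun f hf hd => by
      rw [← (hhas f hf hd).tsum_eq,
        ENNReal.ofReal_tsum_of_nonneg (fun i => hnn (hf i)) (hhas f hf hd).summable])
  have hQ : ∀ {A : Set Ω} (hA : MeasurableSet A), Q A = ENNReal.ofReal (l (ind P hA)) :=
    fun hA => Measure.ofMeasurable_apply _ hA
  have hQr : ∀ {A : Set Ω} (hA : MeasurableSet A), Q.real A = l (ind P hA) := fun hA => by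
    rw [Measure.real, hQ hA, ENNReal.toReal_ofReal (hnn hA)]
  have hprob : IsProbabilityMeasure Q := ⟨by
    rw [hQ MeasurableSet.univ, ind, indicatorConstLp_univ, hone, ENNReal.ofReal_one]⟩
  have hac : Q ≪ P := by
    refine Measure.AbsolutelyContinuous.mk fun A hA h0 => ?_
    have : ind P hA = 0 := by
      refine Lp.ext ?_
      filter_upwards [ind_coe (P := P) hA, coeFn_zero' (P := P),
        measure_eq_zero_iff_ae_notMem.1 h0] with ω h1 h2 h3
      rw [h1, h2, Set.indicator_of_notMem h3]
    rw [hQ hA, this, map_zero, ENNReal.ofReal_zero]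
  refine ⟨Q, hprob, hac, ?_⟩
  have hsimple : ∀ (f : SimpleFunc Ω ℝ) (hf : MemLp f ∞ P), ∫ ω, f ω ∂Q = l (hf.toLp f) := by
    intro f
    induction f using SimpleFunc.induction with
    | const c hs =>
      rename_i A
      intro hf
      have h1 : hf.toLp _ = c • ind P hs := by
        refine Lp.ext ?_
        filter_upwards [hf.coeFn_toLp, ind_coe (P := P) hs, coeFn_smul' c (ind P hs)]
          with ω h1 h2 h3
        rw [h1, h3, h2]
        by_cases hω : ω ∈ A <;> simp [hω]
      rw [h1, map_smul, smul_eq_mul, ← hQr hs]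
      have h2 : ∀ ω, (SimpleFunc.piecewise A hs (SimpleFunc.const Ω c) (SimpleFunc.const Ω 0)) ω =
          A.indicator (fun _ => c) ω := fun ω => by
        by_cases hω : ω ∈ A <;> simp [hω]
      simp_rw [h2]
      rw [integral_indicator_const c hs, smul_eq_mul, mul_comm]
    | add hd hf hg =>
      rename_i f g
      intro hfg
      have hf' := f.memLp_top P
      have hg' := g.memLp_top P
      have h1 : hfg.toLp _ = hf'.toLp f + hg'.toLp g := by
        rw [← MemLp.toLp_add]
        rfl
      rw [h1, map_add, ← hf hf', ← hg hg']
      exact integral_add f.integrable_of_isFiniteMeasure g.integrable_of_isFiniteMeasure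
  intro X
  have happrox : ∀ ε > 0, ∃ f : SimpleFunc Ω ℝ, ∀ᵐ ω ∂P, |X ω - f ω| ≤ ε := by
    intro ε hε
    set M := ‖X‖
    have hXm : Measurable X := (Lp.stronglyMeasurable X).measurable
    -- Truncation bounds the representative at every point, so that rounding down to multiples of ε
    -- has finite range.
    set Y : Ω → ℝ := fun ω => max (-M) (min M (X ω)) with hY
    have hYm : Measurable Y := measurable_const.max (measurable_const.min hXm)
    have hfin : (Set.range fun ω => ε * (⌊Y ω / ε⌋ : ℝ)).Finite := by
      refine ((Set.finite_Icc ⌊-M / ε⌋ ⌊M / ε⌋).image fun k : ℤ => ε * (k : ℝ)).subset ?_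
      rintro _ ⟨ω, rfl⟩
      refine ⟨⌊Y ω / ε⌋, ⟨Int.floor_mono ?_, Int.floor_mono ?_⟩, rfl⟩
      · gcongr; exact le_max_left _ _
      · gcongr
        exact max_le (by linarith [norm_nonneg X]) (min_le_left _ _)
    refine ⟨⟨fun ω => ε * (⌊Y ω / ε⌋ : ℝ), fun x => ?_, hfin⟩, ?_⟩
    · exact (measurable_const.mul (measurable_from_top.comp (hYm.div_const ε).floor))
        (measurableSet_singleton x)
    · filter_upwards [ae_abs_le_norm X] with ω hω
      have hYX : Y ω = X ω := by
        rw [hY]; simp only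
        rw [min_eq_right (abs_le.1 hω).2, max_eq_right (abs_le.1 hω).1]
      show |X ω - ε * (⌊Y ω / ε⌋ : ℝ)| ≤ ε
      rw [hYX]
      have h1 := Int.floor_le (X ω / ε)
      have h2 := Int.lt_floor_add_one (X ω / ε)
      rw [le_div_iff₀ hε] at h1
      rw [div_lt_iff₀ hε] at h2
      rw [abs_le]
      constructor <;> nlinarith
  refine eq_of_forall_dist_le fun ε hε => ?_
  obtain ⟨f, hf⟩ := happrox (ε / 2) (by positivity)
  have hfm := f.memLp_top P
  have h1 : |l X - l (hfm.toLp f)| ≤ ε / 2 := by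
    have hle : X - hfm.toLp f ≤ (ε / 2) • Lp.const ∞ P 1 ∧
        -(X - hfm.toLp f) ≤ (ε / 2) • Lp.const ∞ P 1 := by
      constructor <;> rw [Lp_le_iff]
      · filter_upwards [hf, hfm.coeFn_toLp, coeFn_sub' X (hfm.toLp f),
          coeFn_smul' (ε / 2) (Lp.const ∞ P (1 : ℝ)), coeFn_const' (P := P) 1] with ω a1 a2 a3 a4 a5
        rw [a3, a4, a5, a2]; linarith [(abs_le.1 a1).2]
      · filter_upwards [hf, hfm.coeFn_toLp, coeFn_sub' X (hfm.toLp f),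
          coeFn_smul' (ε / 2) (Lp.const ∞ P (1 : ℝ)), coeFn_const' (P := P) 1,
          coeFn_neg' (X - hfm.toLp f)] with ω a1 a2 a3 a4 a5 a6
        rw [a6, a3, a4, a5, a2]; linarith [(abs_le.1 a1).1]
    have a1 := hpos _ (sub_nonneg.2 hle.1)
    have a2 := hpos _ (sub_nonneg.2 hle.2)
    rw [map_sub, map_smul, hone, smul_eq_mul, map_sub] at a1
    rw [map_sub, map_smul, hone, smul_eq_mul, map_neg, map_sub] at a2
    rw [abs_le]; constructor <;> linarith
  have h2 : |∫ ω, X ω ∂Q - ∫ ω, f ω ∂Q| ≤ ε / 2 := by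
    rw [← integral_sub (integrable_of_absolutelyContinuous hac X) f.integrable_of_isFiniteMeasure]
    have := norm_integral_le_of_norm_le_const (μ := Q) (f := fun ω => X ω - f ω) (C := ε / 2)
      (hac.ae_le hf)
    simpa using this
  rw [hsimple f hfm] at h2
  rw [Real.dist_eq]
  rw [abs_le] at *
  constructor <;> linarith [h1.1, h1.2, h2.1, h2.2]

end Functional

/-! ### Coherent price functionals -/

section Coherent

set_option linter.unusedSectionVars false

variable {Ω : Type*} [mΩ : MeasurableSpace Ω] {P : Measure Ω} [IsProbabilityMeasure P]

/-- A monotone, sublinear, translation invariant functional on `L^∞(P)` which is continuous from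
below. -/
structure IsCoherent (ρ : Lp ℝ ∞ P → ℝ) : Prop where
  mono : Monotone ρ
  add_le : ∀ X Y, ρ (X + Y) ≤ ρ X + ρ Y
  smul : ∀ (l : ℝ) (X), 0 < l → ρ (l • X) = l * ρ X
  add_const : ∀ (X) (c : ℝ), ρ (X + Lp.const ∞ P c) = ρ X + c
  tendsto : ∀ (X : ℕ → Lp ℝ ∞ P) (Y : Lp ℝ ∞ P), Monotone X →
    (∀ᵐ ω ∂P, Tendsto (fun n => X n ω) atTop (𝓝 (Y ω))) →
    Tendsto (fun n => ρ (X n)) atTop (𝓝 (ρ Y))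

variable {ρ : Lp ℝ ∞ P → ℝ}

theorem IsCoherent.map_zero (hρ : IsCoherent ρ) : ρ 0 = 0 := by
  have := hρ.smul 2 0 two_pos
  rw [smul_zero] at this
  linarith

theorem IsCoherent.smul_nonneg (hρ : IsCoherent ρ) {l : ℝ} (hl : 0 ≤ l) (X : Lp ℝ ∞ P) :
    ρ (l • X) = l * ρ X := by
  rcases hl.eq_or_lt with rfl | h
  · rw [zero_smul, hρ.map_zero, zero_mul]
  · exact hρ.smul l X h

theorem tendsto_iInf_tail {u : ℕ → ℝ} {a : ℝ} (h : Tendsto u atTop (𝓝 a))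
    (hb : BddBelow (Set.range u)) : Tendsto (fun k => ⨅ j, u (k + j)) atTop (𝓝 a) := by
  have hbk : ∀ k, BddBelow (Set.range fun j => u (k + j)) := fun k =>
    hb.mono (by rintro _ ⟨j, rfl⟩; exact ⟨k + j, rfl⟩)
  rw [Metric.tendsto_atTop] at h ⊢
  intro ε hε
  obtain ⟨N, hN⟩ := h (ε / 2) (by positivity)
  refine ⟨N, fun k hk => ?_⟩
  have h1 : ⨅ j, u (k + j) ≤ u k := ciInf_le (hbk k) 0
  have h2 : a - ε / 2 ≤ ⨅ j, u (k + j) := le_ciInf fun j => by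
    have := hN (k + j) (by omega)
    rw [Real.dist_eq, abs_lt] at this
    linarith [this.1]
  have h3 := hN k hk
  rw [Real.dist_eq, abs_lt] at h3 ⊢
  constructor <;> linarith [h3.2]

/-- The Fatou property. -/
theorem IsCoherent.le_of_tendsto (hρ : IsCoherent ρ) (X : ℕ → Lp ℝ ∞ P) (Y : Lp ℝ ∞ P) (M a : ℝ)
    (hM : ∀ k, ∀ᵐ ω ∂P, |X k ω| ≤ M)
    (hXY : ∀ᵐ ω ∂P, Tendsto (fun k => X k ω) atTop (𝓝 (Y ω))) (ha : ∀ k, ρ (X k) ≤ a) :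
    ρ Y ≤ a := by
  have hM' := ae_all_iff.2 hM
  have hbd : ∀ ω, (∀ k, |X k ω| ≤ M) → ∀ k, BddBelow (Set.range fun j => X (k + j) ω) :=
    fun ω h k => ⟨-M, by rintro _ ⟨j, rfl⟩; exact (abs_le.1 (h _)).1⟩
  -- The infima of the tails increase to Y and lie below the X k, so continuity from below applies
  -- to them.
  have hI : ∀ k, ∃ I : Lp ℝ ∞ P, I =ᵐ[P] fun ω => ⨅ j, X (k + j) ω := fun k => by
    refine exists_Lp_of_bound (AEMeasurable.iInf fun j =>
      aemeasurable_coeFn _).aestronglyMeasurable M ?_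
    filter_upwards [hM'] with ω hω
    exact abs_le.2 ⟨le_ciInf fun j => (abs_le.1 (hω _)).1,
      (ciInf_le (hbd ω hω k) 0).trans (abs_le.1 (hω _)).2⟩
  choose I hI using hI
  have hmono : Monotone I := monotone_nat_of_le_succ fun k => by
    rw [Lp_le_iff]
    filter_upwards [hI k, hI (k + 1), hM'] with ω h1 h2 h3
    rw [h1, h2]
    refine le_ciInf fun j => ?_
    have := ciInf_le (hbd ω h3 k) (1 + j)
    rwa [← add_assoc] at this
  have hlim : ∀ᵐ ω ∂P, Tendsto (fun k => I k ω) atTop (𝓝 (Y ω)) := by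
    filter_upwards [ae_all_iff.2 hI, hM', hXY] with ω h1 h2 h3
    have h4 : BddBelow (Set.range fun k => X k ω) :=
      ⟨-M, by rintro _ ⟨k, rfl⟩; exact (abs_le.1 (h2 k)).1⟩
    exact (tendsto_iInf_tail (u := fun k => X k ω) h3 h4).congr fun k => (h1 k).symm
  refine _root_.le_of_tendsto (hρ.tendsto I Y hmono hlim) (Eventually.of_forall fun k => ?_)
  refine (hρ.mono ?_).trans (ha k)
  rw [Lp_le_iff]
  filter_upwards [hI k, hM'] with ω h1 h2
  rw [h1]
  exact ciInf_le (hbd ω h2 k) 0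

/-! ### Expected excesses and their weighted sums. -/

/-- The expected excess of `X` over the level `n`. -/
noncomputable def excess (n : ℕ) (X : Lp ℝ ∞ P) : ℝ := ∫ ω, max (X ω - n) 0 ∂P

theorem integrable_excess (n : ℕ) (X : Lp ℝ ∞ P) : Integrable (fun ω => max (X ω - n) 0) P :=
  ((integrable_of_absolutelyContinuous Measure.AbsolutelyContinuous.rfl X).sub
    (integrable_const _)).pos_part

theorem excess_nonneg (n : ℕ) (X : Lp ℝ ∞ P) : 0 ≤ excess n X :=
  integral_nonneg fun _ => le_max_right _ _

theorem excess_convex (n : ℕ) (X Y : Lp ℝ ∞ P) {a b : ℝ} (ha : 0 ≤ a) (hb : 0 ≤ b)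
    (hab : a + b = 1) : excess n (a • X + b • Y) ≤ a * excess n X + b * excess n Y := by
  simp only [excess]
  rw [← integral_const_mul, ← integral_const_mul, ← integral_add
    ((integrable_excess n X).const_mul a) ((integrable_excess n Y).const_mul b)]
  refine integral_mono_ae (integrable_excess n _)
    (((integrable_excess n X).const_mul a).add ((integrable_excess n Y).const_mul b)) ?_
  filter_upwards [coeFn_add' (a • X) (b • Y), coeFn_smul' a X, coeFn_smul' b Y] with ω h1 h2 h3
  rw [h1, h2, h3]
  have e : a * X ω + b * Y ω - n = a * (X ω - n) + b * (Y ω - n) := by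
    linear_combination (n : ℝ) * hab
  rw [e]
  refine max_le (add_le_add ?_ ?_) (add_nonneg ?_ ?_)
  · exact mul_le_mul_of_nonneg_left (le_max_left _ _) ha
  · exact mul_le_mul_of_nonneg_left (le_max_left _ _) hb
  · exact mul_nonneg ha (le_max_right _ _)
  · exact mul_nonneg hb (le_max_right _ _)

theorem excess_eq_zero {n m : ℕ} (hnm : n ≤ m) {X : Lp ℝ ∞ P} (h : X ≤ Lp.const ∞ P (n : ℝ)) :
    excess m X = 0 := by
  refine integral_eq_zero_of_ae ?_
  filter_upwards [Lp_le_iff.1 h, coeFn_const' (P := P) (n : ℝ)] with ω h1 h2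
  rw [h2] at h1
  have : (n : ℝ) ≤ m := by exact_mod_cast hnm
  exact max_eq_right (by linarith)

theorem le_const_of_excess_eq_zero {n : ℕ} {X : Lp ℝ ∞ P} (h : excess n X = 0) :
    X ≤ Lp.const ∞ P (n : ℝ) := by
  have h1 := (integral_eq_zero_iff_of_nonneg (fun _ => le_max_right _ _)
    (integrable_excess n X)).1 h
  rw [Lp_le_iff]
  filter_upwards [h1, coeFn_const' (P := P) (n : ℝ)] with ω h1 h2
  rw [h2]
  have : max (X ω - n) 0 = 0 := h1
  linarith [max_eq_right_iff.1 this]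

theorem excess_sup_zero (n : ℕ) (X : Lp ℝ ∞ P) : excess n (X ⊔ 0) = excess n X := by
  refine integral_congr_ae ?_
  filter_upwards [Lp.coeFn_sup X 0, coeFn_zero' (P := P)] with ω h1 h2
  have h3 : (X ⊔ 0 : Lp ℝ ∞ P) ω = max (X ω) 0 := by rw [h1, Pi.sup_apply, h2]
  have hn : (0 : ℝ) ≤ n := n.cast_nonneg
  show max ((X ⊔ 0 : Lp ℝ ∞ P) ω - n) 0 = max (X ω - n) 0
  rw [h3]
  rcases le_total (X ω) 0 with h | h
  · rw [max_eq_right h, max_eq_right (by linarith), max_eq_right (by linarith)]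
  · rw [max_eq_left h]

theorem tendsto_excess (n : ℕ) (X : ℕ → Lp ℝ ∞ P) (Y : Lp ℝ ∞ P) (M : ℝ)
    (hM : ∀ k, ∀ᵐ ω ∂P, |X k ω| ≤ M)
    (hXY : ∀ᵐ ω ∂P, Tendsto (fun k => X k ω) atTop (𝓝 (Y ω))) :
    Tendsto (fun k => excess n (X k)) atTop (𝓝 (excess n Y)) := by
  refine tendsto_integral_of_dominated_convergence (fun _ => M + n)
    (fun k => (integrable_excess n (X k)).aestronglyMeasurable) (integrable_const _) ?_ ?_
  · intro k
    filter_upwards [hM k] with ω hω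
    have hn : (0 : ℝ) ≤ n := n.cast_nonneg
    rw [Real.norm_eq_abs, abs_of_nonneg (le_max_right _ _)]
    exact max_le (by linarith [(abs_le.1 hω).2]) (by linarith [(abs_nonneg _).trans hω])
  · filter_upwards [hXY] with ω hω
    exact (hω.sub_const _).max tendsto_const_nhds

/-- A weighted sum of expected excesses. -/
noncomputable def wexcess (w : ℕ → ℝ) (N : ℕ) (X : Lp ℝ ∞ P) : ℝ :=
  ∑ n ∈ Finset.range N, w n * excess n X

theorem wexcess_convex {w : ℕ → ℝ} (hw : ∀ n, 0 ≤ w n) (N : ℕ) (X Y : Lp ℝ ∞ P) {a b : ℝ}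
    (ha : 0 ≤ a) (hb : 0 ≤ b) (hab : a + b = 1) :
    wexcess w N (a • X + b • Y) ≤ a * wexcess w N X + b * wexcess w N Y := by
  simp only [wexcess]
  rw [Finset.mul_sum, Finset.mul_sum, ← Finset.sum_add_distrib]
  refine Finset.sum_le_sum fun n _ => ?_
  have := mul_le_mul_of_nonneg_left (excess_convex n X Y ha hb hab) (hw n)
  linarith

theorem wexcess_eq_of_le {w : ℕ → ℝ} {N M : ℕ} (h : N ≤ M) {X : Lp ℝ ∞ P}
    (hX : X ≤ Lp.const ∞ P (N : ℝ)) : wexcess w M X = wexcess w N X := by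
  refine (Finset.sum_subset (Finset.range_mono h) fun n _ hn => ?_).symm
  rw [excess_eq_zero (not_lt.1 fun h' => hn (Finset.mem_range.2 h')) hX, mul_zero]

theorem tendsto_wexcess (w : ℕ → ℝ) (N : ℕ) (X : ℕ → Lp ℝ ∞ P) (Y : Lp ℝ ∞ P) (M : ℝ)
    (hM : ∀ k, ∀ᵐ ω ∂P, |X k ω| ≤ M)
    (hXY : ∀ᵐ ω ∂P, Tendsto (fun k => X k ω) atTop (𝓝 (Y ω))) :
    Tendsto (fun k => wexcess w N (X k)) atTop (𝓝 (wexcess w N Y)) :=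
  tendsto_finsetSum _ fun n _ => (tendsto_excess n X Y M hM hXY).const_mul (w n)

/-! ### Construction of the separating neighbourhood and duality for coherent functionals. -/

theorem IsCoherent.convex_sub (hρ : IsCoherent ρ) (X : Lp ℝ ∞ P) :
    Convex ℝ {h : Lp ℝ ∞ P | ρ (X - h) ≤ 0} := by
  intro h hh k hk a b ha hb hab
  have e : X - (a • h + b • k) = a • (X - h) + b • (X - k) := by
    rw [smul_sub, smul_sub]
    nth_rewrite 1 [← one_smul ℝ X]
    rw [← hab, add_smul]; abel
  show ρ (X - (a • h + b • k)) ≤ 0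
  rw [e]
  refine (hρ.add_le _ _).trans ?_
  rw [hρ.smul_nonneg ha, hρ.smul_nonneg hb]
  have h1 : ρ (X - h) ≤ 0 := hh
  have h2 : ρ (X - k) ≤ 0 := hk
  nlinarith

/-- If no `r` worked, there would be counterexamples with `k * excess N Y ≤ b` for every k. By
compactness a common limit point has no excess over N, so it falls under `h`, although its weighted
excess is at most b < a. The loss from a to b makes room for the limit. -/
theorem IsCoherent.exists_next_weight (hρ : IsCoherent ρ) (X : Lp ℝ ∞ P) (w : ℕ → ℝ)
    (hw : ∀ n, 0 ≤ w n) (N : ℕ) {a b : ℝ} (hb : 0 ≤ b) (hba : b < a)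
    (h : ∀ Y : Lp ℝ ∞ P, ρ (X - Y) ≤ 0 → Y ≤ Lp.const ∞ P (N : ℝ) → a ≤ wexcess w N Y) :
    ∃ r : ℝ, 0 ≤ r ∧ ∀ Y : Lp ℝ ∞ P, ρ (X - Y) ≤ 0 → Y ≤ Lp.const ∞ P ((N + 1 : ℕ) : ℝ) →
      b ≤ wexcess w N Y + r * excess N Y := by
  by_contra! hcon
  let D : ℕ → Set (Lp ℝ ∞ P) := fun k => {Y | 0 ≤ Y ∧ Y ≤ Lp.const ∞ P ((N + 1 : ℕ) : ℝ) ∧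
    ρ (X - Y) ≤ 0 ∧ wexcess w N Y ≤ b ∧ k * excess N Y ≤ b}
  have hwnn : ∀ Y : Lp ℝ ∞ P, 0 ≤ wexcess w N Y := fun Y =>
    Finset.sum_nonneg fun n _ => mul_nonneg (hw n) (excess_nonneg n Y)
  have hbd : ∀ n, ∀ Y ∈ D n, ∀ᵐ ω ∂P, |Y ω| ≤ ((N + 1 : ℕ) : ℝ) := fun n Y hY => by
    filter_upwards [Lp_le_iff.1 hY.1, Lp_le_iff.1 hY.2.1, coeFn_zero' (P := P),
      coeFn_const' (P := P) ((N + 1 : ℕ) : ℝ)] with ω h1 h2 h3 h4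
    rw [h3] at h1
    rw [h4] at h2
    rw [abs_of_nonneg h1]; exact h2
  have hne := exists_mem_iInter_of_ae_closed D ?_ ?_ ?_ ((N + 1 : ℕ) : ℝ) (Nat.cast_nonneg _) hbd ?_
  · obtain ⟨Y, hY⟩ := hne
    rw [Set.mem_iInter] at hY
    have h0 : excess N Y = 0 := by
      refine le_antisymm (le_of_forall_pos_le_add fun ε hε => ?_) (excess_nonneg N Y)
      obtain ⟨k, hk⟩ := exists_nat_gt (b / ε)
      have h1 := (hY k).2.2.2.2
      rw [div_lt_iff₀ hε] at hk
      by_contra! h2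
      have hk0 : (0 : ℝ) ≤ k := k.cast_nonneg
      nlinarith
    have := h Y (hY 0).2.2.1 (le_const_of_excess_eq_zero h0)
    linarith [(hY 0).2.2.2.1]
  · intro k
    obtain ⟨Y, h1, h2, h3⟩ := hcon k k.cast_nonneg
    -- The positive part supplies the lower bound needed for compactness. It has the same excesses,
    -- all levels being nonnegative, and it can only decrease ρ(X - Y).
    refine ⟨Y ⊔ 0, le_sup_right, sup_le h2 ?_, ?_, ?_, ?_⟩
    · exact const_mono (a := 0) (Nat.cast_nonneg _)
    · exact (hρ.mono (sub_le_sub_left le_sup_left X)).trans h1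
    · have : wexcess w N (Y ⊔ 0) = wexcess w N Y :=
        Finset.sum_congr rfl fun n _ => by rw [excess_sup_zero]
      rw [this]
      have := mul_nonneg (k.cast_nonneg : (0 : ℝ) ≤ k) (excess_nonneg N Y)
      linarith
    · rw [excess_sup_zero]
      linarith [hwnn Y]
  · rintro k Y ⟨a1, a2, a3, a4, a5⟩ Z ⟨b1, b2, b3, b4, b5⟩ s t hs ht hst
    refine ⟨?_, ?_, hρ.convex_sub X a3 b3 hs ht hst, ?_, ?_⟩
    · have := add_le_add (smul_mono_Lp hs a1) (smul_mono_Lp ht b1)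
      simpa using this
    · have := add_le_add (smul_mono_Lp hs a2) (smul_mono_Lp ht b2)
      rwa [← add_smul, hst, one_smul] at this
    · refine (wexcess_convex hw N Y Z hs ht hst).trans ?_
      nlinarith
    · have := mul_le_mul_of_nonneg_left (excess_convex N Y Z hs ht hst)
        (k.cast_nonneg : (0 : ℝ) ≤ k)
      nlinarith
  · rintro m n hmn Y ⟨a1, a2, a3, a4, a5⟩
    refine ⟨a1, a2, a3, a4, le_trans ?_ a5⟩
    exact mul_le_mul_of_nonneg_right (by exact_mod_cast hmn) (excess_nonneg N Y)
  · intro n Z Y hZ hlim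
    have hb' := fun k => hbd n (Z k) (hZ k)
    refine ⟨?_, ?_, ?_, ?_, ?_⟩
    · rw [Lp_le_iff]
      filter_upwards [hlim, ae_all_iff.2 fun k => Lp_le_iff.1 (hZ k).1] with ω h1 h2
      exact ge_of_tendsto' h1 h2
    · rw [Lp_le_iff]
      filter_upwards [hlim, ae_all_iff.2 fun k => Lp_le_iff.1 (hZ k).2.1] with ω h1 h2
      exact le_of_tendsto' h1 h2
    · refine hρ.le_of_tendsto (fun k => X - Z k) _ (‖X‖ + ((N + 1 : ℕ) : ℝ)) 0 (fun k => ?_) ?_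
        fun k => (hZ k).2.2.1
      · filter_upwards [hb' k, ae_abs_le_norm X, coeFn_sub' X (Z k)] with ω h1 h2 h3
        rw [h3]
        exact (abs_sub _ _).trans (add_le_add h2 h1)
      · filter_upwards [hlim, coeFn_sub' X Y, ae_all_iff.2 fun k => coeFn_sub' X (Z k)]
          with ω h1 h2 h3
        rw [h2]
        simp_rw [h3]
        exact h1.const_sub _
    · exact le_of_tendsto' (tendsto_wexcess w N Z Y _ hb' hlim) fun k => (hZ k).2.2.2.1
    · exact le_of_tendsto' ((tendsto_excess N Z Y _ hb' hlim).const_mul (n : ℝ))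
        fun k => (hZ k).2.2.2.2

/-- The weights are built one at a time. At stage N the lower bound is 1 + 1/(N+1); it decreases
strictly, as `exists_next_weight` requires, but never below 1. At stage 0 no Y qualifies: Y ≤ 0
would give ρ(X) ≤ ρ(X - Y) ≤ 0. -/
theorem IsCoherent.exists_weights (hρ : IsCoherent ρ) (X : Lp ℝ ∞ P) (hX : 0 < ρ X) :
    ∃ w : ℕ → ℝ, (∀ n, 0 ≤ w n) ∧ ∀ (N : ℕ) (Y : Lp ℝ ∞ P), ρ (X - Y) ≤ 0 →
      Y ≤ Lp.const ∞ P (N : ℝ) → 1 ≤ wexcess w N Y := by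
  let good : ℕ → (ℕ → ℝ) → Prop := fun N w => (∀ n, 0 ≤ w n) ∧ ∀ Y : Lp ℝ ∞ P, ρ (X - Y) ≤ 0 →
    Y ≤ Lp.const ∞ P (N : ℝ) → 1 + 1 / ((N : ℝ) + 1) ≤ wexcess w N Y
  have hstep : ∀ (N : ℕ) (w : {w // good N w}), ∃ w' : {w // good (N + 1) w},
      ∀ n < N, w'.1 n = w.1 n := by
    rintro N ⟨w, hw, hwN⟩
    obtain ⟨r, hr, h⟩ := hρ.exists_next_weight X w hw N
      (b := 1 + 1 / (((N + 1 : ℕ) : ℝ) + 1)) (by positivity) (by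
        push_cast
        gcongr
        linarith) hwN
    refine ⟨⟨Function.update w N r, fun n => ?_, fun Y h1 h2 => ?_⟩, fun n hn => ?_⟩
    · by_cases hn : n = N
      · subst hn; simpa using hr
      · simpa [hn] using hw n
    · refine (h Y h1 h2).trans_eq ?_
      rw [wexcess, wexcess, Finset.sum_range_succ, Function.update_self]
      congr 1
      refine Finset.sum_congr rfl fun n hn => ?_
      rw [Function.update_of_ne (Finset.mem_range.1 hn).ne]
    · exact Function.update_of_ne hn.ne _ _
  choose next hnext using hstep
  have h0 : good 0 (fun _ => 0) := by
    refine ⟨fun _ => le_rfl, fun Y h1 h2 => ?_⟩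
    exfalso
    have h3 : Y ≤ 0 := h2.trans (le_of_eq (by simp))
    have h4 : X ≤ X - Y := by simpa using h3
    linarith [hρ.mono h4]
  let x : ∀ N, {w // good N w} := fun N => Nat.rec ⟨_, h0⟩ (fun N w => next N w) N
  have hx : ∀ N, x (N + 1) = next N (x N) := fun N => rfl
  -- The weight of index n is fixed at stage n + 1; for Y ≤ N only the weights of index below N
  -- matter.
  have hstab : ∀ n N, n + 1 ≤ N → (x N).1 n = (x (n + 1)).1 n := by
    intro n N hN
    induction N, hN using Nat.le_induction with
    | base => rfl
    | succ N hN ih => rw [hx, hnext N (x N) n (by omega), ih]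
  refine ⟨fun n => (x (n + 1)).1 n, fun n => (x (n + 1)).2.1 n, fun N Y h1 h2 => ?_⟩
  have h3 := (x N).2.2 Y h1 h2
  have h4 : wexcess (fun n => (x (n + 1)).1 n) N Y = wexcess (x N).1 N Y :=
    Finset.sum_congr rfl fun n hn => by rw [hstab n N (Finset.mem_range.1 hn)]
  rw [h4]
  have : (0 : ℝ) < 1 / ((N : ℝ) + 1) := Nat.one_div_pos_of_nat
  linarith

/-- Hahn–Banach separates U from K. Since K absorbs nonnegative directions and the directions -A
with ρ(A) ≤ 0, the separating functional is positive and nonpositive on {ρ ≤ 0}; after normalization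
it is dominated by ρ. Since X ∈ K and 0 lies in the interior of U, it is positive at X. -/
theorem IsCoherent.exists_measure_of_pos (hρ : IsCoherent ρ) (X : Lp ℝ ∞ P) (hX : 0 < ρ X) :
    ∃ Q : Measure Ω, IsProbabilityMeasure Q ∧ Q ≪ P ∧ (∀ Y : Lp ℝ ∞ P, ∫ ω, Y ω ∂Q ≤ ρ Y) ∧
      0 < ∫ ω, X ω ∂Q := by
  obtain ⟨w, hw, hwK⟩ := hρ.exists_weights X hX
  set K : Set (Lp ℝ ∞ P) := {Y | ρ (X - Y) ≤ 0} with hK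
  set U : Set (Lp ℝ ∞ P) := {Y | ∃ N : ℕ, Y ≤ Lp.const ∞ P (N : ℝ) ∧ wexcess w N Y < 1} with hU
  have hdisj : Disjoint U K := Set.disjoint_left.2 fun Y ⟨N, h1, h2⟩ h3 =>
    absurd (hwK N Y h3 h1) (not_le.2 h2)
  have hUco : Convex ℝ U := by
    rintro Y ⟨N, hN, hY⟩ Z ⟨M, hM, hZ⟩ a b ha hb hab
    have hN' : Y ≤ Lp.const ∞ P ((max N M : ℕ) : ℝ) :=
      hN.trans (const_mono (by exact_mod_cast le_max_left N M))
    have hM' : Z ≤ Lp.const ∞ P ((max N M : ℕ) : ℝ) :=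
      hM.trans (const_mono (by exact_mod_cast le_max_right N M))
    refine ⟨max N M, ?_, ?_⟩
    · have := add_le_add (smul_mono_Lp ha hN') (smul_mono_Lp hb hM')
      rwa [← add_smul, hab, one_smul] at this
    · refine (wexcess_convex hw _ Y Z ha hb hab).trans_lt ?_
      rw [wexcess_eq_of_le (le_max_left N M) hN, wexcess_eq_of_le (le_max_right N M) hM]
      rcases ha.eq_or_lt with rfl | ha'
      · rw [zero_add] at hab; subst hab; linarith
      · nlinarith
  have h0int : (0 : Lp ℝ ∞ P) ∈ interior U := by
    rw [mem_interior_iff_mem_nhds, Metric.mem_nhds_iff]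
    -- A radius of at most 1 keeps Y below level 1, so only `w 0` contributes; the second bound
    -- gives `w 0 * ‖Y‖ < 1`.
    refine ⟨min 1 (1 / (w 0 + 1)), lt_min one_pos (div_pos one_pos (by linarith [hw 0])), ?_⟩
    intro Y hY
    rw [mem_ball_zero_iff, lt_min_iff] at hY
    have hY1 := Lp_le_const_norm Y
    refine ⟨1, hY1.trans (const_mono (by exact_mod_cast hY.1.le)), ?_⟩
    rw [wexcess, Finset.sum_range_one]
    have h1 : excess 0 Y ≤ ‖Y‖ := by
      have h2 : excess 0 Y ≤ ∫ _, ‖Y‖ ∂P := by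
        refine integral_mono_ae (integrable_excess 0 Y) (integrable_const _) ?_
        filter_upwards [ae_abs_le_norm Y] with ω hω
        rw [Nat.cast_zero, sub_zero]
        exact max_le (abs_le.1 hω).2 (norm_nonneg _)
      simpa using h2
    have h3 := hY.2
    have h4 : 0 < w 0 + 1 := by linarith [hw 0]
    rw [lt_div_iff₀ h4] at h3
    nlinarith [hw 0, norm_nonneg Y, mul_le_mul_of_nonneg_left h1 (hw 0)]
  obtain ⟨l, s, hlU, hlK⟩ := geometric_hahn_banach_open hUco.interior isOpen_interior
    (hρ.convex_sub X) (hdisj.mono_left interior_subset)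
  have hs : 0 < s := by simpa using hlU 0 h0int
  -- Separation only concerns the interior of U; a convex set with nonempty interior lies in the
  -- closure of that interior.
  have hlU' : ∀ Y ∈ U, l Y ≤ s := by
    have h1 : U ⊆ closure (interior U) := by
      rw [hUco.closure_interior_eq_closure_of_nonempty_interior ⟨0, h0int⟩]
      exact subset_closure
    have h2 : closure (interior U) ⊆ {Y | l Y ≤ s} :=
      closure_minimal (fun Y hY => (hlU Y hY).le) (isClosed_le l.continuous continuous_const)
    exact fun Y hY => h2 (h1 hY)
  have hcK : Lp.const ∞ P (ρ X) ∈ K := by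
    show ρ (X - Lp.const ∞ P (ρ X)) ≤ 0
    rw [sub_eq_add_neg, ← map_neg, hρ.add_const]
    simp
  have hXK : X ∈ K := by
    show ρ (X - X) ≤ 0
    rw [sub_self, hρ.map_zero]
  have hlinear : ∀ Y A : Lp ℝ ∞ P, (∀ t : ℝ, 0 ≤ t → Y + t • A ∈ K) → 0 ≤ l A := by
    intro Y A h
    by_contra! hneg
    -- This multiplier pushes `l (Y + t • A)` down to at most -1, below the positive level s.
    have h1 := hlK _ (h ((|l Y| + 1) / (-l A)) (div_nonneg (by positivity) (by linarith)))
    rw [map_add, map_smul, smul_eq_mul, div_mul_eq_mul_div, div_neg, mul_div_assoc,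
      div_self hneg.ne] at h1
    linarith [le_abs_self (l Y)]
  have hlpos : ∀ A, 0 ≤ A → 0 ≤ l A := fun A hA => hlinear X A fun t ht => by
    refine (hρ.mono ?_).trans hXK
    have := smul_mono_Lp ht hA
    rw [smul_zero] at this
    exact sub_le_sub_left (le_add_of_nonneg_right this) X
  have hlC : ∀ A, ρ A ≤ 0 → l A ≤ 0 := fun A hA => by
    have := hlinear X (-A) fun t ht => by
      show ρ (X - (X + t • -A)) ≤ 0
      rw [sub_add_cancel_left, smul_neg, neg_neg, hρ.smul_nonneg ht]
      exact mul_nonpos_of_nonneg_of_nonpos ht hA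
    rw [map_neg] at this
    linarith
  have hconst : ∀ c : ℝ, l (Lp.const ∞ P c) = c * l (Lp.const ∞ P 1) := fun c => by
    rw [← smul_eq_mul, ← map_smul, smul_const, mul_one]
  have hone : 0 < l (Lp.const ∞ P 1) := by
    have h1 := hlK _ hcK
    rw [hconst] at h1
    by_contra! h2
    nlinarith
  set m := l (Lp.const ∞ P 1) with hm
  have hcont : ∀ ε > 0, ∃ δ > 0, ∀ (A : Set Ω) (hA : MeasurableSet A), P.real A ≤ δ →
      (m⁻¹ • l) (ind P hA) ≤ ε := by
    intro ε hε
    -- Once M·1_A ∈ U, the bound by s gives l(1_A) ≤ s/M < mε. Membership holds when P(A) ≤ 1/(B +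
    -- 1), since the weighted excess of M·1_A is at most B·P(A).
    obtain ⟨M, hM⟩ := exists_nat_gt (s / (m * ε))
    have hM0 : (0 : ℝ) < M := lt_trans (by positivity) hM
    set B := ∑ n ∈ Finset.range M, w n * M with hB
    have hB0 : 0 ≤ B := Finset.sum_nonneg fun n _ => mul_nonneg (hw n) hM0.le
    refine ⟨1 / (B + 1), by positivity, fun A hA hPA => ?_⟩
    have hmem : (M : ℝ) • ind P hA ∈ U := by
      refine ⟨M, ?_, ?_⟩
      · rw [Lp_le_iff]
        filter_upwards [coeFn_smul' (M : ℝ) (ind P hA), ind_coe (P := P) hA,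
          coeFn_const' (P := P) (M : ℝ)] with ω h1 h2 h3
        rw [h1, h2, h3]
        by_cases hω : ω ∈ A <;> simp [hω]
      · have h1 : ∀ n, excess n ((M : ℝ) • ind P hA) ≤ M * P.real A := fun n => by
          have h2 : ∫ ω, A.indicator (fun _ => (M : ℝ)) ω ∂P = M * P.real A := by
            rw [integral_indicator_const _ hA, smul_eq_mul, mul_comm]
          rw [← h2]
          refine integral_mono_ae (integrable_excess n _)
            ((integrable_const _).indicator hA) ?_
          filter_upwards [coeFn_smul' (M : ℝ) (ind P hA), ind_coe (P := P) hA] with ω h1 h2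
          rw [h1, h2]
          have hn : (0 : ℝ) ≤ n := n.cast_nonneg
          by_cases hω : ω ∈ A <;> simp [hω, hM0.le]
        have h2 : wexcess w M ((M : ℝ) • ind P hA) ≤ B * P.real A := by
          rw [hB, Finset.sum_mul]
          refine Finset.sum_le_sum fun n _ => ?_
          rw [mul_assoc]
          exact mul_le_mul_of_nonneg_left (h1 n) (hw n)
        refine h2.trans_lt ?_
        have h3 := mul_le_mul_of_nonneg_left hPA hB0
        refine h3.trans_lt ?_
        rw [mul_one_div, div_lt_one (by linarith)]
        linarith
    have h1 := hlU' _ hmem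
    rw [map_smul, smul_eq_mul] at h1
    show m⁻¹ * l (ind P hA) ≤ ε
    rw [inv_mul_le_iff₀ hone]
    rw [div_lt_iff₀ (by positivity)] at hM
    nlinarith
  obtain ⟨Q, hQ, hQP, hQl⟩ := exists_measure_of_continuousLinearMap (m⁻¹ • l)
    (fun A hA => mul_nonneg (inv_nonneg.2 hone.le) (hlpos A hA))
    (inv_mul_cancel₀ hone.ne') hcont
  refine ⟨Q, hQ, hQP, fun Y => ?_, ?_⟩
  · rw [hQl]
    show m⁻¹ * l Y ≤ ρ Y
    have h1 := hlC (Y + Lp.const ∞ P (-ρ Y)) (by rw [hρ.add_const]; simp)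
    rw [map_add, hconst] at h1
    rw [inv_mul_le_iff₀ hone]
    linarith
  · rw [hQl]
    exact mul_pos (inv_pos.2 hone) (hs.trans_le (hlK X hXK))

theorem IsCoherent.exists_measure_lt (hρ : IsCoherent ρ) (X : Lp ℝ ∞ P) {a : ℝ} (ha : a < ρ X) :
    ∃ Q : Measure Ω, IsProbabilityMeasure Q ∧ Q ≪ P ∧ (∀ Y : Lp ℝ ∞ P, ∫ ω, Y ω ∂Q ≤ ρ Y) ∧
      a < ∫ ω, X ω ∂Q := by
  obtain ⟨Q, hQ, hQP, h1, h2⟩ := hρ.exists_measure_of_pos (X + Lp.const ∞ P (-a))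
    (by rw [hρ.add_const]; linarith)
  refine ⟨Q, hQ, hQP, h1, ?_⟩
  have h3 : ∫ ω, (X + Lp.const ∞ P (-a) : Lp ℝ ∞ P) ω ∂Q = ∫ ω, X ω ∂Q - a := by
    have h4 : ∫ ω, (X + Lp.const ∞ P (-a) : Lp ℝ ∞ P) ω ∂Q = ∫ ω, (X ω - a) ∂Q := by
      refine integral_congr_ae (hQP.ae_le ?_)
      filter_upwards [coeFn_add' X (Lp.const ∞ P (-a)), coeFn_const' (P := P) (-a)] with ω h5 h6
      rw [h5, h6, sub_eq_add_neg]
    rw [h4, integral_sub (integrable_of_absolutelyContinuous hQP X) (integrable_const _)]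
    simp
  linarith

end Coherent

/-! ### Conditional expectations under equivalent measures -/

section CondExp

variable {Ω : Type*} {m₁ m : MeasurableSpace Ω} [mΩ : MeasurableSpace Ω]

theorem condExp_le_of_setIntegral_le {Q : Measure Ω} [IsProbabilityMeasure Q]
    (hm : m ≤ mΩ) {f g : Ω → ℝ} (hf : Integrable f Q)
    (hg : Integrable g Q) (hgm : AEStronglyMeasurable[m] g Q)
    (h : ∀ A, MeasurableSet[m] A → ∫ ω in A, f ω ∂Q ≤ ∫ ω in A, g ω ∂Q) : Q[f|m] ≤ᵐ[Q] g := by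
  have h1 : Q[f|m] ≤ᵐ[Q] Q[g|m] := by
    refine ae_le_of_ae_le_trim (hm := hm) ?_
    refine ae_le_of_forall_setIntegral_le
      (integrable_condExp.trim hm stronglyMeasurable_condExp)
      (integrable_condExp.trim hm stronglyMeasurable_condExp) fun A hA _ => ?_
    rw [← setIntegral_trim hm stronglyMeasurable_condExp hA,
      ← setIntegral_trim hm stronglyMeasurable_condExp hA, setIntegral_condExp hm hf hA,
      setIntegral_condExp hm hg hA]
    exact h A hA
  exact h1.trans (condExp_of_aestronglyMeasurable' hm hgm hg).le

/-- The density of T with respect to R is E_R(dQ/dR | m). Both integrals then equal that of E_R(X |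
m)·E_R(dQ/dR | m) under R. -/
theorem exists_paste {Q R : Measure Ω} [IsProbabilityMeasure Q] [IsProbabilityMeasure R]
    (hQR : Q ≪ R) (hm : m ≤ mΩ) :
    ∃ T : Measure Ω, IsProbabilityMeasure T ∧ T ≪ R ∧ (R ≪ Q → R ≪ T) ∧
      ∀ X : Ω → ℝ, AEStronglyMeasurable X R → ∀ C : ℝ, (∀ᵐ ω ∂ R, |X ω| ≤ C) →
        ∫ ω, X ω ∂T = ∫ ω, (R[X|m]) ω ∂Q := by
  set z : Ω → ℝ := fun ω => (Q.rnDeriv R ω).toReal with hz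
  have hzi : Integrable z R := Measure.integrable_toReal_rnDeriv
  have hz0 : 0 ≤ᵐ[R] R[z|m] := condExp_nonneg (Eventually.of_forall fun _ => ENNReal.toReal_nonneg)
  have hzm : Measurable (R[z|m]) := (stronglyMeasurable_condExp.mono hm).measurable
  let T : Measure Ω := R.withDensity fun ω => ENNReal.ofReal ((R[z|m]) ω)
  have hTR : T ≪ R := withDensity_absolutelyContinuous _ _
  have hint : ∀ X : Ω → ℝ, AEStronglyMeasurable X R → ∀ C : ℝ, (∀ᵐ ω ∂ R, |X ω| ≤ C) →
      ∫ ω, X ω ∂T = ∫ ω, (R[X|m]) ω ∂Q := by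
    intro X hX C hC
    have hXi : Integrable X R := Integrable.of_bound hX C hC
    have hcb : ∀ᵐ ω ∂ R, |(R[X|m]) ω| ≤ C := ae_bdd_abs_condExp_of_ae_bdd_abs hC
    have hcs : StronglyMeasurable[m] (R[X|m]) := stronglyMeasurable_condExp
    have i1 : Integrable (R[z|m] * X) R := by
      have := (integrable_condExp (f := z) (m := m) (μ := R)).bdd_mul hX (c := C) hC
      exact this.congr (Eventually.of_forall fun ω => mul_comm _ _)
    have i2 : Integrable (R[X|m] * z) R :=
      hzi.bdd_mul (hcs.mono hm).aestronglyMeasurable (c := C) hcb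
    have e1 := condExp_mul_of_stronglyMeasurable_left
      (stronglyMeasurable_condExp (f := z) (m := m) (μ := R)) i1 hXi
    have e2 := condExp_mul_of_stronglyMeasurable_left hcs i2 hzi
    have e3 : ∫ ω, X ω ∂T = ∫ ω, (R[z|m] * X) ω ∂ R := by
      rw [integral_withDensity_eq_integral_toReal_smul hzm.ennreal_ofReal
        (Eventually.of_forall fun _ => ENNReal.ofReal_lt_top)]
      refine integral_congr_ae ?_
      filter_upwards [hz0] with ω hω
      rw [ENNReal.toReal_ofReal hω, smul_eq_mul, Pi.mul_apply]
    have e4 : ∫ ω, (R[X|m]) ω ∂Q = ∫ ω, (R[X|m] * z) ω ∂ R := by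
      rw [← integral_rnDeriv_smul hQR]
      exact integral_congr_ae (Eventually.of_forall fun ω => by
        simp only [smul_eq_mul, Pi.mul_apply, hz, mul_comm])
    rw [e3, e4, ← integral_condExp hm, ← integral_condExp hm (f := R[X|m] * z)]
    refine integral_congr_ae ?_
    filter_upwards [e1, e2] with ω h1 h2
    rw [h1, h2, Pi.mul_apply, Pi.mul_apply, mul_comm]
  have hTfin : IsFiniteMeasure T :=
    isFiniteMeasure_withDensity_ofReal integrable_condExp.hasFiniteIntegral
  have hTprob : IsProbabilityMeasure T := by
    have h1 := hint (fun _ => 1) aestronglyMeasurable_const 1 (by simp)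
    rw [condExp_const hm] at h1
    simp only [integral_const, smul_eq_mul, mul_one, probReal_univ] at h1
    exact ⟨by rw [← ENNReal.ofReal_toReal (measure_ne_top T Set.univ)]
              rw [show (T Set.univ).toReal = 1 from h1, ENNReal.ofReal_one]⟩
  refine ⟨T, hTprob, hTR, fun hRQ => Measure.AbsolutelyContinuous.mk fun A hA h0 => ?_, hint⟩
  have hbd : ∀ᵐ ω ∂ R, |A.indicator (fun _ => (1 : ℝ)) ω| ≤ 1 := Eventually.of_forall fun ω => by
    by_cases hω : ω ∈ A <;> simp [hω]
  have h1 := hint (A.indicator fun _ => 1) (measurable_const.indicator hA).aestronglyMeasurable 1 hbd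
  rw [integral_indicator_const _ hA, Measure.real, h0] at h1
  simp only [ENNReal.toReal_zero, zero_smul] at h1
  have hnn : 0 ≤ᵐ[R] R[A.indicator fun _ => (1 : ℝ)|m] :=
    condExp_nonneg (Eventually.of_forall fun ω => Set.indicator_nonneg (fun _ _ => zero_le_one) _)
  have h2 := (integral_eq_zero_iff_of_nonneg_ae (hQR.ae_le hnn) (Integrable.of_bound
    ((stronglyMeasurable_condExp.mono hm).aestronglyMeasurable) 1
    (hQR.ae_le (ae_bdd_abs_condExp_of_ae_bdd_abs hbd)))).1 h1.symm
  have h3 := integral_condExp (μ := R) hm (f := A.indicator fun _ => (1 : ℝ))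
  rw [integral_congr_ae (hRQ.ae_eq h2), integral_indicator_const _ hA] at h3
  simp only [Pi.zero_apply, integral_zero, smul_eq_mul, mul_one] at h3
  exact (measureReal_eq_zero_iff (measure_ne_top R A)).1 h3.symm

variable {P : Measure Ω}

theorem abs_condExp_le_norm {Q : Measure Ω} (hQP : Q ≪ P) (hPQ : P ≪ Q)
    (X : Lp ℝ ∞ P) : ∀ᵐ ω ∂P, |(Q[X|m]) ω| ≤ ‖X‖ :=
  hPQ.ae_le (ae_bdd_abs_condExp_of_ae_bdd_abs (hQP.ae_le (ae_abs_le_norm X)))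

theorem integral_Lp_add {Q : Measure Ω} [IsFiniteMeasure Q] (hQ : Q ≪ P) (X Y : Lp ℝ ∞ P) :
    ∫ ω, (X + Y : Lp ℝ ∞ P) ω ∂Q = ∫ ω, X ω ∂Q + ∫ ω, Y ω ∂Q := by
  rw [← integral_add (integrable_of_absolutelyContinuous hQ X)
    (integrable_of_absolutelyContinuous hQ Y)]
  exact integral_congr_ae (hQ.ae_le (coeFn_add' X Y))

theorem integral_Lp_smul {Q : Measure Ω} (hQ : Q ≪ P) (c : ℝ) (X : Lp ℝ ∞ P) :
    ∫ ω, (c • X : Lp ℝ ∞ P) ω ∂Q = c * ∫ ω, X ω ∂Q := by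
  rw [← integral_const_mul]
  exact integral_congr_ae (hQ.ae_le (coeFn_smul' c X))

/-- Integration with respect to an absolutely continuous measure as a linear functional on
`L^∞(P)`. -/
noncomputable def integralLM {Q : Measure Ω} [IsFiniteMeasure Q] (hQ : Q ≪ P) :
    Lp ℝ ∞ P →ₗ[ℝ] ℝ where
  toFun X := ∫ ω, X ω ∂Q
  map_add' X Y := integral_Lp_add hQ X Y
  map_smul' c X := integral_Lp_smul hQ c X

theorem exists_bounded_representative (X : Lp ℝ ∞ P) :
    ∃ f : Ω → ℝ, Measurable f ∧ (∀ ω, |f ω| ≤ ‖X‖) ∧ X =ᵐ[P] f := by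
  refine ⟨fun ω => max (-‖X‖) (min ‖X‖ (X ω)), measurable_const.max
    (measurable_const.min (Lp.stronglyMeasurable X).measurable), fun ω => abs_le.2
    ⟨le_max_left _ _, max_le (by linarith [norm_nonneg X]) (min_le_left _ _)⟩, ?_⟩
  filter_upwards [ae_abs_le_norm X] with ω hω
  rw [min_eq_right (abs_le.1 hω).2, max_eq_right (abs_le.1 hω).1]

theorem exists_Lp_indicator (X : Lp ℝ ∞ P) {A : Set Ω} (hA : MeasurableSet A) :
    ∃ W : Lp ℝ ∞ P, W =ᵐ[P] A.indicator X := by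
  refine exists_Lp_of_bound ((Lp.aestronglyMeasurable X).indicator hA) ‖X‖ ?_
  filter_upwards [ae_abs_le_norm X] with ω hω
  by_cases h : ω ∈ A
  · rwa [Set.indicator_of_mem h]
  · rw [Set.indicator_of_notMem h, abs_zero]; exact norm_nonneg X

/-- The conditional expectation of a measure which is pasted together from `Q` and `R`. -/
theorem condExp_paste {Q R T : Measure Ω} [IsProbabilityMeasure Q] [IsProbabilityMeasure R]
    [IsProbabilityMeasure T] (hQP : Q ≪ P) (hPQ : P ≪ Q) (hRP : R ≪ P) (hPR : P ≪ R)
    (hTP : T ≪ P) (h₁₂ : m₁ ≤ m) (hm : m ≤ mΩ)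
    (hT : ∀ X : Ω → ℝ, Measurable X → (∃ C : ℝ, ∀ ω, |X ω| ≤ C) →
      ∫ ω, X ω ∂T = ∫ ω, (R[X|m]) ω ∂Q) (X : Lp ℝ ∞ P) :
    T[X|m₁] =ᵐ[T] Q[R[X|m]|m₁] := by
  have hQR : Q ≪ R := hQP.trans hPR
  have hT' : ∀ Y : Lp ℝ ∞ P, ∫ ω, Y ω ∂T = ∫ ω, (R[Y|m]) ω ∂Q := fun Y => by
    obtain ⟨f, hf, hfb, hYf⟩ := exists_bounded_representative Y
    rw [integral_congr_ae (hTP.ae_eq hYf), hT f hf ⟨_, hfb⟩]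
    exact integral_congr_ae (hQR.ae_eq (condExp_congr_ae (hRP.ae_eq hYf.symm)))
  have hRb := abs_condExp_le_norm hRP hPR (m := m) X
  have hRi : Integrable (R[X|m]) Q := Integrable.of_bound
    (stronglyMeasurable_condExp.mono hm).aestronglyMeasurable ‖X‖ (hQP.ae_le hRb)
  set G := Q[R[X|m]|m₁] with hG
  have hGm : StronglyMeasurable[m₁] G := stronglyMeasurable_condExp
  have hGb : ∀ᵐ ω ∂P, |G ω| ≤ ‖X‖ := hPQ.ae_le (ae_bdd_abs_condExp_of_ae_bdd_abs (hQP.ae_le hRb))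
  have hGP : AEStronglyMeasurable G P := (hGm.mono (h₁₂.trans hm)).aestronglyMeasurable
  obtain ⟨G', hG'⟩ := exists_Lp_of_bound hGP ‖X‖ hGb
  have hXT := integrable_of_absolutelyContinuous hTP X
  refine (ae_eq_condExp_of_forall_setIntegral_eq (h₁₂.trans hm) hXT (fun A _ _ => ?_)
    (fun A hA _ => ?_) hGm.aestronglyMeasurable).symm
  · exact ((integrable_of_absolutelyContinuous hTP G').congr (hTP.ae_eq hG')).integrableOn
  · have hAm : MeasurableSet[m] A := h₁₂ A hA
    have hAΩ : MeasurableSet A := hm A hAm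
    obtain ⟨W, hW⟩ := exists_Lp_indicator X hAΩ
    obtain ⟨V, hV⟩ := exists_Lp_indicator G' hAΩ
    have hV' : V =ᵐ[P] A.indicator G := by
      filter_upwards [hV, hG'] with ω h1 h2
      rw [h1]
      by_cases h : ω ∈ A <;> simp [h, h2]
    have e1 : ∫ ω in A, X ω ∂T = ∫ ω in A, (R[X|m]) ω ∂Q := by
      rw [← integral_indicator hAΩ, ← integral_congr_ae (hTP.ae_eq hW), hT',
        ← integral_indicator hAΩ]
      refine integral_congr_ae (hQR.ae_eq ?_)
      exact (condExp_congr_ae (hRP.ae_eq hW)).trans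
        (condExp_indicator (integrable_of_absolutelyContinuous hRP X) hAm)
    have e2 : ∫ ω in A, G ω ∂T = ∫ ω in A, G ω ∂Q := by
      rw [← integral_indicator hAΩ, ← integral_congr_ae (hTP.ae_eq hV'), hT',
        ← integral_indicator hAΩ]
      refine integral_congr_ae (hQR.ae_eq ?_)
      have hVi := (integrable_of_absolutelyContinuous hRP V).congr (hRP.ae_eq hV')
      refine (condExp_congr_ae (hRP.ae_eq hV')).trans (EventuallyEq.of_eq ?_)
      exact condExp_of_stronglyMeasurable hm ((hGm.mono h₁₂).indicator hAm) hVi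
    rw [e1, e2, hG, setIntegral_condExp (h₁₂.trans hm) hRi hA]

end CondExp

/-! ### The spaces `L^∞(F_σ)` -/

section LInf

variable {Ω : Type*} [mΩ : MeasurableSpace Ω] {F : Filtration ℝ≥0 mΩ} {P : Measure Ω}

theorem sigmaAt_le (σ : StoppingTime F) : sigmaAt σ ≤ mΩ := fun _ hA => hA.1

theorem mem_LInf {σ : StoppingTime F} {X : Lp ℝ ∞ P} :
    X ∈ LInf F P σ ↔ AEStronglyMeasurable[sigmaAt σ] X P :=
  mem_lpMeas_iff_aestronglyMeasurable

theorem sigmaAt_infty : sigmaAt (StoppingTime.infty F) = mΩ := by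
  refine le_antisymm (sigmaAt_le _) fun A hA => ⟨hA, fun t => ?_⟩
  have : A ∩ {ω | (StoppingTime.infty F).1 ω ≤ t} = ∅ := by
    refine Set.eq_empty_of_forall_notMem fun ω hω => ?_
    have h : (⊤ : WithTop ℝ≥0) ≤ (t : WithTop ℝ≥0) := hω.2
    exact absurd h (not_le.2 (WithTop.coe_lt_top t))
  rw [this]
  exact @MeasurableSet.empty _ (F t)

theorem mem_LInf_infty (X : Lp ℝ ∞ P) : X ∈ LInf F P (StoppingTime.infty F) := by
  rw [mem_LInf, sigmaAt_infty]
  exact Lp.aestronglyMeasurable X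

/-- Elements of `L^∞(P)` as elements of `L^∞(F_∞)`. -/
def LInf.top (F : Filtration ℝ≥0 mΩ) (X : Lp ℝ ∞ P) : LInf F P (StoppingTime.infty F) :=
  ⟨X, mem_LInf_infty X⟩

theorem LInf.ext_ae {σ : StoppingTime F} {X Y : LInf F P σ}
    (h : (X : Lp ℝ ∞ P) =ᵐ[P] (Y : Lp ℝ ∞ P)) : X = Y :=
  Subtype.ext (Lp.ext h)

theorem LInf.le_iff {σ : StoppingTime F} {X Y : LInf F P σ} :
    X ≤ Y ↔ ∀ᵐ ω ∂P, (X : Lp ℝ ∞ P) ω ≤ (Y : Lp ℝ ∞ P) ω :=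
  (Subtype.coe_le_coe).symm.trans Lp_le_iff

theorem LInf.exists_measurable {σ : StoppingTime F} (X : LInf F P σ) :
    ∃ f : Ω → ℝ, StronglyMeasurable[sigmaAt σ] f ∧ (X : Lp ℝ ∞ P) =ᵐ[P] f :=
  mem_LInf.1 X.2

theorem ind_mem_LInf [IsProbabilityMeasure P] {σ : StoppingTime F} {A : Set Ω}
    (hA : MeasurableSet[sigmaAt σ] A) : ind P (sigmaAt_le σ A hA) ∈ LInf F P σ := by
  rw [mem_LInf]
  exact ⟨A.indicator fun _ => 1, stronglyMeasurable_const.indicator hA, ind_coe _⟩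

end LInf

/-! ### Prices at horizon `∞` -/

section Price

variable {Ω : Type*} [mΩ : MeasurableSpace Ω] {F : Filtration ℝ≥0 mΩ} {P : Measure Ω}

/-- The price `Π_{σ,∞}(X)` as an element of `L^∞(P)`. -/
noncomputable def price (Pr : PriceFamily F P) (σ : StoppingTime F) (X : Lp ℝ ∞ P) : Lp ℝ ∞ P :=
  Pr σ (StoppingTime.infty F) (StoppingTime.le_infty σ) (LInf.top F X)

variable {Pr : PriceFamily F P}

theorem price_mem (σ : StoppingTime F) (X : Lp ℝ ∞ P) : price Pr σ X ∈ LInf F P σ :=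
  SetLike.coe_mem _

theorem IsDynamicPricing.price_mono (h : IsDynamicPricing Pr) (σ : StoppingTime F)
    {X Y : Lp ℝ ∞ P} (hXY : X ≤ Y) : price Pr σ X ≤ price Pr σ Y :=
  h.monotone _ _ _ (LInf.top F X) (LInf.top F Y) hXY

theorem IsDynamicPricing.price_add (h : IsDynamicPricing Pr) (σ : StoppingTime F)
    (X : Lp ℝ ∞ P) {Z : Lp ℝ ∞ P} (hZ : Z ∈ LInf F P σ) :
    price Pr σ (X + Z) = price Pr σ X + Z :=
  congrArg Subtype.val
    (h.translation σ _ (StoppingTime.le_infty σ) (LInf.top F X) ⟨Z, hZ⟩)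

theorem IsDynamicPricing.price_sub (h : IsDynamicPricing Pr) (σ : StoppingTime F)
    (X : Lp ℝ ∞ P) {Z : Lp ℝ ∞ P} (hZ : Z ∈ LInf F P σ) :
    price Pr σ (X - Z) = price Pr σ X - Z := by
  rw [sub_eq_add_neg, h.price_add σ X (neg_mem hZ), sub_eq_add_neg]

theorem IsDynamicPricing.price_zero (h : IsDynamicPricing Pr) (σ : StoppingTime F) :
    price Pr σ 0 = 0 :=
  congrArg Subtype.val (h.normalized σ _ (StoppingTime.le_infty σ))

theorem IsDynamicPricing.price_of_mem (h : IsDynamicPricing Pr) {σ : StoppingTime F}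
    {Z : Lp ℝ ∞ P} (hZ : Z ∈ LInf F P σ) : price Pr σ Z = Z := by
  have := h.price_add σ 0 hZ
  rwa [zero_add, h.price_zero, zero_add] at this

theorem IsSublinear.price_smul (h : IsSublinear Pr) (σ : StoppingTime F) {l : ℝ} (hl : 0 < l)
    (X : Lp ℝ ∞ P) : price Pr σ (l • X) = l • price Pr σ X :=
  congrArg Subtype.val (h σ _ (StoppingTime.le_infty σ) l (LInf.top F X) hl)

theorem IsDynamicPricing.price_add_le (h : IsDynamicPricing Pr) (hs : IsSublinear Pr)
    (σ : StoppingTime F) (X Y : Lp ℝ ∞ P) :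
    price Pr σ (X + Y) ≤ price Pr σ X + price Pr σ Y := by
  have h1 : price Pr σ ((1 / 2 : ℝ) • ((2 : ℝ) • X) + (1 - 1 / 2 : ℝ) • ((2 : ℝ) • Y)) ≤
      (1 / 2 : ℝ) • price Pr σ ((2 : ℝ) • X) + (1 - 1 / 2 : ℝ) • price Pr σ ((2 : ℝ) • Y) :=
    h.convex σ _ (StoppingTime.le_infty σ) (LInf.top F ((2 : ℝ) • X))
      (LInf.top F ((2 : ℝ) • Y)) (1 / 2) (by norm_num) (by norm_num)
  rw [hs.price_smul σ two_pos, hs.price_smul σ two_pos, smul_smul, smul_smul, smul_smul,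
    smul_smul] at h1
  norm_num at h1
  exact h1

/-- Every X ∈ L^∞(F_τ) is its own price at τ, so time consistency reduces all maps of the family to
those with horizon ∞. -/
theorem IsTCPP.price_of_le (h : IsTCPP Pr) {σ τ : StoppingTime F} (hστ : σ ≤ τ)
    (X : LInf F P τ) : (Pr σ τ hστ X : Lp ℝ ∞ P) = price Pr σ X := by
  have h1 := h.timeConsistent σ τ _ hστ (StoppingTime.le_infty τ) (LInf.top F X)
  have h2 : Pr τ _ (StoppingTime.le_infty τ) (LInf.top F X) = X :=
    Subtype.ext (h.price_of_mem X.2)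
  rw [h2] at h1
  exact congrArg Subtype.val h1

theorem IsTCPP.price_price (h : IsTCPP Pr) {ν σ : StoppingTime F} (hνσ : ν ≤ σ)
    (X : Lp ℝ ∞ P) : price Pr ν (price Pr σ X) = price Pr ν X := by
  have h1 := h.timeConsistent ν σ _ hνσ (StoppingTime.le_infty σ) (LInf.top F X)
  have h2 := congrArg Subtype.val h1
  rw [h.price_of_le] at h2
  exact h2

variable [IsProbabilityMeasure P]

theorem const_mem_LInf (σ : StoppingTime F) (c : ℝ) : Lp.const ∞ P c ∈ LInf F P σ :=
  mem_LInf.2 ⟨fun _ => c, stronglyMeasurable_const, Lp.coeFn_const ∞ P c⟩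

/-- Prices are local. -/
theorem IsDynamicPricing.price_indicator (h : IsDynamicPricing Pr) {σ : StoppingTime F}
    {A : Set Ω} (hA : MeasurableSet[sigmaAt σ] A) {W Y : Lp ℝ ∞ P}
    (hW : W =ᵐ[P] A.indicator Y) : price Pr σ W =ᵐ[P] A.indicator (price Pr σ Y) := by
  set b := ‖Y‖
  have hb : 0 ≤ b := norm_nonneg Y
  -- W and Y differ by at most J = b·1_{Aᶜ}, which determines the price on A; |W| ≤ I = b·1_A makes
  -- it vanish off A. Both bounds are F_σ-measurable and pass through the price.
  set I : Lp ℝ ∞ P := b • ind P (sigmaAt_le σ A hA)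
  set J : Lp ℝ ∞ P := b • ind P (sigmaAt_le σ Aᶜ hA.compl)
  have hI : I ∈ LInf F P σ := Submodule.smul_mem _ _ (ind_mem_LInf hA)
  have hJ : J ∈ LInf F P σ := Submodule.smul_mem _ _ (ind_mem_LInf hA.compl)
  have hIc : ∀ᵐ ω ∂P, I ω = b * A.indicator (fun _ => (1 : ℝ)) ω := by
    filter_upwards [coeFn_smul' b (ind P (sigmaAt_le σ A hA)),
      ind_coe (P := P) (sigmaAt_le σ A hA)] with ω h1 h2
    rw [h1, h2]
  have hJc : ∀ᵐ ω ∂P, J ω = b * Aᶜ.indicator (fun _ => (1 : ℝ)) ω := by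
    filter_upwards [coeFn_smul' b (ind P (sigmaAt_le σ Aᶜ hA.compl)),
      ind_coe (P := P) (sigmaAt_le σ Aᶜ hA.compl)] with ω h1 h2
    rw [h1, h2]
  have hY := ae_abs_le_norm Y
  have a1 : W ≤ Y + J := by
    rw [Lp_le_iff]
    filter_upwards [hW, hJc, hY, coeFn_add' Y J] with ω h1 h2 h3 h4
    rw [h1, h4, h2]
    by_cases hω : ω ∈ A
    · simp [hω]
    · simp [hω]; linarith [(abs_le.1 h3).1]
  have a2 : Y ≤ W + J := by
    rw [Lp_le_iff]
    filter_upwards [hW, hJc, hY, coeFn_add' W J] with ω h1 h2 h3 h4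
    rw [h4, h1, h2]
    by_cases hω : ω ∈ A
    · simp [hω]
    · simp [hω]; linarith [(abs_le.1 h3).2]
  have a3 : W ≤ I := by
    rw [Lp_le_iff]
    filter_upwards [hW, hIc, hY] with ω h1 h2 h3
    rw [h1, h2]
    by_cases hω : ω ∈ A
    · simp [hω]; linarith [(abs_le.1 h3).2]
    · simp [hω]
  have a4 : -I ≤ W := by
    rw [Lp_le_iff]
    filter_upwards [hW, hIc, hY, coeFn_neg' I] with ω h1 h2 h3 h4
    rw [h4, h1, h2]
    by_cases hω : ω ∈ A
    · simp [hω]; linarith [(abs_le.1 h3).1]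
    · simp [hω]
  have b1 := h.price_mono σ a1
  have b2 := h.price_mono σ a2
  have b3 := h.price_mono σ a3
  have b4 := h.price_mono σ a4
  rw [h.price_add σ _ hJ] at b1 b2
  rw [h.price_of_mem hI] at b3
  rw [h.price_of_mem (neg_mem hI)] at b4
  filter_upwards [Lp_le_iff.1 b1, Lp_le_iff.1 b2, Lp_le_iff.1 b3, Lp_le_iff.1 b4, hIc, hJc,
    coeFn_add' (price Pr σ Y) J, coeFn_add' (price Pr σ W) J, coeFn_neg' I]
    with ω c1 c2 c3 c4 c5 c6 c7 c8 c9
  rw [c7, c6] at c1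
  rw [c8, c6] at c2
  rw [c5] at c3
  rw [c9, c5] at c4
  by_cases hω : ω ∈ A
  · simp only [hω, Set.indicator_of_mem, Set.indicator_of_notMem, Set.mem_compl_iff,
      not_true_eq_false, not_false_eq_true, mul_zero, add_zero] at *
    linarith
  · simp only [hω, Set.indicator_of_notMem, not_false_eq_true, mul_zero, neg_zero] at *
    linarith

omit [IsProbabilityMeasure P] in
theorem staticZeroCost_subset (Pr : PriceFamily F P) : staticZeroCost Pr ⊆ simpleZeroCost Pr := by
  rintro _ ⟨X, hX, rfl⟩
  refine ⟨0, Fin.elim0, X, Fin.elim0, Fin.elim0, fun i => i.elim0, fun i => i.elim0, hX,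
    fun i => i.elim0, ?_⟩
  simp

/-- The expected price at time zero. -/
noncomputable def meanPrice (Pr : PriceFamily F P) (X : Lp ℝ ∞ P) : ℝ :=
  ∫ ω, price Pr (StoppingTime.zero F) X ω ∂P

omit [IsProbabilityMeasure P] in
theorem meanPrice_price (h : IsTCPP Pr) (σ : StoppingTime F) (X : Lp ℝ ∞ P) :
    meanPrice Pr (price Pr σ X) = meanPrice Pr X := by
  rw [meanPrice, h.price_price (StoppingTime.zero_le σ), meanPrice]

/-- The axioms survive integration. For continuity from below, the prices lie between those of X 0
and of the limit, so dominated convergence applies. -/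
theorem isCoherent_meanPrice (h : IsTCPP Pr) (hs : IsSublinear Pr) :
    IsCoherent (meanPrice Pr) where
  mono X Y hXY := integral_mono_ae
    (integrable_of_absolutelyContinuous Measure.AbsolutelyContinuous.rfl _)
    (integrable_of_absolutelyContinuous Measure.AbsolutelyContinuous.rfl _)
    (Lp_le_iff.1 (h.price_mono _ hXY))
  add_le X Y := by
    rw [meanPrice, meanPrice, meanPrice,
      ← integral_Lp_add Measure.AbsolutelyContinuous.rfl]
    exact integral_mono_ae
      (integrable_of_absolutelyContinuous Measure.AbsolutelyContinuous.rfl _)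
      (integrable_of_absolutelyContinuous Measure.AbsolutelyContinuous.rfl _)
      (Lp_le_iff.1 (h.price_add_le hs _ X Y))
  smul l X hl := by
    rw [meanPrice, hs.price_smul _ hl, integral_Lp_smul Measure.AbsolutelyContinuous.rfl]
    rfl
  add_const X c := by
    rw [meanPrice, h.price_add _ X (const_mem_LInf _ c),
      integral_Lp_add Measure.AbsolutelyContinuous.rfl, integral_congr_ae (Lp.coeFn_const ∞ P c)]
    simp [meanPrice]
  tendsto X Y hX hXY := by
    have h1 := h.continuousFromBelow (StoppingTime.zero F) _ (StoppingTime.le_infty _)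
      (fun n => LInf.top F (X n)) (LInf.top F Y) (fun m n hmn => hX hmn) hXY
    have hup : ∀ n, X n ≤ Y := fun n => by
      rw [Lp_le_iff]
      filter_upwards [hXY, ae_all_iff.2 fun k => Lp_le_iff.1 (hX (Nat.le_add_right n k))]
        with ω a1 a2
      refine ge_of_tendsto a1 ?_
      filter_upwards [eventually_ge_atTop n] with m hm
      obtain ⟨k, rfl⟩ := Nat.exists_eq_add_of_le hm
      exact a2 k
    refine tendsto_integral_of_dominated_convergence
      (fun _ => ‖price Pr (StoppingTime.zero F) (X 0)‖ + ‖price Pr (StoppingTime.zero F) Y‖)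
      (fun n => Lp.aestronglyMeasurable _) (integrable_const _) (fun n => ?_) h1
    filter_upwards [ae_abs_le_norm (price Pr (StoppingTime.zero F) (X 0)),
      ae_abs_le_norm (price Pr (StoppingTime.zero F) Y),
      Lp_le_iff.1 (h.price_mono (StoppingTime.zero F) (hX (Nat.zero_le n))),
      Lp_le_iff.1 (h.price_mono (StoppingTime.zero F) (hup n))] with ω a1 a2 a3 a4
    have b1 := norm_nonneg (price Pr (StoppingTime.zero F) (X 0))
    have b2 := norm_nonneg (price Pr (StoppingTime.zero F) Y)
    rw [Real.norm_eq_abs, abs_le]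
    constructor <;> linarith [(abs_le.1 a1).1, (abs_le.1 a2).2]

/-- Otherwise the price of 1_A, being nonnegative with mean zero, vanishes, and 1_A itself is a free
lunch. Static products are simple strategies without trades, so either condition excludes it. -/
theorem meanPrice_ind_pos (h : IsTCPP Pr)
    (hfl : NoStaticFreeLunch Pr ∨ NoMultiperiodFreeLunch Pr) {A : Set Ω} (hA : MeasurableSet A)
    (hPA : P A ≠ 0) : 0 < meanPrice Pr (ind P hA) := by
  by_contra! hle
  have h0 : 0 ≤ price Pr (StoppingTime.zero F) (ind P hA) := by
    rw [← h.price_zero (StoppingTime.zero F)]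
    exact h.price_mono _ (ind_nonneg hA)
  have h0' : 0 ≤ᵐ[P] (price Pr (StoppingTime.zero F) (ind P hA) : Ω → ℝ) := by
    filter_upwards [Lp_le_iff.1 h0, coeFn_zero' (P := P)] with ω h1 h2
    rwa [h2] at h1
  have h1 : price Pr (StoppingTime.zero F) (ind P hA) = 0 := by
    refine Lp.ext ?_
    have h2 := (integral_eq_zero_iff_of_nonneg_ae h0'
      (integrable_of_absolutelyContinuous Measure.AbsolutelyContinuous.rfl _)).1
      (le_antisymm hle (integral_nonneg_of_ae h0'))
    filter_upwards [h2, coeFn_zero' (P := P)] with ω h3 h4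
    rw [h3, h4]; rfl
  have hst : ind P hA ∈ staticZeroCost Pr :=
    ⟨LInf.top F (ind P hA), le_of_eq (Subtype.ext h1), rfl⟩
  have key : ∀ B : Set (Lp ℝ ∞ P), ind P hA ∈ B →
      closure[weakStar P] (nonnegMultiples B) ∩ {X | 0 ≤ X} = {0} → False := by
    intro B hB hcl
    have hm : ind P hA ∈ closure[weakStar P] (nonnegMultiples B) ∩ {X | 0 ≤ X} :=
      ⟨@subset_closure _ (weakStar P) _ _ ⟨1, zero_le_one, _, hB, (one_smul ℝ _).symm⟩,
        ind_nonneg hA⟩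
    rw [hcl, Set.mem_singleton_iff] at hm
    refine hPA (measure_eq_zero_iff_ae_notMem.2 ?_)
    have h3 := ind_coe (P := P) hA
    rw [hm] at h3
    filter_upwards [h3, coeFn_zero' (P := P)] with ω h4 h5 h6
    rw [h5, Set.indicator_of_mem h6] at h4
    exact zero_ne_one h4
  rcases hfl with hfl | hfl
  · exact key _ hst hfl
  · exact key _ (staticZeroCost_subset Pr hst) hfl

end Price

/-! ### Equivalent measures below a coherent functional -/

section Dominated

variable {Ω : Type*} [mΩ : MeasurableSpace Ω] {P : Measure Ω} [IsProbabilityMeasure P]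
  {ρ : Lp ℝ ∞ P → ℝ}

/-- The absolutely continuous probability measures whose expectation is dominated by `ρ`. -/
def dominated (ρ : Lp ℝ ∞ P → ℝ) : Set (Measure Ω) :=
  {Q | IsProbabilityMeasure Q ∧ Q ≪ P ∧ ∀ X : Lp ℝ ∞ P, ∫ ω, X ω ∂Q ≤ ρ X}

/-- This is the Halmos–Savage exhaustion: countably many of the supports {dQ/dP ≠ 0} cover all the
others up to null sets. -/
theorem exists_seq_dominating (M : Set (Measure Ω)) (hne : M.Nonempty)
    (hM : ∀ Q ∈ M, IsProbabilityMeasure Q ∧ Q ≪ P) :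
    ∃ s : ℕ → M, ∀ A, MeasurableSet A → (∀ n, (s n : Measure Ω) A = 0) → ∀ Q ∈ M, Q A = 0 := by
  have : Nonempty M := hne.to_subtype
  let B : M → Set Ω := fun Q => {ω | (Q : Measure Ω).rnDeriv P ω ≠ 0}
  have hB : ∀ Q, MeasurableSet (B Q) := fun Q =>
    ((Measure.measurable_rnDeriv _ _) (measurableSet_singleton 0)).compl
  obtain ⟨s, hs⟩ := exists_seq_ae_le_iSup (P := P) (fun Q => (B Q).indicator fun _ => (1 : ℝ))
    (fun Q => (measurable_const.indicator (hB Q)).aemeasurable) 1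
    (fun Q => Eventually.of_forall fun ω => by by_cases hω : ω ∈ B Q <;> simp [hω])
  have hzero : ∀ (Q : M) {A : Set Ω}, MeasurableSet A →
      ((Q : Measure Ω) A = 0 ↔ ∀ᵐ ω ∂P, ω ∈ A → ω ∉ B Q) := fun Q A hA => by
    have := (hM Q Q.2).1
    rw [← Measure.setLIntegral_rnDeriv (hM Q Q.2).2 A,
      setLIntegral_eq_zero_iff hA (Measure.measurable_rnDeriv _ _)]
    simp [B]
  refine ⟨s, fun A hA hsA Q hQ => (hzero ⟨Q, hQ⟩ hA).2 ?_⟩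
  filter_upwards [hs ⟨Q, hQ⟩, ae_all_iff.2 fun n => (hzero (s n) hA).1 (hsA n)] with ω h1 h2 hω hωQ
  rw [Set.indicator_of_mem hωQ] at h1
  have h3 : ⨆ n, (B (s n)).indicator (fun _ => (1 : ℝ)) ω = 0 := by
    simp [fun n => h2 n hω]
  rw [h3] at h1
  linarith

/-- The mixture of the exhausting sequence with weights 2^{-(n+1)} stays dominated by ρ and charges
every event charged by some dominated measure. -/
theorem exists_equivalent_dominated (hne : (dominated ρ).Nonempty)
    (hpos : ∀ A, MeasurableSet A → P A ≠ 0 → ∃ Q ∈ dominated ρ, Q A ≠ 0) :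
    ∃ Q ∈ dominated ρ, P ≪ Q := by
  obtain ⟨s, hs⟩ := exists_seq_dominating (P := P) (dominated ρ) hne
    fun Q hQ => ⟨hQ.1, hQ.2.1⟩
  let c : ℕ → ℝ≥0∞ := fun n => 2⁻¹ ^ (n + 1)
  have hc1 : ∑' n, c n = 1 := by
    rw [ENNReal.tsum_geometric_add_one, ENNReal.one_sub_inv_two, inv_inv]
    exact ENNReal.inv_mul_cancel two_ne_zero ENNReal.ofNat_ne_top
  have hcr : HasSum (fun n => (c n).toReal) 1 := by
    have := ENNReal.hasSum_toReal (f := c) (by rw [hc1]; exact ENNReal.one_ne_top)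
    rwa [← ENNReal.tsum_toReal_eq (fun n => by simp [c]), hc1, ENNReal.toReal_one] at this
  let Q : Measure Ω := Measure.sum fun n => c n • (s n : Measure Ω)
  have hQa : ∀ A, MeasurableSet A → Q A = ∑' n, c n * (s n : Measure Ω) A := fun A hA => by
    rw [Measure.sum_apply _ hA]
    rfl
  have hprob : IsProbabilityMeasure Q := ⟨by
    rw [hQa _ MeasurableSet.univ]
    have : ∀ n, (s n : Measure Ω) Set.univ = 1 := fun n => (s n).2.1.measure_univ
    simp only [this, mul_one, hc1]⟩
  have hQP : Q ≪ P := Measure.AbsolutelyContinuous.mk fun A hA h0 => by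
    rw [hQa A hA]
    simp [fun n => (s n).2.2.1 h0]
  refine ⟨Q, ⟨hprob, hQP, fun X => ?_⟩, Measure.AbsolutelyContinuous.mk fun A hA h0 => ?_⟩
  · have h1 := hasSum_integral_measure (integrable_of_absolutelyContinuous hQP X)
    simp only [integral_smul_measure, smul_eq_mul] at h1
    have h2 := hcr.mul_right (ρ X)
    rw [one_mul] at h2
    exact hasSum_le (fun n => mul_le_mul_of_nonneg_left ((s n).2.2.2 X) ENNReal.toReal_nonneg) h1 h2
  · by_contra hPA
    obtain ⟨R, hR, hRA⟩ := hpos A hA hPA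
    refine hRA (hs A hA (fun n => ?_) R hR)
    rw [hQa A hA, ENNReal.tsum_eq_zero] at h0
    exact (mul_eq_zero.1 (h0 n)).resolve_left (by simp [c])

/-- The expectation of a dominated measure can be approximated by dominated measures which are
equivalent to `P`. -/
theorem exists_equivalent_lt (hρ : IsCoherent ρ) {Q₀ : Measure Ω} (hQ₀ : Q₀ ∈ dominated (P := P) ρ)
    (hPQ : P ≪ Q₀) (X : Lp ℝ ∞ P) {a : ℝ} (ha : a < ρ X) :
    ∃ Q ∈ dominated (P := P) ρ, P ≪ Q ∧ a < ∫ ω, X ω ∂Q := by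
  obtain ⟨Q₁, hQ₁, hQ₁P, h1, h2⟩ := hρ.exists_measure_lt X ha
  have := hQ₀.1
  set q := ∫ ω, X ω ∂Q₁
  set q₀ := ∫ ω, X ω ∂Q₀
  obtain ⟨ε, hε0, hε1, hε⟩ : ∃ ε : ℝ, 0 < ε ∧ ε < 1 ∧ a < (1 - ε) * q + ε * q₀ := by
    have hc : ContinuousAt (fun ε : ℝ => (1 - ε) * q + ε * q₀) 0 := by fun_prop
    have h3 : ∀ᶠ ε : ℝ in 𝓝 0, a < (1 - ε) * q + ε * q₀ :=
      hc.eventually (lt_mem_nhds (by simpa using h2))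
    have h3' : ∀ᶠ ε : ℝ in 𝓝[>] 0, a < (1 - ε) * q + ε * q₀ := nhdsWithin_le_nhds h3
    have h4 : ∀ᶠ ε : ℝ in 𝓝[>] 0, ε < 1 := nhdsWithin_le_nhds (gt_mem_nhds one_pos)
    obtain ⟨ε, ⟨h5, h6⟩, h7⟩ := ((h3'.and h4).and self_mem_nhdsWithin).exists
    exact ⟨ε, h7, h6, h5⟩
  let Q : Measure Ω := ENNReal.ofReal (1 - ε) • Q₁ + ENNReal.ofReal ε • Q₀
  have hint : ∀ Y : Lp ℝ ∞ P, ∫ ω, Y ω ∂Q = (1 - ε) * ∫ ω, Y ω ∂Q₁ + ε * ∫ ω, Y ω ∂Q₀ := by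
    intro Y
    rw [integral_add_measure
      ((integrable_of_absolutelyContinuous hQ₁P Y).smul_measure ENNReal.ofReal_ne_top)
      ((integrable_of_absolutelyContinuous hQ₀.2.1 Y).smul_measure ENNReal.ofReal_ne_top),
      integral_smul_measure, integral_smul_measure, ENNReal.toReal_ofReal (by linarith),
      ENNReal.toReal_ofReal hε0.le, smul_eq_mul, smul_eq_mul]
  refine ⟨Q, ⟨⟨?_⟩, Measure.AbsolutelyContinuous.mk fun A _ h0 => ?_, fun Y => ?_⟩,
    Measure.AbsolutelyContinuous.mk fun A _ h0 => ?_, ?_⟩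
  · simp only [Q, Measure.add_apply, Measure.smul_apply, measure_univ, smul_eq_mul, mul_one]
    rw [← ENNReal.ofReal_add (by linarith) hε0.le]
    simp
  · simp [Q, hQ₁P h0, hQ₀.2.1 h0]
  · rw [hint]
    have h3 := h1 Y
    have h4 := hQ₀.2.2 Y
    nlinarith
  · refine hPQ ?_
    simp only [Q, Measure.add_apply, Measure.smul_apply, smul_eq_mul, add_eq_zero, mul_eq_zero,
      ENNReal.ofReal_eq_zero] at h0
    exact h0.2.resolve_left (by linarith)
  · rw [hint]
    exact hε

end Dominated

/-! ### From price families to stable sets -/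

section Representation

variable {Ω : Type*} [mΩ : MeasurableSpace Ω] {F : Filtration ℝ≥0 mΩ} {P : Measure Ω}
  [IsProbabilityMeasure P]

/-- Attaining the essential supremum as a countable supremum gives it an F_σ-measurable version. -/
theorem exists_essSup_condExp {M : Set (Measure Ω)} (hne : M.Nonempty)
    (hM : ∀ Q ∈ M, IsProbabilityMeasure Q ∧ Q ≪ P ∧ P ≪ Q) (σ : StoppingTime F)
    (X : Lp ℝ ∞ P) :
    ∃ (s : ℕ → M) (V : LInf F P σ),
      (V : Lp ℝ ∞ P) =ᵐ[P] (fun ω => ⨆ n, ((s n : Measure Ω)[X|sigmaAt σ]) ω) ∧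
      IsEssSup P (fun Q : M => (Q : Measure Ω)[X|sigmaAt σ]) (V : Lp ℝ ∞ P) := by
  have : Nonempty M := hne.to_subtype
  have hm : ∀ Q : M, AEMeasurable ((Q : Measure Ω)[X|sigmaAt σ]) P := fun Q =>
    (stronglyMeasurable_condExp.mono (sigmaAt_le σ)).measurable.aemeasurable
  have hb : ∀ Q : M, ∀ᵐ ω ∂P, |((Q : Measure Ω)[X|sigmaAt σ]) ω| ≤ ‖X‖ := fun Q =>
    abs_condExp_le_norm (hM Q Q.2).2.1 (hM Q Q.2).2.2 X
  obtain ⟨s, hs⟩ := exists_seq_ae_le_iSup (P := P) _ hm ‖X‖ hb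
  have hgm : StronglyMeasurable[sigmaAt σ]
      fun ω => ⨆ n, ((s n : Measure Ω)[X|sigmaAt σ]) ω :=
    (Measurable.iSup fun n => stronglyMeasurable_condExp.measurable).stronglyMeasurable
  obtain ⟨V, hV⟩ := exists_Lp_of_bound (hgm.mono (sigmaAt_le σ)).aestronglyMeasurable ‖X‖ (by
    filter_upwards [ae_all_iff.2 fun n => hb (s n)] with ω hω using abs_iSup_le_of_forall hω)
  exact ⟨s, ⟨V, mem_LInf.2 ⟨_, hgm, hV⟩⟩, hV, (isEssSup_iSup_seq _ hm s hs).congr hV.symm⟩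

variable {Pr : PriceFamily F P}

theorem meanPrice_zero (h : IsTCPP Pr) (hs : IsSublinear Pr) : meanPrice Pr (0 : Lp ℝ ∞ P) = 0 :=
  (isCoherent_meanPrice h hs).map_zero

omit [IsProbabilityMeasure P] in
theorem integral_indicator_sub {Q : Measure Ω} [IsProbabilityMeasure Q] (hQ : Q ≪ P)
    {A : Set Ω} (hA : MeasurableSet A) {X Y W : Lp ℝ ∞ P}
    (hW : W =ᵐ[P] A.indicator (X - Y : Lp ℝ ∞ P)) :
    ∫ ω, W ω ∂Q = ∫ ω in A, X ω ∂Q - ∫ ω in A, Y ω ∂Q := by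
  rw [integral_congr_ae (hQ.ae_eq hW), integral_indicator hA, ← integral_sub
    (integrable_of_absolutelyContinuous hQ X).integrableOn
    (integrable_of_absolutelyContinuous hQ Y).integrableOn]
  exact integral_congr_ae (ae_restrict_of_ae (hQ.ae_le (coeFn_sub' X Y)))

/-- For A ∈ F_σ let W = 1_A(X - Π_σ(X)). Locality and translation invariance give Π_σ(W) = 0, hence
E_Q(W) ≤ ρ(W) = ρ(Π_σ(W)) = 0. -/
theorem condExp_le_price (h : IsTCPP Pr) (hs : IsSublinear Pr) {Q : Measure Ω}
    (hQ : Q ∈ dominated (P := P) (meanPrice Pr)) (σ : StoppingTime F) (X : Lp ℝ ∞ P) :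
    Q[X|sigmaAt σ] ≤ᵐ[Q] price Pr σ X := by
  have := hQ.1
  refine condExp_le_of_setIntegral_le (sigmaAt_le σ) (integrable_of_absolutelyContinuous hQ.2.1 X)
    (integrable_of_absolutelyContinuous hQ.2.1 _)
    ((mem_LInf.1 (price_mem σ X)).mono_ac hQ.2.1) fun A hA => ?_
  obtain ⟨W, hW⟩ := exists_Lp_indicator (X - price Pr σ X) (sigmaAt_le σ A hA)
  have h1 : price Pr σ W = 0 := by
    refine Lp.ext ?_
    have h2 := h.price_indicator hA hW
    rw [h.price_sub σ X (price_mem σ X), sub_self] at h2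
    filter_upwards [h2, coeFn_zero' (P := P)] with ω h3 h4
    rw [h3, h4]
    by_cases hω : ω ∈ A <;> simp [hω]
  have h2 := hQ.2.2 W
  rw [← meanPrice_price h σ, h1, meanPrice_zero h hs,
    integral_indicator_sub hQ.2.1 (sigmaAt_le σ A hA) hW] at h2
  linarith

/-- The equivalent probability measures whose expectation is dominated by the price at zero. -/
def pricingMeasures (Pr : PriceFamily F P) : Set (Measure Ω) :=
  {Q | Q ∈ dominated (P := P) (meanPrice Pr) ∧ P ≪ Q}

theorem pricingMeasures_nonempty (h : IsTCPP Pr) (hs : IsSublinear Pr)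
    (hfl : NoStaticFreeLunch Pr ∨ NoMultiperiodFreeLunch Pr) : (pricingMeasures Pr).Nonempty := by
  have hρ := isCoherent_meanPrice h hs
  obtain ⟨Q, hQ, hPQ⟩ := exists_equivalent_dominated (P := P) (ρ := meanPrice Pr) (by
      obtain ⟨Q, h1, h2, h3, -⟩ := hρ.exists_measure_lt 0 (a := -1) (by rw [hρ.map_zero]; norm_num)
      exact ⟨Q, h1, h2, h3⟩) (fun A hA hPA => by
      obtain ⟨Q, h1, h2, h3, h4⟩ := hρ.exists_measure_lt _ (meanPrice_ind_pos h hfl hA hPA)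
      refine ⟨Q, ⟨h1, h2, h3⟩, fun h0 => ?_⟩
      rw [integral_congr_ae (h2.ae_eq (ind_coe hA)), integral_indicator_const _ hA, Measure.real,
        h0] at h4
      simp at h4)
  exact ⟨Q, hQ, hPQ⟩

omit [IsProbabilityMeasure P] in
theorem pricingMeasures_equiv {Q : Measure Ω} (hQ : Q ∈ pricingMeasures Pr) :
    IsProbabilityMeasure Q ∧ Q ≪ P ∧ P ≪ Q :=
  ⟨hQ.1.1, hQ.1.2.1, hQ.2⟩

/-- The pasted measure stays dominated: E_Q(E_R(X|F_τ)) ≤ E_Q(Π_τ(X)) ≤ ρ(Π_τ(X)) = ρ(X). -/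
theorem isStableSet_pricingMeasures (h : IsTCPP Pr) (hs : IsSublinear Pr) :
    IsStableSet F (pricingMeasures Pr) := by
  intro Q hQ R hR τ
  have := hQ.1.1
  have := hR.1.1
  have hQR : Q ≪ R := hQ.1.2.1.trans hR.2
  have hRQ : R ≪ Q := hR.1.2.1.trans hQ.2
  obtain ⟨T, hT, hTR, hRT, hint⟩ := exists_paste hQR (sigmaAt_le τ)
  refine ⟨T, ⟨⟨hT, hTR.trans hR.1.2.1, fun X => ?_⟩, hR.2.trans (hRT hRQ)⟩, ?_⟩
  · rw [hint X ((Lp.aestronglyMeasurable X).mono_ac hR.1.2.1) ‖X‖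
      (hR.1.2.1.ae_le (ae_abs_le_norm X))]
    have h1 : ∫ ω, (R[X|sigmaAt τ]) ω ∂Q ≤ ∫ ω, price Pr τ X ω ∂Q :=
      integral_mono_ae (Integrable.of_bound
        (stronglyMeasurable_condExp.mono (sigmaAt_le τ)).aestronglyMeasurable ‖X‖
        (hQ.1.2.1.ae_le (abs_condExp_le_norm hR.1.2.1 hR.2 X)))
        (integrable_of_absolutelyContinuous hQ.1.2.1 _)
        (hQR.ae_le (condExp_le_price h hs hR.1 τ X))
    refine h1.trans ((hQ.1.2.2 _).trans_eq (meanPrice_price h τ X))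
  · rintro X hX ⟨C, hC⟩
    exact hint X hX.aestronglyMeasurable C (Eventually.of_forall hC)

/-- On A = {Π_σ(X) > V} let W = 1_A(X - V), so Π_σ(W) is the positive part of Π_σ(X) - V. All
pricing measures give E_Q(W) ≤ 0, so ρ(W) ≤ 0 by duality, and E_{Q₀}(Π_σ(W)) ≤ ρ(Π_σ(W)) = ρ(W)
forces Π_σ(W) = 0. -/
theorem price_le_of_isEssSup (h : IsTCPP Pr) (hs : IsSublinear Pr)
    (hne : (pricingMeasures Pr).Nonempty) (σ : StoppingTime F) (X : Lp ℝ ∞ P) {V : Lp ℝ ∞ P}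
    (hVm : V ∈ LInf F P σ)
    (hV : ∀ Q ∈ pricingMeasures Pr, Q[X|sigmaAt σ] ≤ᵐ[P] V) : price Pr σ X ≤ V := by
  obtain ⟨Q₀, hQ₀⟩ := hne
  have := hQ₀.1.1
  have hρ := isCoherent_meanPrice h hs
  obtain ⟨d, hdm, hd⟩ := mem_LInf.1 (sub_mem (price_mem (Pr := Pr) σ X) hVm)
  set A : Set Ω := {ω | 0 < d ω} with hAdef
  have hA : MeasurableSet[sigmaAt σ] A := hdm.measurable measurableSet_Ioi
  have hA' : MeasurableSet A := sigmaAt_le σ A hA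
  obtain ⟨W, hW⟩ := exists_Lp_indicator (X - V) hA'
  have hWp : price Pr σ W =ᵐ[P] A.indicator d := by
    have h1 := h.price_indicator hA hW
    rw [h.price_sub σ X hVm] at h1
    filter_upwards [h1, hd] with ω h2 h3
    rw [h2]
    by_cases hω : ω ∈ A <;> simp only [hω, Set.indicator_of_mem, Set.indicator_of_notMem, h3,
      not_false_eq_true]
  have hWle : meanPrice Pr W ≤ 0 := by
    by_contra! hpos
    obtain ⟨Q, hQ, hPQ, h1⟩ := exists_equivalent_lt hρ hQ₀.1 hQ₀.2 W hpos
    have := hQ.1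
    rw [integral_indicator_sub hQ.2.1 hA' hW, ← setIntegral_condExp (sigmaAt_le σ)
      (integrable_of_absolutelyContinuous hQ.2.1 X) hA] at h1
    have h2 : ∫ ω in A, (Q[X|sigmaAt σ]) ω ∂Q ≤ ∫ ω in A, V ω ∂Q :=
      setIntegral_mono_ae integrable_condExp.integrableOn
        (integrable_of_absolutelyContinuous hQ.2.1 V).integrableOn
        (hQ.2.1.ae_le (hV Q ⟨hQ, hPQ⟩))
    linarith
  have h1 := (hQ₀.1.2.2 (price Pr σ W)).trans ((meanPrice_price h σ W).trans_le hWle)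
  have hnn : 0 ≤ᵐ[Q₀] (price Pr σ W : Ω → ℝ) := by
    filter_upwards [hQ₀.1.2.1.ae_eq hWp] with ω h2
    rw [h2]
    exact Set.indicator_nonneg (fun ω hω => le_of_lt hω) ω
  have h2 := (integral_eq_zero_iff_of_nonneg_ae hnn
    (integrable_of_absolutelyContinuous hQ₀.1.2.1 _)).1 (le_antisymm h1 (integral_nonneg_of_ae hnn))
  rw [Lp_le_iff]
  filter_upwards [hQ₀.2.ae_eq h2, hWp, hd, coeFn_sub' (price Pr σ X) V] with ω h3 h4 h5 h6
  rw [h6] at h5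
  rw [h3] at h4
  by_contra! hlt
  have hω : ω ∈ A := by
    show 0 < d ω
    rw [← h5]; linarith
  rw [Set.indicator_of_mem hω] at h4
  have : 0 < d ω := hω
  rw [← h4] at this
  exact lt_irrefl _ this

theorem isRepresentedBy_pricingMeasures (h : IsTCPP Pr) (hs : IsSublinear Pr)
    (hne : (pricingMeasures Pr).Nonempty) : IsRepresentedBy Pr (pricingMeasures Pr) := by
  intro σ τ hστ X
  rw [h.price_of_le hστ]
  refine ⟨aemeasurable_coeFn _, fun Q => Q.2.2.ae_le (condExp_le_price h hs Q.2.1 σ X),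
    fun Z hZ hle => ?_⟩
  obtain ⟨-, V, -, hV⟩ := exists_essSup_condExp hne (fun Q hQ => pricingMeasures_equiv hQ) σ
    (X : Lp ℝ ∞ P)
  have h1 := price_le_of_isEssSup h hs hne σ X V.2 fun Q hQ => hV.upper ⟨Q, hQ⟩
  exact EventuallyLE.trans (Lp_le_iff.1 h1) (hV.least Z hZ hle)

/-- The cases n = 1 and n = -1 bound E_Q(S_τ|F_σ) from above and from below by S_σ. -/
theorem pricingMeasures_subset (h : IsTCPP Pr) (hs : IsSublinear Pr) {d : ℕ}
    {S : Fin (d + 1) → ℝ≥0 → Ω → ℝ} (hS : ExtendsDynamics S Pr) :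
    pricingMeasures Pr ⊆ EquivalentLMM F P S := by
  intro Q hQ
  refine ⟨hQ.1.1, hQ.1.2.1, hQ.2, fun k σ τ hστ X hval hX => ?_⟩
  have e1 := hS k 1 σ τ hστ X hval hX
  have e2 := hS k (-1) σ τ hστ X hval hX
  rw [h.price_of_le hστ] at e1 e2
  simp only [Int.cast_one, one_smul, one_mul] at e1
  simp only [Int.cast_neg, Int.cast_one, neg_smul, one_smul, neg_mul, one_mul] at e2
  have b1 := condExp_le_price h hs hQ.1 σ (X : Lp ℝ ∞ P)
  have b2 := condExp_le_price h hs hQ.1 σ (-X : Lp ℝ ∞ P)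
  have hneg : Q[(-X : Lp ℝ ∞ P)|sigmaAt σ] =ᵐ[Q] -Q[(X : Lp ℝ ∞ P)|sigmaAt σ] :=
    (condExp_congr_ae (hQ.1.2.1.ae_eq (Lp.coeFn_neg _))).trans (condExp_neg _ _)
  filter_upwards [hQ.1.2.1.ae_eq e1, hQ.1.2.1.ae_eq e2, b1, b2, hneg] with ω h1 h2 h3 h4 h5
  rw [h1] at h3
  rw [h5, Pi.neg_apply] at h4
  have h6 : (price Pr σ (-X : Lp ℝ ∞ P)) ω = -valueAt (S k) σ.1 ω := h2
  rw [h6] at h4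
  linarith

end Representation

/-! ### Stable sets are directed -/

section Directed

variable {Ω : Type*} [mΩ : MeasurableSpace Ω] {F : Filtration ℝ≥0 mΩ} {P : Measure Ω}

open Classical in
/-- The stopping time which is `σ` on `A` and `∞` outside `A`. -/
noncomputable def StoppingTime.restrict (σ : StoppingTime F) {A : Set Ω}
    (hA : MeasurableSet[sigmaAt σ] A) : StoppingTime F :=
  ⟨fun ω => if ω ∈ A then σ.1 ω else ⊤, fun t => by
    have : {ω | (if ω ∈ A then σ.1 ω else ⊤) ≤ (t : WithTop ℝ≥0)} = A ∩ {ω | σ.1 ω ≤ t} := by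
      ext ω
      by_cases h : ω ∈ A
      · simp [h]
      · simp only [Set.mem_ofPred_eq, h, if_false, Set.mem_inter_iff, false_and, iff_false]
        exact not_le.2 (WithTop.coe_lt_top t)
    rw [this]
    exact hA.2 t⟩

theorem StoppingTime.restrict_of_mem (σ : StoppingTime F) {A : Set Ω}
    (hA : MeasurableSet[sigmaAt σ] A) {ω : Ω} (hω : ω ∈ A) : (σ.restrict hA).1 ω = σ.1 ω :=
  if_pos hω

theorem StoppingTime.restrict_of_notMem (σ : StoppingTime F) {A : Set Ω}
    (hA : MeasurableSet[sigmaAt σ] A) {ω : Ω} (hω : ω ∉ A) : (σ.restrict hA).1 ω = ⊤ :=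
  if_neg hω

theorem StoppingTime.le_restrict (σ : StoppingTime F) {A : Set Ω}
    (hA : MeasurableSet[sigmaAt σ] A) : σ ≤ σ.restrict hA := fun ω => by
  show σ.1 ω ≤ (σ.restrict hA).1 ω
  by_cases hω : ω ∈ A
  · rw [σ.restrict_of_mem hA hω]
  · rw [σ.restrict_of_notMem hA hω]; exact le_top

theorem sigmaAt_restrict_inter (σ : StoppingTime F) {A : Set Ω}
    (hA : MeasurableSet[sigmaAt σ] A) (B : Set Ω) :
    MeasurableSet[sigmaAt (σ.restrict hA)] (A ∩ B) ↔ MeasurableSet[sigmaAt σ] (A ∩ B) := by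
  have h : ∀ t : ℝ≥0, (A ∩ B) ∩ {ω | (σ.restrict hA).1 ω ≤ t} = (A ∩ B) ∩ {ω | σ.1 ω ≤ t} := by
    intro t
    ext ω
    simp only [Set.mem_inter_iff, Set.mem_ofPred_eq]
    refine and_congr_right fun hω => ?_
    rw [σ.restrict_of_mem hA hω.1]
  constructor
  · exact fun hB => ⟨hB.1, fun t => h t ▸ hB.2 t⟩
  · exact fun hB => ⟨hB.1, fun t => (h t).symm ▸ hB.2 t⟩

theorem sigmaAt_restrict_compl_inter (σ : StoppingTime F) {A : Set Ω}
    (hA : MeasurableSet[sigmaAt σ] A) (B : Set Ω) :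
    MeasurableSet[sigmaAt (σ.restrict hA)] (Aᶜ ∩ B) ↔ MeasurableSet (Aᶜ ∩ B) := by
  refine ⟨fun hB => hB.1, fun hB => ⟨hB, fun t => ?_⟩⟩
  have : (Aᶜ ∩ B) ∩ {ω | (σ.restrict hA).1 ω ≤ t} = ∅ := by
    refine Set.eq_empty_of_forall_notMem fun ω hω => ?_
    have h1 : (σ.restrict hA).1 ω ≤ t := hω.2
    rw [σ.restrict_of_notMem hA hω.1.1] at h1
    exact absurd h1 (not_le.2 (WithTop.coe_lt_top t))
  rw [this]
  exact @MeasurableSet.empty _ (F t)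

/-- The σ-algebra of the restricted time agrees with F_σ on A and with F_∞ off A, where X is already
known. -/
theorem condExp_restrict {R : Measure Ω} [IsProbabilityMeasure R] (hR : R ≪ P)
    (σ : StoppingTime F) {A : Set Ω} (hA : MeasurableSet[sigmaAt σ] A) (X : Lp ℝ ∞ P) :
    R[X|sigmaAt (σ.restrict hA)] =ᵐ[R] A.indicator (R[X|sigmaAt σ]) + Aᶜ.indicator X := by
  have hAτ : MeasurableSet[sigmaAt (σ.restrict hA)] A := sigmaAt_mono (σ.le_restrict hA) A hA
  have h1 := condExp_ae_eq_restrict_of_measurableSpace_eq_on (f := (X : Ω → ℝ)) (μ := R)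
    (sigmaAt_le (σ.restrict hA)) (sigmaAt_le σ) hAτ (sigmaAt_restrict_inter σ hA)
  have h2 := condExp_ae_eq_restrict_of_measurableSpace_eq_on (f := (X : Ω → ℝ)) (μ := R)
    (sigmaAt_le (σ.restrict hA)) le_rfl hAτ.compl (sigmaAt_restrict_compl_inter σ hA)
  rw [condExp_of_stronglyMeasurable le_rfl (Lp.stronglyMeasurable X)
    (integrable_of_absolutelyContinuous hR X)] at h2
  have h1' := (ae_restrict_iff' (sigmaAt_le σ A hA)).1 h1
  have h2' := (ae_restrict_iff' (sigmaAt_le σ A hA).compl).1 h2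
  filter_upwards [h1', h2'] with ω h3 h4
  by_cases hω : ω ∈ A
  · simp [hω, h3 hω]
  · simp [hω, h4 hω]

/-- T follows Q, switching to R at time σ only on A, the event where R gives the larger conditional
expectation. Its own conditional expectation is the maximum of the two. -/
theorem IsStableSet.exists_ge {M : Set (Measure Ω)}
    (hM : ∀ Q ∈ M, IsProbabilityMeasure Q ∧ Q ≪ P ∧ P ≪ Q) (hst : IsStableSet F M)
    (σ : StoppingTime F) (X : Lp ℝ ∞ P) {Q R : Measure Ω} (hQ : Q ∈ M) (hR : R ∈ M) :
    ∃ T ∈ M, Q[X|sigmaAt σ] ≤ᵐ[P] T[X|sigmaAt σ] ∧ R[X|sigmaAt σ] ≤ᵐ[P] T[X|sigmaAt σ] := by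
  obtain ⟨_, hQP, hPQ⟩ := hM Q hQ
  obtain ⟨_, hRP, hPR⟩ := hM R hR
  set A : Set Ω := {ω | (Q[X|sigmaAt σ]) ω ≤ (R[X|sigmaAt σ]) ω} with hAdef
  have hA : MeasurableSet[sigmaAt σ] A :=
    stronglyMeasurable_condExp.measurableSet_le stronglyMeasurable_condExp
  obtain ⟨T, hT, hTX⟩ := hst Q hQ R hR (σ.restrict hA)
  obtain ⟨_, hTP, hPT⟩ := hM T hT
  have h1 := condExp_paste hQP hPQ hRP hPR hTP (sigmaAt_mono (σ.le_restrict hA))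
    (sigmaAt_le _) hTX X
  have hQR : Q ≪ R := hQP.trans hPR
  have hXQ := integrable_of_absolutelyContinuous hQP X
  have hRi : Integrable (R[X|sigmaAt σ]) Q := Integrable.of_bound
    (stronglyMeasurable_condExp.mono (sigmaAt_le σ)).aestronglyMeasurable ‖X‖
    (hQP.ae_le (abs_condExp_le_norm hRP hPR X))
  have hAΩ := sigmaAt_le σ A hA
  have h2 := condExp_congr_ae (m := sigmaAt σ) (hQR.ae_eq (condExp_restrict hRP σ hA X))
  have h3 := condExp_add (hRi.indicator hAΩ) (hXQ.indicator hAΩ.compl) (sigmaAt σ)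
  have h4 : Q[A.indicator (R[X|sigmaAt σ])|sigmaAt σ] = A.indicator (R[X|sigmaAt σ]) :=
    condExp_of_stronglyMeasurable (sigmaAt_le σ) (stronglyMeasurable_condExp.indicator hA)
      (hRi.indicator hAΩ)
  have h5 := condExp_indicator (m := sigmaAt σ) hXQ hA.compl
  have key : ∀ᵐ ω ∂P, (T[X|sigmaAt σ]) ω =
      A.indicator (R[X|sigmaAt σ]) ω + Aᶜ.indicator (Q[X|sigmaAt σ]) ω := by
    filter_upwards [hPT.ae_eq h1, hPQ.ae_eq h2, hPQ.ae_eq h3, hPQ.ae_eq h5] with ω a1 a2 a3 a5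
    rw [a1, a2, a3, Pi.add_apply, h4, a5]
  refine ⟨T, hT, ?_, ?_⟩
  · filter_upwards [key] with ω hω
    rw [hω]
    by_cases h : ω ∈ A
    · have h' : (Q[X|sigmaAt σ]) ω ≤ (R[X|sigmaAt σ]) ω := h
      simpa [h] using h'
    · simp [h]
  · filter_upwards [key] with ω hω
    rw [hω]
    by_cases h : ω ∈ A
    · simp [h]
    · have h' : ¬ (Q[X|sigmaAt σ]) ω ≤ (R[X|sigmaAt σ]) ω := h
      simpa [h] using (not_le.1 h').le

/-- The essential supremum over a stable set is the limit of a sequence of conditional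
expectations. -/
theorem IsStableSet.exists_seq_tendsto [IsProbabilityMeasure P] {M : Set (Measure Ω)}
    (hne : M.Nonempty) (hM : ∀ Q ∈ M, IsProbabilityMeasure Q ∧ Q ≪ P ∧ P ≪ Q)
    (hst : IsStableSet F M) (σ : StoppingTime F) (X : Lp ℝ ∞ P) {V : Ω → ℝ}
    (hV : IsEssSup P (fun Q : M => (Q : Measure Ω)[X|sigmaAt σ]) V) :
    ∃ R : ℕ → M, ∀ᵐ ω ∂P,
      Tendsto (fun n => ((R n : Measure Ω)[X|sigmaAt σ]) ω) atTop (𝓝 (V ω)) := by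
  obtain ⟨s, V', hV's, hV'⟩ := exists_essSup_condExp hne hM σ X
  have hstep : ∀ Q R : M, ∃ T : M,
      (Q : Measure Ω)[X|sigmaAt σ] ≤ᵐ[P] (T : Measure Ω)[X|sigmaAt σ] ∧
      (R : Measure Ω)[X|sigmaAt σ] ≤ᵐ[P] (T : Measure Ω)[X|sigmaAt σ] := fun Q R => by
    obtain ⟨T, hT, h1, h2⟩ := hst.exists_ge hM σ X Q.2 R.2
    exact ⟨⟨T, hT⟩, h1, h2⟩
  choose join hj1 hj2 using hstep
  obtain ⟨R, hR0, hR⟩ : ∃ R : ℕ → M, R 0 = s 0 ∧ ∀ n, R (n + 1) = join (R n) (s (n + 1)) :=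
    ⟨fun n => Nat.rec (s 0) (fun n Q => join Q (s (n + 1))) n, rfl, fun _ => rfl⟩
  have hle : ∀ n i, i ≤ n →
      (s i : Measure Ω)[X|sigmaAt σ] ≤ᵐ[P] (R n : Measure Ω)[X|sigmaAt σ] := by
    intro n
    induction n with
    | zero => intro i hi; rw [Nat.le_zero.1 hi, hR0]
    | succ n ih =>
      intro i hi
      rw [hR]
      rcases Nat.le_succ_iff.1 hi with hi | rfl
      · exact (ih i hi).trans (hj1 _ _)
      · exact hj2 _ _
  have hle' : ∀ᵐ ω ∂P, ∀ n i, i ≤ n → ((s i : Measure Ω)[X|sigmaAt σ]) ω ≤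
      ((R n : Measure Ω)[X|sigmaAt σ]) ω := by
    rw [ae_all_iff]; intro n
    rw [ae_all_iff]; intro i
    by_cases hi : i ≤ n
    · filter_upwards [hle n i hi] with ω hω _ using hω
    · exact Eventually.of_forall fun ω h => absurd h hi
  have hRV : ∀ n, (R n : Measure Ω)[X|sigmaAt σ] ≤ᵐ[P] V := fun n => hV.upper (R n)
  refine ⟨R, ?_⟩
  filter_upwards [hle', ae_all_iff.2 hRV, hV'.ae_eq hV, hV's] with ω h1 h2 h3 h4
  rw [Metric.tendsto_atTop]
  intro ε hε
  have h5 : V ω - ε < ⨆ n, ((s n : Measure Ω)[X|sigmaAt σ]) ω := by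
    rw [← h4, h3]; linarith
  obtain ⟨i, hi⟩ := exists_lt_of_lt_ciSup h5
  refine ⟨i, fun n hn => ?_⟩
  have h6 := h1 n i hn
  have h7 := h2 n
  rw [Real.dist_eq, abs_lt]
  constructor <;> linarith

end Directed

/-! ### From stable sets to price families -/

section Converse

variable {Ω : Type*} [mΩ : MeasurableSpace Ω] {F : Filtration ℝ≥0 mΩ} {P : Measure Ω}
  {M : Set (Measure Ω)} {Pr : PriceFamily F P}

theorem LInf.coe_add_ae {σ : StoppingTime F} (X Y : LInf F P σ) :
    ∀ᵐ ω ∂P, ((X + Y : LInf F P σ) : Lp ℝ ∞ P) ω = (X : Lp ℝ ∞ P) ω + (Y : Lp ℝ ∞ P) ω :=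
  coeFn_add' _ _

theorem LInf.coe_smul_ae {σ : StoppingTime F} (c : ℝ) (X : LInf F P σ) :
    ∀ᵐ ω ∂P, ((c • X : LInf F P σ) : Lp ℝ ∞ P) ω = c * (X : Lp ℝ ∞ P) ω :=
  coeFn_smul' _ _

theorem LInf.coe_neg_ae {σ : StoppingTime F} (X : LInf F P σ) :
    ∀ᵐ ω ∂P, ((-X : LInf F P σ) : Lp ℝ ∞ P) ω = -(X : Lp ℝ ∞ P) ω :=
  coeFn_neg' _

theorem condExp_Lp_add {Q : Measure Ω} [IsProbabilityMeasure Q] (hQP : Q ≪ P) (hPQ : P ≪ Q)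
    (σ : StoppingTime F) (X Y : Lp ℝ ∞ P) : ∀ᵐ ω ∂P,
      (Q[(X + Y : Lp ℝ ∞ P)|sigmaAt σ]) ω = (Q[X|sigmaAt σ]) ω + (Q[Y|sigmaAt σ]) ω :=
  hPQ.ae_le ((condExp_congr_ae (hQP.ae_eq (Lp.coeFn_add X Y))).trans
    (condExp_add (integrable_of_absolutelyContinuous hQP X)
      (integrable_of_absolutelyContinuous hQP Y) _))

theorem condExp_Lp_smul {Q : Measure Ω} (hQP : Q ≪ P) (hPQ : P ≪ Q)
    (σ : StoppingTime F) (c : ℝ) (X : Lp ℝ ∞ P) : ∀ᵐ ω ∂P,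
      (Q[(c • X : Lp ℝ ∞ P)|sigmaAt σ]) ω = c * (Q[X|sigmaAt σ]) ω :=
  hPQ.ae_le ((condExp_congr_ae (hQP.ae_eq (Lp.coeFn_smul c X))).trans (condExp_smul c _ _))

theorem condExp_Lp_neg {Q : Measure Ω} (hQP : Q ≪ P) (hPQ : P ≪ Q)
    (σ : StoppingTime F) (X : Lp ℝ ∞ P) : ∀ᵐ ω ∂P,
      (Q[(-X : Lp ℝ ∞ P)|sigmaAt σ]) ω = -(Q[X|sigmaAt σ]) ω :=
  hPQ.ae_le ((condExp_congr_ae (hQP.ae_eq (Lp.coeFn_neg X))).trans (condExp_neg _ _))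

theorem condExp_Lp_of_mem {Q : Measure Ω} [IsProbabilityMeasure Q] (hQP : Q ≪ P) (hPQ : P ≪ Q)
    (σ : StoppingTime F) (Z : LInf F P σ) : Q[(Z : Lp ℝ ∞ P)|sigmaAt σ] =ᵐ[P] (Z : Lp ℝ ∞ P) :=
  hPQ.ae_eq (condExp_of_aestronglyMeasurable' (sigmaAt_le σ)
    ((mem_LInf.1 Z.2).mono_ac hQP) (integrable_of_absolutelyContinuous hQP _))

theorem condExp_Lp_mono {Q : Measure Ω} [IsProbabilityMeasure Q] (hQP : Q ≪ P) (hPQ : P ≪ Q)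
    (σ : StoppingTime F) {X Y : Lp ℝ ∞ P} (h : X ≤ Y) :
    Q[X|sigmaAt σ] ≤ᵐ[P] Q[Y|sigmaAt σ] :=
  hPQ.ae_le (condExp_mono (integrable_of_absolutelyContinuous hQP X)
    (integrable_of_absolutelyContinuous hQP Y) (hQP.ae_le (Lp_le_iff.1 h)))

theorem IsRepresentedBy.condExp_le (hR : IsRepresentedBy Pr M) {Q : Measure Ω} (hQ : Q ∈ M)
    {σ τ : StoppingTime F} (h : σ ≤ τ) (X : LInf F P τ) :
    Q[(X : Lp ℝ ∞ P)|sigmaAt σ] ≤ᵐ[P] (Pr σ τ h X : Lp ℝ ∞ P) :=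
  (hR σ τ h X).upper ⟨Q, hQ⟩

theorem IsRepresentedBy.le_of_forall (hR : IsRepresentedBy Pr M)
    {σ τ : StoppingTime F} (h : σ ≤ τ) (X : LInf F P τ) (Z : LInf F P σ)
    (hZ : ∀ Q ∈ M, Q[(X : Lp ℝ ∞ P)|sigmaAt σ] ≤ᵐ[P] (Z : Lp ℝ ∞ P)) : Pr σ τ h X ≤ Z :=
  LInf.le_iff.2 ((hR σ τ h X).least _ (aemeasurable_coeFn _) fun Q => hZ Q Q.2)

theorem IsRepresentedBy.isDynamicPricing (hne : M.Nonempty)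
    (hM : ∀ Q ∈ M, IsProbabilityMeasure Q ∧ Q ≪ P ∧ P ≪ Q) (hR : IsRepresentedBy Pr M) :
    IsDynamicPricing Pr where
  monotone σ τ h X Y hXY := hR.le_of_forall h X _ fun Q hQ => by
    obtain ⟨_, hQP, hPQ⟩ := hM Q hQ
    exact (condExp_Lp_mono hQP hPQ σ hXY).trans (hR.condExp_le hQ h Y)
  translation σ τ h X Z := by
    have hadd : ∀ Q ∈ M, ∀ᵐ ω ∂P,
        (Q[((X + LInf.incl h Z : LInf F P τ) : Lp ℝ ∞ P)|sigmaAt σ]) ω =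
          (Q[(X : Lp ℝ ∞ P)|sigmaAt σ]) ω + (Z : Lp ℝ ∞ P) ω := fun Q hQ => by
      obtain ⟨_, hQP, hPQ⟩ := hM Q hQ
      filter_upwards [condExp_Lp_add hQP hPQ σ (X : Lp ℝ ∞ P) (Z : Lp ℝ ∞ P),
        condExp_Lp_of_mem hQP hPQ σ Z] with ω h1 h2
      rw [h2] at h1
      exact h1
    refine le_antisymm (hR.le_of_forall h _ _ fun Q hQ => ?_) ?_
    · filter_upwards [hadd Q hQ, hR.condExp_le hQ h X, LInf.coe_add_ae (Pr σ τ h X) Z]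
        with ω h1 h2 h3
      rw [h1, h3]
      linarith
    · rw [← le_sub_iff_add_le]
      refine hR.le_of_forall h _ _ fun Q hQ => ?_
      filter_upwards [hadd Q hQ, hR.condExp_le hQ h (X + LInf.incl h Z),
        coeFn_sub' (Pr σ τ h (X + LInf.incl h Z) : Lp ℝ ∞ P) (Z : Lp ℝ ∞ P)] with ω h1 h2 h3
      have h4 : ((Pr σ τ h (X + LInf.incl h Z) - Z : LInf F P σ) : Lp ℝ ∞ P) ω =
        (Pr σ τ h (X + LInf.incl h Z) : Lp ℝ ∞ P) ω - (Z : Lp ℝ ∞ P) ω := h3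
      rw [h4]
      linarith
  convex σ τ h X Y l hl0 hl1 := hR.le_of_forall h _ _ fun Q hQ => by
    obtain ⟨_, hQP, hPQ⟩ := hM Q hQ
    filter_upwards [condExp_Lp_add hQP hPQ σ (l • X : Lp ℝ ∞ P) ((1 - l) • Y : Lp ℝ ∞ P),
      condExp_Lp_smul hQP hPQ σ l (X : Lp ℝ ∞ P), condExp_Lp_smul hQP hPQ σ (1 - l) (Y : Lp ℝ ∞ P),
      hR.condExp_le hQ h X, hR.condExp_le hQ h Y,
      LInf.coe_add_ae (l • Pr σ τ h X) ((1 - l) • Pr σ τ h Y), LInf.coe_smul_ae l (Pr σ τ h X),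
      LInf.coe_smul_ae (1 - l) (Pr σ τ h Y)] with ω h1 h2 h3 h4 h5 h6 h7 h8
    rw [h6, h7, h8]
    refine (h1.trans (by rw [h2, h3])).trans_le ?_
    exact add_le_add (mul_le_mul_of_nonneg_left h4 hl0)
      (mul_le_mul_of_nonneg_left h5 (by linarith))
  normalized σ τ h := by
    have hzero : ∀ Q ∈ M, Q[((0 : LInf F P τ) : Lp ℝ ∞ P)|sigmaAt σ] =ᵐ[P]
        ((0 : LInf F P σ) : Lp ℝ ∞ P) := fun Q hQ => by
      obtain ⟨_, hQP, hPQ⟩ := hM Q hQ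
      exact condExp_Lp_of_mem hQP hPQ σ 0
    refine le_antisymm (hR.le_of_forall h _ _ fun Q hQ => (hzero Q hQ).le) ?_
    obtain ⟨Q, hQ⟩ := hne
    exact LInf.le_iff.2 ((hzero Q hQ).symm.le.trans (hR.condExp_le hQ h 0))

theorem IsRepresentedBy.smul_le (hM : ∀ Q ∈ M, IsProbabilityMeasure Q ∧ Q ≪ P ∧ P ≪ Q)
    (hR : IsRepresentedBy Pr M) {σ τ : StoppingTime F} (h : σ ≤ τ) {l : ℝ} (hl : 0 ≤ l)
    (X : LInf F P τ) : Pr σ τ h (l • X) ≤ l • Pr σ τ h X :=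
  hR.le_of_forall h _ _ fun Q hQ => by
    obtain ⟨_, hQP, hPQ⟩ := hM Q hQ
    filter_upwards [condExp_Lp_smul hQP hPQ σ l (X : Lp ℝ ∞ P), hR.condExp_le hQ h X,
      LInf.coe_smul_ae l (Pr σ τ h X)] with ω h1 h2 h3
    rw [h3]
    exact h1.trans_le (mul_le_mul_of_nonneg_left h2 hl)

theorem IsRepresentedBy.isSublinear (hM : ∀ Q ∈ M, IsProbabilityMeasure Q ∧ Q ≪ P ∧ P ≪ Q)
    (hR : IsRepresentedBy Pr M) : IsSublinear Pr := by
  intro σ τ h l X hl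
  refine le_antisymm (hR.smul_le hM h hl.le X) ?_
  have h1 := hR.smul_le hM h (inv_nonneg.2 hl.le) (l • X)
  rw [smul_smul, inv_mul_cancel₀ hl.ne', one_smul] at h1
  have h2 := smul_mono_Lp hl.le h1
  have h3 : l • (l⁻¹ • Pr σ τ h (l • X)) = Pr σ τ h (l • X) := by
    rw [smul_smul, mul_inv_cancel₀ hl.ne', one_smul]
  have h4 : l • Pr σ τ h X ≤ l • (l⁻¹ • Pr σ τ h (l • X)) := h2
  rwa [h3] at h4

/-- For ≤, approximate Π_{σ,τ}(X) by E_{R n}(X|F_σ); pasting Q with `R n` at σ stays in M, so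
E_Q(E_{R n}(X|F_σ)|F_ν) ≤ Π_{ν,τ}(X), and the limit is taken under integrals over F_ν-events. For ≥,
the tower property under a single Q suffices. -/
theorem IsRepresentedBy.isTimeConsistent [IsProbabilityMeasure P] (hne : M.Nonempty)
    (hM : ∀ Q ∈ M, IsProbabilityMeasure Q ∧ Q ≪ P ∧ P ≪ Q) (hst : IsStableSet F M)
    (hR : IsRepresentedBy Pr M) : IsTimeConsistent Pr := by
  intro ν σ τ h₁ h₂ X
  refine le_antisymm (hR.le_of_forall h₁ _ _ fun Q hQ => ?_) (hR.le_of_forall _ _ _ fun Q hQ => ?_)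
  · obtain ⟨_, hQP, hPQ⟩ := hM Q hQ
    obtain ⟨R, hRlim⟩ := hst.exists_seq_tendsto hne hM σ (X : Lp ℝ ∞ P) (hR σ τ h₂ X)
    set V : Lp ℝ ∞ P := (Pr σ τ h₂ X).1
    set W : Lp ℝ ∞ P := (Pr ν τ (h₁.trans h₂) X).1
    refine hPQ.ae_le (condExp_le_of_setIntegral_le (sigmaAt_le ν)
      (integrable_of_absolutelyContinuous hQP V) (integrable_of_absolutelyContinuous hQP W)
      ((mem_LInf.1 (SetLike.coe_mem (Pr ν τ (h₁.trans h₂) X))).mono_ac hQP) fun A hA => ?_)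
    have hRb : ∀ n, ∀ᵐ ω ∂Q, |((R n : Measure Ω)[(X : Lp ℝ ∞ P)|sigmaAt σ]) ω| ≤ ‖(X : Lp ℝ ∞ P)‖ := fun n =>
      hQP.ae_le (abs_condExp_le_norm (hM _ (R n).2).2.1 (hM _ (R n).2).2.2 _)
    have hRm : ∀ n, AEStronglyMeasurable ((R n : Measure Ω)[(X : Lp ℝ ∞ P)|sigmaAt σ]) Q := fun n =>
      (stronglyMeasurable_condExp.mono (sigmaAt_le σ)).aestronglyMeasurable
    have hlim : Tendsto (fun n => ∫ ω in A, ((R n : Measure Ω)[(X : Lp ℝ ∞ P)|sigmaAt σ]) ω ∂Q) atTop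
        (𝓝 (∫ ω in A, V ω ∂Q)) :=
      tendsto_integral_of_dominated_convergence (fun _ => ‖(X : Lp ℝ ∞ P)‖)
        (fun n => (hRm n).restrict) (integrable_const _) (fun n => ae_restrict_of_ae (hRb n))
        (ae_restrict_of_ae (hQP.ae_le hRlim))
    refine le_of_tendsto' hlim fun n => ?_
    obtain ⟨_, hRP, hPR⟩ := hM _ (R n).2
    obtain ⟨T, hT, hTX⟩ := hst Q hQ (R n) (R n).2 σ
    obtain ⟨_, hTP, hPT⟩ := hM T hT
    have h1 := condExp_paste hQP hPQ hRP hPR hTP (sigmaAt_mono h₁) (sigmaAt_le σ) hTX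
      (X : Lp ℝ ∞ P)
    have h2 := hR.condExp_le hT (h₁.trans h₂) X
    have h3 : Q[(R n : Measure Ω)[(X : Lp ℝ ∞ P)|sigmaAt σ]|sigmaAt ν] ≤ᵐ[Q] W := by
      filter_upwards [hQP.ae_le (hPT.ae_eq h1), hQP.ae_le h2] with ω h4 h5
      rw [← h4]
      exact h5
    rw [← setIntegral_condExp (sigmaAt_le ν) (Integrable.of_bound (hRm n) _ (hRb n)) hA]
    exact setIntegral_mono_ae integrable_condExp.integrableOn
      (integrable_of_absolutelyContinuous hQP W).integrableOn h3
  · obtain ⟨_, hQP, hPQ⟩ := hM Q hQ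
    have hi : Integrable (Q[(X : Lp ℝ ∞ P)|sigmaAt σ]) Q := integrable_condExp
    have h1 : Q[Q[(X : Lp ℝ ∞ P)|sigmaAt σ]|sigmaAt ν] =ᵐ[Q] Q[(X : Lp ℝ ∞ P)|sigmaAt ν] :=
      condExp_condExp_of_le (sigmaAt_mono h₁) (sigmaAt_le σ)
    have h2 : Q[Q[(X : Lp ℝ ∞ P)|sigmaAt σ]|sigmaAt ν] ≤ᵐ[Q]
        Q[(Pr σ τ h₂ X : Lp ℝ ∞ P)|sigmaAt ν] :=
      condExp_mono hi (integrable_of_absolutelyContinuous hQP _)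
        (hQP.ae_le (hR.condExp_le hQ h₂ X))
    exact EventuallyLE.trans (hPQ.ae_le (h1.symm.le.trans h2)) (hR.condExp_le hQ h₁ _)

/-- The limit L of the increasing prices lies below the price of Y. Conversely L dominates each
E_Q(X_n|F_σ), hence each E_Q(Y|F_σ) by dominated convergence, hence their essential supremum. -/
theorem IsRepresentedBy.isContinuousFromBelow [IsProbabilityMeasure P] (hne : M.Nonempty)
    (hM : ∀ Q ∈ M, IsProbabilityMeasure Q ∧ Q ≪ P ∧ P ≪ Q)
    (hR : IsRepresentedBy Pr M) : IsContinuousFromBelow Pr := by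
  intro σ τ h X Y hX hXY
  have hdyn := hR.isDynamicPricing hne hM
  have hup : ∀ n, X n ≤ Y := fun n => by
    rw [LInf.le_iff]
    filter_upwards [hXY, ae_all_iff.2 fun k => LInf.le_iff.1 (hX (Nat.le_add_right n k))]
      with ω a1 a2
    refine ge_of_tendsto a1 ?_
    filter_upwards [eventually_ge_atTop n] with m hm
    obtain ⟨k, rfl⟩ := Nat.exists_eq_add_of_le hm
    exact a2 k
  have hmono : ∀ᵐ ω ∂P, Monotone fun n => (Pr σ τ h (X n) : Lp ℝ ∞ P) ω := by
    filter_upwards [ae_all_iff.2 fun n =>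
      LInf.le_iff.1 (hdyn.monotone σ τ h _ _ (hX (Nat.le_succ n)))] with ω hω
    exact monotone_nat_of_le_succ hω
  have hle : ∀ᵐ ω ∂P, ∀ n, (Pr σ τ h (X n) : Lp ℝ ∞ P) ω ≤ (Pr σ τ h Y : Lp ℝ ∞ P) ω :=
    ae_all_iff.2 fun n => LInf.le_iff.1 (hdyn.monotone σ τ h _ _ (hup n))
  -- F_σ-measurable versions are chosen so that their supremum is F_σ-measurable at every point.
  choose p hpm hp using fun n => LInf.exists_measurable (Pr σ τ h (X n))
  set L : Ω → ℝ := fun ω => ⨆ n, p n ω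
  have hp' := ae_all_iff.2 hp
  have hLm : StronglyMeasurable[sigmaAt σ] L :=
    (Measurable.iSup fun n => (hpm n).measurable).stronglyMeasurable
  have hlim : ∀ᵐ ω ∂P, Tendsto (fun n => (Pr σ τ h (X n) : Lp ℝ ∞ P) ω) atTop (𝓝 (L ω)) := by
    filter_upwards [hmono, hle, hp'] with ω h1 h2 h3
    have h4 := tendsto_atTop_ciSup h1 ⟨_, by rintro _ ⟨n, rfl⟩; exact h2 n⟩
    simp only [h3] at h4 ⊢
    exact h4
  have hLY : L ≤ᵐ[P] (Pr σ τ h Y : Lp ℝ ∞ P) := by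
    filter_upwards [hlim, hle] with ω h1 h2 using le_of_tendsto' h1 h2
  have hXL : ∀ n, ∀ᵐ ω ∂P, (Pr σ τ h (X n) : Lp ℝ ∞ P) ω ≤ L ω := fun n => by
    filter_upwards [hlim, hmono] with ω h1 h2 using h2.ge_of_tendsto h1 n
  set C := ‖(Pr σ τ h (X 0) : Lp ℝ ∞ P)‖ + ‖(Pr σ τ h Y : Lp ℝ ∞ P)‖
  have hLb : ∀ᵐ ω ∂P, |L ω| ≤ C := by
    filter_upwards [hLY, hXL 0, ae_abs_le_norm (Pr σ τ h (X 0) : Lp ℝ ∞ P),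
      ae_abs_le_norm (Pr σ τ h Y : Lp ℝ ∞ P)] with ω h1 h2 h3 h4
    have b1 := norm_nonneg (Pr σ τ h (X 0) : Lp ℝ ∞ P)
    have b2 := norm_nonneg (Pr σ τ h Y : Lp ℝ ∞ P)
    rw [abs_le]
    constructor <;> simp only [C] <;> linarith [(abs_le.1 h3).1, (abs_le.1 h4).2]
  obtain ⟨L', hL'⟩ := exists_Lp_of_bound (hLm.mono (sigmaAt_le σ)).aestronglyMeasurable C hLb
  have hYL : Pr σ τ h Y ≤ ⟨L', mem_LInf.2 ⟨L, hLm, hL'⟩⟩ := by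
    refine hR.le_of_forall h _ _ fun Q hQ => ?_
    obtain ⟨_, hQP, hPQ⟩ := hM Q hQ
    refine hPQ.ae_le (condExp_le_of_setIntegral_le (sigmaAt_le σ)
      (integrable_of_absolutelyContinuous hQP _) (integrable_of_absolutelyContinuous hQP L')
      ⟨L, hLm, hQP.ae_eq hL'⟩ fun A hA => ?_)
    have hXb : ∀ n, ∀ᵐ ω ∂P, ‖(X n : Lp ℝ ∞ P) ω‖ ≤
        ‖(X 0 : Lp ℝ ∞ P)‖ + ‖(Y : Lp ℝ ∞ P)‖ := fun n => by
      filter_upwards [LInf.le_iff.1 (hX (Nat.zero_le n)), LInf.le_iff.1 (hup n),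
        ae_abs_le_norm (X 0 : Lp ℝ ∞ P), ae_abs_le_norm (Y : Lp ℝ ∞ P)] with ω h1 h2 h3 h4
      have b1 := norm_nonneg (X 0 : Lp ℝ ∞ P)
      have b2 := norm_nonneg (Y : Lp ℝ ∞ P)
      rw [Real.norm_eq_abs, abs_le]
      constructor <;> linarith [(abs_le.1 h3).1, (abs_le.1 h4).2]
    have hint : Tendsto (fun n => ∫ ω in A, (X n : Lp ℝ ∞ P) ω ∂Q) atTop
        (𝓝 (∫ ω in A, (Y : Lp ℝ ∞ P) ω ∂Q)) :=
      tendsto_integral_of_dominated_convergence _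
        (fun n => (integrable_of_absolutelyContinuous hQP _).aestronglyMeasurable.restrict)
        (integrable_const (‖(X 0 : Lp ℝ ∞ P)‖ + ‖(Y : Lp ℝ ∞ P)‖))
        (fun n => ae_restrict_of_ae (hQP.ae_le (hXb n))) (ae_restrict_of_ae (hQP.ae_le hXY))
    refine le_of_tendsto' hint fun n => ?_
    rw [← setIntegral_condExp (sigmaAt_le σ) (integrable_of_absolutelyContinuous hQP _) hA]
    refine setIntegral_mono_ae integrable_condExp.integrableOn
      (integrable_of_absolutelyContinuous hQP L').integrableOn (hQP.ae_le ?_)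
    filter_upwards [hR.condExp_le hQ h (X n), hXL n, hL'] with ω h1 h2 h3
    rw [h3]
    exact h1.trans h2
  filter_upwards [hlim, hLY, LInf.le_iff.1 hYL, hL'] with ω h1 h2 h3 h4
  have h5 : (Pr σ τ h Y : Lp ℝ ∞ P) ω ≤ L' ω := h3
  rw [h4] at h5
  rwa [le_antisymm h5 h2]

theorem IsRepresentedBy.ext {Pr' : PriceFamily F P} (hR : IsRepresentedBy Pr M)
    (hR' : IsRepresentedBy Pr' M) : Pr = Pr' := by
  funext σ τ h X
  exact LInf.ext_ae ((hR σ τ h X).ae_eq (hR' σ τ h X))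

theorem exists_isRepresentedBy [IsProbabilityMeasure P] (hne : M.Nonempty)
    (hM : ∀ Q ∈ M, IsProbabilityMeasure Q ∧ Q ≪ P ∧ P ≪ Q) :
    ∃ Pr : PriceFamily F P, IsRepresentedBy Pr M := by
  choose s V _ hV using fun (σ : StoppingTime F) (X : Lp ℝ ∞ P) =>
    exists_essSup_condExp hne hM σ X
  exact ⟨fun σ _ _ X => V σ X, fun σ _ _ X => hV σ X⟩

/-! ### Absence of free lunches and extension of the dynamics. -/

theorem isClosed_integral_nonpos {Q : Measure Ω} [IsFiniteMeasure P] [IsFiniteMeasure Q]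
    (hQ : Q ≪ P) : IsClosed[weakStar P] {X : Lp ℝ ∞ P | ∫ ω, X ω ∂Q ≤ 0} := by
  have hg : MemLp (fun ω => (Q.rnDeriv P ω).toReal) 1 P :=
    memLp_one_iff_integrable.2 Measure.integrable_toReal_rnDeriv
  have hcont : @Continuous (Lp ℝ ∞ P) ℝ (weakStar P) _
      fun X => ∫ ω, (hg.toLp _ : Lp ℝ 1 P) ω * X ω ∂P :=
    (@continuous_pi_iff _ _ _ (weakStar P) _ fun (X : Lp ℝ ∞ P) (g : Lp ℝ 1 P) =>
      ∫ ω, g ω * X ω ∂P).1 continuous_induced_dom (hg.toLp _)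
  have heq : ∀ X : Lp ℝ ∞ P, ∫ ω, (hg.toLp _ : Lp ℝ 1 P) ω * X ω ∂P = ∫ ω, X ω ∂Q := fun X => by
    rw [← integral_rnDeriv_smul hQ]
    refine integral_congr_ae ?_
    filter_upwards [hg.coeFn_toLp] with ω hω
    rw [hω, smul_eq_mul]
  simp only [heq] at hcont
  exact @IsClosed.preimage _ _ (weakStar P) _ _ hcont _ isClosed_Iic

theorem closure_inter_nonneg_eq [IsFiniteMeasure P] {Q : Measure Ω} [IsProbabilityMeasure Q]
    (hQP : Q ≪ P) (hPQ : P ≪ Q) {B : Set (Lp ℝ ∞ P)} (hBne : B.Nonempty)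
    (hB : ∀ X ∈ B, ∫ ω, X ω ∂Q ≤ 0) :
    closure[weakStar P] (nonnegMultiples B) ∩ {X | 0 ≤ X} = {0} := by
  refine Set.Subset.antisymm ?_ ?_
  · rintro X ⟨hX, hX0⟩
    have hsub : closure[weakStar P] (nonnegMultiples B) ⊆ {X : Lp ℝ ∞ P | ∫ ω, X ω ∂Q ≤ 0} := by
      refine @closure_minimal _ (weakStar P) _ _ ?_ (isClosed_integral_nonpos hQP)
      rintro _ ⟨l, hl, Y, hY, rfl⟩
      show ∫ ω, (l • Y : Lp ℝ ∞ P) ω ∂Q ≤ 0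
      rw [integral_Lp_smul hQP]
      exact mul_nonpos_of_nonneg_of_nonpos hl (hB Y hY)
    have h1 : ∫ ω, X ω ∂Q ≤ 0 := hsub hX
    have h2 : 0 ≤ᵐ[P] (X : Ω → ℝ) := by
      filter_upwards [Lp_le_iff.1 hX0, coeFn_zero' (P := P)] with ω h3 h4
      rwa [h4] at h3
    have h3 := (integral_eq_zero_iff_of_nonneg_ae (hQP.ae_le h2)
      (integrable_of_absolutelyContinuous hQP X)).1
      (le_antisymm h1 (integral_nonneg_of_ae (hQP.ae_le h2)))
    refine Lp.ext ((hPQ.ae_eq h3).trans (Lp.coeFn_zero _ _ _).symm)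
  · rintro _ rfl
    obtain ⟨Y, hY⟩ := hBne
    exact ⟨@subset_closure _ (weakStar P) _ _ ⟨0, le_rfl, Y, hY, (zero_smul ℝ Y).symm⟩,
      le_refl (0 : Lp ℝ ∞ P)⟩

/-- Each trade loses under Q, because with prices taken at the trading time E_Q(Z|·) ≤ Π(Z) ≤ -Π(-Y)
≤ E_Q(Y|·). -/
theorem IsRepresentedBy.integral_nonpos_of_simpleZeroCost
    (hR : IsRepresentedBy Pr M) {Q : Measure Ω} (hQ : Q ∈ M)
    (hM : IsProbabilityMeasure Q ∧ Q ≪ P ∧ P ≪ Q) {W : Lp ℝ ∞ P} (hW : W ∈ simpleZeroCost Pr) :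
    ∫ ω, W ω ∂Q ≤ 0 := by
  obtain ⟨_, hQP, hPQ⟩ := hM
  obtain ⟨n, r, X₀, Y, Z, -, -, hX₀, hYZ, rfl⟩ := hW
  have h0 : ∫ ω, (X₀ : Lp ℝ ∞ P) ω ∂Q ≤ 0 := by
    rw [← integral_condExp (sigmaAt_le (StoppingTime.zero F))]
    refine integral_nonpos_of_ae ?_
    refine hQP.ae_le ?_
    filter_upwards [hR.condExp_le hQ (StoppingTime.zero_le _) X₀, LInf.le_iff.1 hX₀,
      coeFn_zero' (P := P)] with ω h1 h2 h3
    exact h1.trans (h2.trans_eq h3)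
  have h1 : ∀ i, ∫ ω, (Z i : Lp ℝ ∞ P) ω ∂Q ≤ ∫ ω, (Y i : Lp ℝ ∞ P) ω ∂Q := fun i => by
    rw [← integral_condExp (sigmaAt_le (r i)) (f := (Z i : Lp ℝ ∞ P)),
      ← integral_condExp (sigmaAt_le (r i)) (f := (Y i : Lp ℝ ∞ P))]
    refine integral_mono_ae integrable_condExp integrable_condExp (hQP.ae_le ?_)
    filter_upwards [hR.condExp_le hQ (StoppingTime.le_infty (r i)) (Z i),
      hR.condExp_le hQ (StoppingTime.le_infty (r i)) (-Y i), LInf.le_iff.1 (hYZ i),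
      condExp_Lp_neg hQP hPQ (r i) (Y i : Lp ℝ ∞ P),
      LInf.coe_neg_ae (Pr (r i) _ (StoppingTime.le_infty _) (-Y i))] with ω a1 a2 a3 a4 a5
    have a6 := a4.symm.trans_le a2
    rw [a5] at a3
    linarith
  have h2 : ((X₀ + ∑ i, (Z i - Y i) : LInf F P (StoppingTime.infty F)) : Lp ℝ ∞ P) =
      X₀ + ∑ i, ((Z i : Lp ℝ ∞ P) - (Y i : Lp ℝ ∞ P)) := by
    simp
  have h3 : integralLM hQP (X₀ + ∑ i, ((Z i : Lp ℝ ∞ P) - (Y i : Lp ℝ ∞ P))) ≤ 0 := by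
    rw [map_add, map_sum]
    refine add_nonpos h0 (Finset.sum_nonpos fun i _ => ?_)
    rw [map_sub]
    exact sub_nonpos.2 (h1 i)
  rw [h2]
  exact h3

theorem IsRepresentedBy.noFreeLunch [IsProbabilityMeasure P] (hne : M.Nonempty)
    (hM : ∀ Q ∈ M, IsProbabilityMeasure Q ∧ Q ≪ P ∧ P ≪ Q) (hR : IsRepresentedBy Pr M) :
    NoStaticFreeLunch Pr ∧ NoMultiperiodFreeLunch Pr := by
  have h0 : (0 : Lp ℝ ∞ P) ∈ staticZeroCost Pr :=
    ⟨0, le_of_eq ((hR.isDynamicPricing hne hM).normalized _ _ _), rfl⟩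
  obtain ⟨Q, hQ⟩ := hne
  obtain ⟨_, hQP, hPQ⟩ := hM Q hQ
  exact ⟨closure_inter_nonneg_eq hQP hPQ ⟨0, h0⟩ fun X hX =>
      hR.integral_nonpos_of_simpleZeroCost hQ (hM Q hQ) (staticZeroCost_subset Pr hX),
    closure_inter_nonneg_eq hQP hPQ ⟨0, staticZeroCost_subset Pr h0⟩ fun X hX =>
      hR.integral_nonpos_of_simpleZeroCost hQ (hM Q hQ) hX⟩

theorem IsRepresentedBy.extendsDynamics {d : ℕ} {S : Fin (d + 1) → ℝ≥0 → Ω → ℝ}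
    (hne : M.Nonempty) (hM : M ⊆ EquivalentLMM F P S) (hR : IsRepresentedBy Pr M) :
    ExtendsDynamics S Pr := by
  intro k n σ τ h X hval hX
  have key : ∀ Q ∈ M, Q[((n : ℝ) • X : LInf F P τ)|sigmaAt σ] =ᵐ[P]
      fun ω => (n : ℝ) * valueAt (S k) σ.1 ω := fun Q hQ => by
    obtain ⟨_, hQP, hPQ, hQS⟩ := hM hQ
    filter_upwards [hPQ.ae_eq (hQS k σ τ h X hval hX),
      condExp_Lp_smul hQP hPQ σ (n : ℝ) (X : Lp ℝ ∞ P)] with ω h1 h2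
    rw [← h1]
    exact h2
  obtain ⟨Q, hQ⟩ := hne
  -- Measurability of S_σ is read off from its agreement with a conditional expectation; leastness
  -- of the essential supremum needs it.
  have hme : AEMeasurable (fun ω => (n : ℝ) * valueAt (S k) σ.1 ω) P :=
    ((stronglyMeasurable_condExp.mono (sigmaAt_le σ)).measurable.aemeasurable).congr (key Q hQ)
  exact ((hR σ τ h ((n : ℝ) • X)).least _ hme fun R => (key R R.2).le).antisymm
    ((key Q hQ).symm.le.trans (hR.condExp_le hQ h _))

end Converse

end TCPP

theorem mainTheorem10 {Ω : Type*} [mΩ : MeasurableSpace Ω] (P : Measure Ω)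
    [IsProbabilityMeasure P] (F : Filtration ℝ≥0 mΩ) (hF : TCPP.UsualAssumptions F P)
    {d : ℕ} (S : Fin (d + 1) → ℝ≥0 → Ω → ℝ) (hS : TCPP.IsReferenceMarket F P S) :
    (∀ Pr : TCPP.PriceFamily F P, TCPP.IsTCPP Pr → TCPP.IsSublinear Pr →
      (TCPP.NoStaticFreeLunch Pr ∨ TCPP.NoMultiperiodFreeLunch Pr) →
      TCPP.ExtendsDynamics S Pr →
        ∃ 𝒬 : Set (Measure Ω), 𝒬.Nonempty ∧ 𝒬 ⊆ TCPP.EquivalentLMM F P S ∧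
          TCPP.IsStableSet F 𝒬 ∧ TCPP.IsRepresentedBy Pr 𝒬) ∧
    (∀ 𝒬 : Set (Measure Ω), 𝒬.Nonempty → 𝒬 ⊆ TCPP.EquivalentLMM F P S →
      TCPP.IsStableSet F 𝒬 →
        (∃! Pr : TCPP.PriceFamily F P, TCPP.IsRepresentedBy Pr 𝒬) ∧
        ∀ Pr : TCPP.PriceFamily F P, TCPP.IsRepresentedBy Pr 𝒬 →
          TCPP.IsTCPP Pr ∧ TCPP.IsSublinear Pr ∧ TCPP.NoStaticFreeLunch Pr ∧
            TCPP.NoMultiperiodFreeLunch Pr ∧ TCPP.ExtendsDynamics S Pr) := by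
  refine ⟨fun Pr h hs hfl hext => ?_, fun 𝒬 hne hsub hst => ?_⟩
  · have hne := TCPP.pricingMeasures_nonempty h hs hfl
    exact ⟨TCPP.pricingMeasures Pr, hne, TCPP.pricingMeasures_subset h hs hext,
      TCPP.isStableSet_pricingMeasures h hs, TCPP.isRepresentedBy_pricingMeasures h hs hne⟩
  · have hM : ∀ Q ∈ 𝒬, IsProbabilityMeasure Q ∧ Q ≪ P ∧ P ≪ Q := fun Q hQ =>
      ⟨(hsub hQ).1, (hsub hQ).2.1, (hsub hQ).2.2.1⟩
    obtain ⟨Pr, hPr⟩ := TCPP.exists_isRepresentedBy (F := F) hne hM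
    refine ⟨⟨Pr, hPr, fun Pr' hPr' => hPr'.ext hPr⟩, fun Pr' hR => ?_⟩
    exact ⟨⟨hR.isDynamicPricing hne hM, hR.isTimeConsistent hne hM hst,
      hR.isContinuousFromBelow hne hM⟩, hR.isSublinear hM, (hR.noFreeLunch hne hM).1,
      (hR.noFreeLunch hne hM).2, hR.extendsDynamics hne hsub⟩
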